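/- **Notation.** Let $\mathcal D$ be the set of dyadic intervals of $\mathbb R$, $h_I$ the $L^2$-normalized Haar wavelet of $I\in\mathcal D$, $\bar\chi_I=\chi_I/|I|$, $h_{I\times J}=h_I\otimes h_J$, $g_R=\langle g,h_R\rangle$ for a dyadic rectangle $R=I\times J$, $f_J(x)=\langle f(x,\cdot),h_J\rangle$, $f_I(y)=\langle f(\cdot,y),h_I\rangle$, and let $\langle f\rangle_E$ be the average of $f$ over $E$. All functions are real-valued. For $g$ with finite Haar support (a finite linear combination of the $h_R$) let $$\pi^4_g(f)=\sum_{I,J\in\mathcal D}\langle f_J\rangle_I\,g_{I\times J}\,h_I\otimes\bar\chi_J,\qquad G(x,y)_{I,J}=g_{I\times J}|I\times J|^{-1/2}\chi_I(x)\chi_J(y),$$ and put $$\|g\|_{BMO}=\sup_{\Omega}\Big(\frac1{|\Omega|}\sum_{R\subseteq\Omega}g_R^2\Big)^{1/2},\qquad \|g\|_p'=\sup\sum_{I,J\in\mathcal D}\langle|f_J|\rangle_I\,\langle|f'_I|\rangle_J\,|g_{I\times J}|,$$ where $\Omega$ ranges over the open sets of finite positive measure and the second supremum is over $\|f\|_{L^p(\mathbb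 R^2)}=\|f'\|_{L^{p'}(\mathbb R^2)}=1$, $1/p+1/p'=1$. Let $\pi^3_{g}(f)=\sum_{I,J}\langle f_J\rangle_I\langle g_I\rangle_J\,h_I\otimes h_J$, and let $H^1_d(\mathbb R\otimes\mathbb R)$ be the space of integrable functions whose strong dyadic maximal function is integrable. For an $n\times n$ real matrix $H=(H_{ij})_{0\le i,j<n}$ let $g^H$ be the function with $g^H_{I\times J}=H_{ij}|I\times J|^{1/2}$ if $I,J\subseteq[0,1]$, $|I|=2^{-i}$, $|J|=2^{-j}$, $0\le i,j<n$, and $g^H_{I\times J}=0$ for all other $I,J$. An $n\times n$ matrix $H$ is a Hadamard matrix if its entries are $\pm1$ and $HH^{T}=n\,\mathrm{Id}$. **Statement.** Below, $C_p$ denotes finite constants that depend only on $p$. 1. For $1<p<\infty$ and every $g$ with finite Haar support, $\|\pi^4_g\|_{L^p\to L^p}\le C_p\,\big\|\,\|G(x,y)\|_{\ell^2(\mathcal D)\to\ell^2(\mathcal D)}\big\|_{L^\infty(\mathbb R^2)}$. 2. Let $n\ge1$. If all entries of $H$ are $\pm1$, then $\|g^H\|_{BMO}=n$. If moreover $H$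 is a Hadamard matrix, then for $g=g^H$ one has $\|G(x,y)\|_{\ell^2\to\ell^2}=\sqrt n$ at every $(x,y)\in[0,1)^2$, and $\|\pi^4_{g}\|_{L^p\to L^p}\le C_p\sqrt n$ for $1<p<\infty$. For every $k\ge0$, Sylvester's matrix of size $n=2^k$ (defined by $S_0=(1)$, $S_{k+1}=\begin{pmatrix}S_k&S_k\\S_k&-S_k\end{pmatrix}$) is a Hadamard matrix. 3. Let $n\ge1$, let $H$ be the $n\times n$ identity matrix, and $g=g^H$. Then $\|g\|_{BMO}\ge\sqrt n$, $\|G(x,y)\|_{\ell^2\to\ell^2}=1$ at every $(x,y)\in[0,1)^2$, and $\|g\|_p'\le C_p$ for $1<p<\infty$. 4. Consequently, for $1<p<\infty$ the product BMO norm is not controlled by $\|\pi^4_g\|_{L^p\to L^p}$, nor by $\|g\|'_p$, nor by $\sup|\langle\pi^3_{f'}(f),g\rangle|$ over $\|f\|_{L^p}=\|f'\|_{L^{p'}}=1$: for each of these three quantities $N(g)$ and every $C<\infty$ there is a $g$ with finite Haar support and $C\,N(g)<\|g\|_{BMO}$. 5. Weak factorization of $H^1_d(\mathbb R\otimes\mathbb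 R)$ through $\pi^3$ fails: there is $g'\in H^1_d(\mathbb R\otimes\mathbb R)$ such that for no $1<p<\infty$ can one write $g'=\sum_i\lambda_i\,\pi^3_{f'_i}(f_i)$ (even only in the sense of convergence of each Haar coefficient) with $\lambda_i\ge0$, $\sum_i\lambda_i<\infty$, $\|f_i\|_{L^p(\mathbb R^2)}=\|f'_i\|_{L^{p'}(\mathbb R^2)}=1$. Moreover, the Haar coefficients of this $g'$ are not of the form $g'_{I\times J}=\langle u_J\otimes v_I\rangle_{I\times J}$ for all $I,J\in\mathcal D$, with $u_J,v_I\in L^2(\mathbb R)$ and $\sum_{I,J}\|u_J\otimes v_I\|_{L^2(\mathbb R^2)}^2<\infty$. -/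

import Mathlib

open MeasureTheory
open scoped ENNReal NNReal

noncomputable section

/-- The dyadic interval `[pos * 2 ^ (-gen), (pos + 1) * 2 ^ (-gen))` of the line; every dyadic
interval is represented by exactly one such pair. -/
structure DyadicInterval where
  /-- the generation: the interval has length `2 ^ (-gen)` -/
  gen : ℤ
  /-- the index of the interval within its generation -/
  pos : ℤ

namespace DyadicInterval

/-- The length `|I|`. -/
def len (I : DyadicInterval) : ℝ := (2 : ℝ) ^ (-I.gen)

/-- The point set of `I`. -/
def toSet (I : DyadicInterval) : Set ℝ :=
  Set.Ico ((I.pos : ℝ) * I.len) (((I.pos : ℝ) + 1) * I.len)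

/-- The left half of `I`. -/
def leftHalf (I : DyadicInterval) : Set ℝ :=
  Set.Ico ((I.pos : ℝ) * I.len) (((I.pos : ℝ) + 1 / 2) * I.len)

/-- The right half of `I`. -/
def rightHalf (I : DyadicInterval) : Set ℝ :=
  Set.Ico (((I.pos : ℝ) + 1 / 2) * I.len) (((I.pos : ℝ) + 1) * I.len)

/-- The characteristic function `χ_I`. -/
def char (I : DyadicInterval) : ℝ → ℝ := I.toSet.indicator 1

/-- The normalized characteristic function `χ_I / |I|`. -/
def avgChar (I : DyadicInterval) (x : ℝ) : ℝ := I.char x / I.len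

/-- The `L²`-normalized Haar wavelet `h_I`. -/
def haar (I : DyadicInterval) (x : ℝ) : ℝ :=
  (I.leftHalf.indicator 1 x - I.rightHalf.indicator 1 x) / Real.sqrt I.len

end DyadicInterval

/-- A pair `R = (I, J)` stands for the dyadic rectangle `I × J`. -/
abbrev DyadicRectangle := DyadicInterval × DyadicInterval

namespace DyadicRectangle

/-- The point set of `R = I × J`. -/
def toSet (R : DyadicRectangle) : Set (ℝ × ℝ) := R.1.toSet ×ˢ R.2.toSet

/-- The area `|R|`. -/
def area (R : DyadicRectangle) : ℝ := R.1.len * R.2.len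

/-- The rectangular Haar wavelet `h_R = h_I ⊗ h_J`. -/
def haar (R : DyadicRectangle) (z : ℝ × ℝ) : ℝ := R.1.haar z.1 * R.2.haar z.2

end DyadicRectangle

/-- The Haar coefficient `g_R = ⟨g, h_R⟩`. -/
def haarCoeff (g : ℝ × ℝ → ℝ) (R : DyadicRectangle) : ℝ := ∫ z, g z * R.haar z

/-- `g` has finite Haar support: it is a finite linear combination of rectangular Haar wavelets. -/
def FiniteHaarSupport (g : ℝ × ℝ → ℝ) : Prop :=
  ∃ (s : Finset DyadicRectangle) (a : DyadicRectangle → ℝ),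
    g =ᵐ[volume] fun z => ∑ R ∈ s, a R * R.haar z

/-- `⟨f, χ̄_I ⊗ h_J⟩`, the average over `I` of `f_J`. -/
def coeffAvgHaar (f : ℝ × ℝ → ℝ) (R : DyadicRectangle) : ℝ :=
  ∫ z, f z * (R.1.avgChar z.1 * R.2.haar z.2)

/-- `⟨f, h_I ⊗ χ̄_J⟩`, the average over `J` of `f_I`. -/
def coeffHaarAvg (f : ℝ × ℝ → ℝ) (R : DyadicRectangle) : ℝ :=
  ∫ z, f z * (R.1.haar z.1 * R.2.avgChar z.2)

/-- The paraproduct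
`π⁴_g(f) = ∑_{I,J} ⟨f, χ̄_I ⊗ h_J⟩ ⟨g, h_I ⊗ h_J⟩ h_I ⊗ χ̄_J`
(for `g` with finite Haar support only finitely many terms are nonzero). -/
def pi4 (g f : ℝ × ℝ → ℝ) (z : ℝ × ℝ) : ℝ :=
  ∑' R : DyadicRectangle,
    coeffAvgHaar f R * haarCoeff g R * (R.1.haar z.1 * R.2.avgChar z.2)

/-- The operator norm of `π⁴_g` from `L^p(ℝ²)` to `L^p(ℝ²)`, as an extended nonnegative real. -/
def pi4Norm (p : ℝ≥0∞) (g : ℝ × ℝ → ℝ) : ℝ≥0∞ :=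
  ⨆ (f : ℝ × ℝ → ℝ) (_ : MemLp f p volume) (_ : eLpNorm f p volume ≤ 1),
    eLpNorm (pi4 g f) p volume

/-- The Haar coefficient at `I × J` of
`π³_g(f) = ∑_{I,J} ⟨f, χ̄_I ⊗ h_J⟩ ⟨g, h_I ⊗ χ̄_J⟩ h_I ⊗ h_J`. -/
def pi3Coeff (g f : ℝ × ℝ → ℝ) (R : DyadicRectangle) : ℝ :=
  coeffAvgHaar f R * coeffHaarAvg g R

/-- `sup |⟨π³_{f'}(f), g⟩|` over `‖f‖_{L^p} = 1` and `‖f'‖_{L^{p'}} = 1`, for `g` with finite Haar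
support, where `p'` is the exponent conjugate to `p`. -/
def pi3DualNorm (p : ℝ≥0∞) (g : ℝ × ℝ → ℝ) : ℝ≥0∞ :=
  ⨆ (f : ℝ × ℝ → ℝ) (f' : ℝ × ℝ → ℝ)
    (_ : MemLp f p volume ∧ eLpNorm f p volume = 1)
    (_ : MemLp f' p.conjExponent volume ∧ eLpNorm f' p.conjExponent volume = 1),
    ‖∑' R : DyadicRectangle, pi3Coeff f' f R * haarCoeff g R‖ₑ

/-- `f_J(x) = ⟨f(x, ·), h_J⟩`. -/
def partialHaarSnd (f : ℝ × ℝ → ℝ) (J : DyadicInterval) (x : ℝ) : ℝ := ∫ y, f (x, y) * J.haar y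

/-- `f_I(y) = ⟨f(·, y), h_I⟩`. -/
def partialHaarFst (f : ℝ × ℝ → ℝ) (I : DyadicInterval) (y : ℝ) : ℝ := ∫ x, f (x, y) * I.haar x

/-- The absolute-value variant of the norm of `π⁴_g`: the supremum of
`∑_{I,J} ⟨|f_J|⟩_I ⟨|f'_I|⟩_J |g_{I×J}|` over `‖f‖_{L^p} = 1` and `‖f'‖_{L^{p'}} = 1`. -/
def absPi4Norm (p : ℝ≥0∞) (g : ℝ × ℝ → ℝ) : ℝ≥0∞ :=
  ⨆ (f : ℝ × ℝ → ℝ) (f' : ℝ × ℝ → ℝ)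
    (_ : MemLp f p volume ∧ eLpNorm f p volume = 1)
    (_ : MemLp f' p.conjExponent volume ∧ eLpNorm f' p.conjExponent volume = 1),
    ∑' R : DyadicRectangle,
      ENNReal.ofReal ((⨍ x in R.1.toSet, |partialHaarSnd f R.2 x|) *
        (⨍ y in R.2.toSet, |partialHaarFst f' R.1 y|) * |haarCoeff g R|)

/-- The matrix `G(x, y)_{I,J} = g_{I×J} |I × J|^{-1/2} χ_I(x) χ_J(y)`. -/
def haarMatrix (g : ℝ × ℝ → ℝ) (z : ℝ × ℝ) (I J : DyadicInterval) : ℝ :=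
  haarCoeff g (I, J) / Real.sqrt (DyadicRectangle.area (I, J)) * (I.char z.1 * J.char z.2)

/-- The operator norm `ℓ²(ι) → ℓ²(ι)` of a matrix, as an extended nonnegative real. It suffices to
test on the dense subspace of finitely supported vectors. -/
def l2OpNorm {ι : Type*} (A : ι → ι → ℝ) : ℝ≥0∞ :=
  ⨆ (v : ι →₀ ℝ) (_ : ∑ j ∈ v.support, v j ^ 2 ≤ 1),
    (∑' i, ENNReal.ofReal ((∑ j ∈ v.support, A i j * v j) ^ 2)) ^ (1 / 2 : ℝ)

open Classical in
/-- The dyadic product `BMO` norm: the supremum of `(|Ω|⁻¹ ∑_{R ⊆ Ω} g_R²)^{1/2}` over all open sets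
`Ω` of finite positive measure. -/
def prodBMONorm (g : ℝ × ℝ → ℝ) : ℝ≥0∞ :=
  ⨆ (Ω : Set (ℝ × ℝ)) (_ : IsOpen Ω) (_ : 0 < volume Ω) (_ : volume Ω < ∞),
    ((∑' R : DyadicRectangle,
      if R.toSet ⊆ Ω then ENNReal.ofReal (haarCoeff g R ^ 2) else 0) / volume Ω) ^ (1 / 2 : ℝ)

/-- The strong dyadic maximal function. -/
def strongMaximal (f : ℝ × ℝ → ℝ) (z : ℝ × ℝ) : ℝ≥0∞ :=
  ⨆ (R : DyadicRectangle) (_ : z ∈ R.toSet), ‖⨍ w in R.toSet, f w‖ₑ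

/-- Membership in the bi-parameter dyadic Hardy space `H¹_d(ℝ ⊗ ℝ)`. -/
def MemProdH1 (f : ℝ × ℝ → ℝ) : Prop :=
  Integrable f volume ∧ ∫⁻ z, strongMaximal f z < ∞

/-- The function whose Haar coefficient at `I × J` is `H_{ij} |I × J|^{1/2}` when `I, J ⊆ [0, 1]`
are dyadic with `|I| = 2^{-i}`, `|J| = 2^{-j}`, `0 ≤ i, j < n`, and is `0` for all other `I, J`. -/
def exampleFun {n : ℕ} (H : Matrix (Fin n) (Fin n) ℝ) (z : ℝ × ℝ) : ℝ :=
  ∑ i : Fin n, ∑ j : Fin n, ∑ a ∈ Finset.range (2 ^ (i : ℕ)), ∑ b ∈ Finset.range (2 ^ (j : ℕ)),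
    H i j * Real.sqrt (DyadicRectangle.area (⟨i, a⟩, ⟨j, b⟩)) *
      DyadicRectangle.haar (⟨i, a⟩, ⟨j, b⟩) z

/-- All entries are `1` or `-1`. -/
def IsSignMatrix {n : ℕ} (H : Matrix (Fin n) (Fin n) ℝ) : Prop :=
  ∀ i j, H i j = 1 ∨ H i j = -1

/-- A Hadamard matrix: entries `±1` and orthogonal rows. -/
def IsHadamardMatrix {n : ℕ} (H : Matrix (Fin n) (Fin n) ℝ) : Prop :=
  IsSignMatrix H ∧ H * H.transpose = (n : ℝ) • (1 : Matrix (Fin n) (Fin n) ℝ)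

/-- Entries of Sylvester's matrices: `S_0 = (1)` and `S_{k+1}` has the block form
`S_k, S_k; S_k, -S_k`. -/
def sylvesterEntry : ℕ → ℕ → ℕ → ℝ
  | 0, _, _ => 1
  | k + 1, i, j =>
      (if 2 ^ k ≤ i ∧ 2 ^ k ≤ j then -1 else 1) * sylvesterEntry k (i % 2 ^ k) (j % 2 ^ k)

/-- Sylvester's matrix of size `2 ^ k`. -/
def sylvesterMatrix (k : ℕ) : Matrix (Fin (2 ^ k)) (Fin (2 ^ k)) ℝ :=
  Matrix.of fun i j => sylvesterEntry k i j

/-- `g' = ∑_i c_i π³_{f'_i}(f_i)` with `c_i ≥ 0`, `∑_i c_i < ∞`, `‖f_i‖_{L^p} = 1` and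
`‖f'_i‖_{L^{p'}} = 1`. The identity is read in the weakest sense, as convergence of every Haar
coefficient. -/
def HasPi3Factorization (p : ℝ≥0∞) (g' : ℝ × ℝ → ℝ) : Prop :=
  ∃ (c : ℕ → ℝ) (f f' : ℕ → ℝ × ℝ → ℝ),
    (∀ i, 0 ≤ c i) ∧ Summable c ∧
    (∀ i, MemLp (f i) p volume ∧ eLpNorm (f i) p volume = 1) ∧
    (∀ i, MemLp (f' i) p.conjExponent volume ∧ eLpNorm (f' i) p.conjExponent volume = 1) ∧
    ∀ R : DyadicRectangle, HasSum (fun i => c i * pi3Coeff (f' i) (f i) R) (haarCoeff g' R)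

/-- The Haar coefficients of `g'` are `g'_{I×J} = ⟨u_J ⊗ v_I⟩_{I×J}` for some families `u_J`, `v_I`
in `L²(ℝ)` with `∑_{I,J} ‖u_J ⊗ v_I‖²_{L²(ℝ²)} < ∞`. -/
def HasL2TensorForm (g' : ℝ × ℝ → ℝ) : Prop :=
  ∃ u v : DyadicInterval → ℝ → ℝ,
    (∀ J, MemLp (u J) 2 volume) ∧ (∀ I, MemLp (v I) 2 volume) ∧
    (∑' R : DyadicRectangle,
      eLpNorm (fun z : ℝ × ℝ => u R.2 z.1 * v R.1 z.2) 2 volume ^ 2) < ∞ ∧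
    ∀ R : DyadicRectangle, haarCoeff g' R = ⨍ z in R.toSet, u R.2 z.1 * v R.1 z.2

end

/-! All upper bounds come from one bilinear form. The sum of `⟨f_J⟩_I ⟨f'_I⟩_J g_{I×J}` is the
integral over `z = (x, y)` of `∑ G(z)_{I,J} v_J(z) w_I(z)` with `v_J = f_J(x) |J|^{-1/2} χ_J(y)` and
`w_I = f'_I(y) |I|^{-1/2} χ_I(x)`. At each point it is at most the `ℓ²` norm of `G(z)` times the
lengths of `v(z)` and `w(z)`, and these lengths are square functions of `f` and `f'`, each in a
single variable. Hölder's inequality (`enorm_sum_avg_le`) and the `L^p` bound of the one-parameter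
square function (`exists_lintegral_square_le`, proved with a Bellman function) give
`exists_form_bound`. Duality turns this into the bound for `π⁴_g`. The pairing `⟨π³_{f'}(f), g⟩` is
the same form. The variant with `|f_J|` and `|f'_I|` has the same square functions, and is covered
when the coefficients of `g` are nonnegative.

The product BMO norm of a function whose coefficients depend on generations only is the Frobenius
norm of its matrix (`prodBMONorm_gridFun`): the rectangles of fixed generations tile the unit
square. But `G(z)` is, up to zero rows and columns, the matrix itself
(`l2OpNorm_haarMatrix_exampleFun`), since a point lies in one interval of each generation. So BMO
sees the Frobenius norm and the paraproducts see at most the operator norm: `n` against `√n` for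
Hadamard matrices, `√n` against `1` for the identity.

For the failure of factorization, `nonFactorizable` is a sum of diagonal blocks, the `l`-th having
`4^l` entries `4^{-l}` in the generations from `4^l` to `2 · 4^l - 1`. Each block has `L²` norm
`2^{-l}`, so the series converges in `L¹`. Its maximal function is integrable because averaging over
a rectangle keeps or kills every block whole, with at most one exception
(`abs_setAverage_blockFun_le`). Each block has trace one, so pairing with a large identity matrix is
unbounded (`le_sum_haarCoeff_nonFactorizable`), whereas a factorization or an `L²` tensor form would
bound these pairings uniformly by the bilinear estimate. -/

noncomputable section

/-! ### Dyadic intervals and Haar wavelets on the line -/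

namespace DyadicInterval

lemma len_pos (I : DyadicInterval) : 0 < I.len := by unfold len; positivity

lemma len_ne_zero (I : DyadicInterval) : I.len ≠ 0 := I.len_pos.ne'

lemma sqrt_len_pos (I : DyadicInterval) : 0 < Real.sqrt I.len := Real.sqrt_pos.2 I.len_pos

lemma ext_iff' {I J : DyadicInterval} : I = J ↔ I.gen = J.gen ∧ I.pos = J.pos := by
  cases I; cases J; simp

instance : DecidableEq DyadicInterval := fun _ _ => decidable_of_iff _ ext_iff'.symm

/-- The floor form reduces nesting and disjointness of dyadic intervals to integer arithmetic. -/
lemma mem_toSet_iff {I : DyadicInterval} {x : ℝ} :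
    x ∈ I.toSet ↔ ⌊x * (2 : ℝ) ^ I.gen⌋ = I.pos := by
  have h : (0 : ℝ) < 2 ^ I.gen := by positivity
  rw [Int.floor_eq_iff, toSet, Set.mem_Ico, len, zpow_neg, ← div_eq_mul_inv, ← div_eq_mul_inv,
    div_le_iff₀ h, lt_div_iff₀ h]

/-- The dyadic interval of generation `j` that contains `x`. -/
def containing (j : ℤ) (x : ℝ) : DyadicInterval := ⟨j, ⌊x * (2 : ℝ) ^ j⌋⟩

lemma mem_containing (j : ℤ) (x : ℝ) : x ∈ (containing j x).toSet := mem_toSet_iff.2 rfl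

lemma eq_containing {I : DyadicInterval} {x : ℝ} (h : x ∈ I.toSet) : I = containing I.gen x :=
  ext_iff'.2 ⟨rfl, (mem_toSet_iff.1 h).symm⟩

lemma measurableSet_toSet (I : DyadicInterval) : MeasurableSet I.toSet := measurableSet_Ico

lemma volume_toSet (I : DyadicInterval) : volume I.toSet = ENNReal.ofReal I.len := by
  rw [toSet, Real.volume_Ico]; congr 1; ring

lemma volume_real_toSet (I : DyadicInterval) : volume.real I.toSet = I.len := by
  rw [Measure.real, volume_toSet, ENNReal.toReal_ofReal I.len_pos.le]

/-- The left child. -/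
def leftChild (I : DyadicInterval) : DyadicInterval := ⟨I.gen + 1, 2 * I.pos⟩

/-- The right child. -/
def rightChild (I : DyadicInterval) : DyadicInterval := ⟨I.gen + 1, 2 * I.pos + 1⟩

lemma len_leftChild (I : DyadicInterval) : I.leftChild.len = I.len / 2 := by
  simp only [len, leftChild, neg_add]
  rw [zpow_add₀ two_ne_zero]; norm_num; ring

lemma len_rightChild (I : DyadicInterval) : I.rightChild.len = I.len / 2 := I.len_leftChild

lemma toSet_leftChild (I : DyadicInterval) : I.leftChild.toSet = I.leftHalf := by
  rw [toSet, leftHalf, len_leftChild]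
  simp only [leftChild]; push_cast
  congr 1 <;> ring

lemma toSet_rightChild (I : DyadicInterval) : I.rightChild.toSet = I.rightHalf := by
  rw [toSet, rightHalf, len_rightChild]
  simp only [rightChild]; push_cast
  congr 1 <;> ring

lemma toSet_eq_union (I : DyadicInterval) :
    I.toSet = I.leftChild.toSet ∪ I.rightChild.toSet := by
  rw [toSet_leftChild, toSet_rightChild, leftHalf, rightHalf, Set.Ico_union_Ico_eq_Ico]
  · rfl
  all_goals nlinarith [I.len_pos]

lemma disjoint_children (I : DyadicInterval) :
    Disjoint I.leftChild.toSet I.rightChild.toSet := by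
  rw [toSet_leftChild, toSet_rightChild, leftHalf, rightHalf]
  exact Set.Ico_disjoint_Ico_same

lemma leftChild_subset (I : DyadicInterval) : I.leftChild.toSet ⊆ I.toSet := by
  rw [I.toSet_eq_union]; exact Set.subset_union_left

lemma rightChild_subset (I : DyadicInterval) : I.rightChild.toSet ⊆ I.toSet := by
  rw [I.toSet_eq_union]; exact Set.subset_union_right

lemma floor_parent (x : ℝ) (j : ℤ) : ⌊x * (2 : ℝ) ^ j⌋ = ⌊x * (2 : ℝ) ^ (j + 1)⌋ / 2 := by
  have h1 : x * (2 : ℝ) ^ (j + 1) = 2 * (x * 2 ^ j) := by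
    rw [zpow_add₀ two_ne_zero]; norm_num; ring
  rw [h1]
  set t := x * (2 : ℝ) ^ j
  obtain ⟨ha, hb⟩ := Int.floor_eq_iff.1 (rfl : ⌊2 * t⌋ = ⌊2 * t⌋)
  set a := ⌊2 * t⌋
  rw [Int.floor_eq_iff]
  have h2 : a = 2 * (a / 2) ∨ a = 2 * (a / 2) + 1 := by omega
  rcases h2 with h | h <;>
  · have h' := congrArg (Int.cast (R := ℝ)) h
    push_cast at h'
    constructor <;> linarith

lemma floor_eq_of_le {x y : ℝ} {i j : ℤ} (hij : i ≤ j)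
    (h : ⌊x * (2 : ℝ) ^ j⌋ = ⌊y * (2 : ℝ) ^ j⌋) : ⌊x * (2 : ℝ) ^ i⌋ = ⌊y * (2 : ℝ) ^ i⌋ := by
  obtain ⟨n, rfl⟩ := Int.le.dest hij
  induction n with
  | zero => simpa using h
  | succ n ih =>
    apply ih (by omega)
    rw [floor_parent x, floor_parent y]
    push_cast at h
    rw [add_assoc, h]

/-- Nestedness of the dyadic grid: a coarser interval contains `J` or misses it. -/
lemma char_eq_of_mem {I J : DyadicInterval} (h : I.gen ≤ J.gen) {x y : ℝ} (hx : x ∈ J.toSet)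
    (hy : y ∈ J.toSet) : I.char x = I.char y := by
  have : x ∈ I.toSet ↔ y ∈ I.toSet := by
    rw [mem_toSet_iff, mem_toSet_iff,
      floor_eq_of_le h ((mem_toSet_iff.1 hx).trans (mem_toSet_iff.1 hy).symm)]
  by_cases hxI : x ∈ I.toSet
  · rw [char, Set.indicator_of_mem hxI, Set.indicator_of_mem (this.1 hxI)]; rfl
  · rw [char, Set.indicator_of_notMem hxI, Set.indicator_of_notMem (fun h => hxI (this.2 h))]

lemma char_of_mem {I : DyadicInterval} {x : ℝ} (h : x ∈ I.toSet) : I.char x = 1 :=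
  Set.indicator_of_mem h _

lemma char_of_notMem {I : DyadicInterval} {x : ℝ} (h : x ∉ I.toSet) : I.char x = 0 :=
  Set.indicator_of_notMem h _

lemma char_eq_zero_or_one (I : DyadicInterval) (x : ℝ) : I.char x = 0 ∨ I.char x = 1 := by
  by_cases h : x ∈ I.toSet
  · exact .inr (char_of_mem h)
  · exact .inl (char_of_notMem h)

lemma char_nonneg (I : DyadicInterval) (x : ℝ) : 0 ≤ I.char x := by
  rcases I.char_eq_zero_or_one x with h | h <;> simp [h]

lemma char_mul_self (I : DyadicInterval) (x : ℝ) : I.char x * I.char x = I.char x := by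
  rcases I.char_eq_zero_or_one x with h | h <;> simp [h]

lemma measurable_char (I : DyadicInterval) : Measurable I.char :=
  measurable_one.indicator I.measurableSet_toSet

lemma haar_eq_children (I : DyadicInterval) (x : ℝ) :
    I.haar x = (I.leftChild.char x - I.rightChild.char x) / Real.sqrt I.len := by
  rw [haar, char, char, toSet_leftChild, toSet_rightChild]

lemma char_eq_children (I : DyadicInterval) (x : ℝ) :
    I.char x = I.leftChild.char x + I.rightChild.char x := by
  rw [char, toSet_eq_union, Set.indicator_union_of_disjoint I.disjoint_children]; rfl

lemma measurable_haar (I : DyadicInterval) : Measurable I.haar := by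
  have : I.haar = fun x => (I.leftChild.char x - I.rightChild.char x) / Real.sqrt I.len :=
    funext I.haar_eq_children
  rw [this]
  exact (I.leftChild.measurable_char.sub I.rightChild.measurable_char).div_const _

lemma measurable_avgChar (I : DyadicInterval) : Measurable I.avgChar :=
  I.measurable_char.div_const _

lemma haar_sq (I : DyadicInterval) (x : ℝ) : I.haar x * I.haar x = I.char x / I.len := by
  have h := I.disjoint_children
  rw [haar_eq_children, char_eq_children I, div_mul_div_comm, Real.mul_self_sqrt I.len_pos.le]
  congr 1
  by_cases hl : x ∈ I.leftChild.toSet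
  · have hr := Set.disjoint_left.1 h hl
    rw [char_of_mem hl, char_of_notMem hr]; ring
  · rw [char_of_notMem hl]; rcases I.rightChild.char_eq_zero_or_one x with h | h <;> rw [h] <;> ring

lemma haar_of_notMem {I : DyadicInterval} {x : ℝ} (h : x ∉ I.toSet) : I.haar x = 0 := by
  have := I.haar_sq x
  rw [char_of_notMem h, zero_div] at this
  exact mul_self_eq_zero.1 this

lemma abs_haar (I : DyadicInterval) (x : ℝ) : |I.haar x| = I.char x / Real.sqrt I.len := by
  have h := I.haar_sq x
  have h2 : (I.char x / Real.sqrt I.len) ^ 2 = I.char x / I.len := by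
    rw [div_pow, Real.sq_sqrt I.len_pos.le, sq, char_mul_self]
  have h3 : 0 ≤ I.char x / Real.sqrt I.len := div_nonneg (I.char_nonneg x) (Real.sqrt_nonneg _)
  rw [← abs_of_nonneg h3, ← sq_eq_sq_iff_abs_eq_abs, h2, sq, h]

lemma haar_eq_of_mem {I J : DyadicInterval} (h : I.gen < J.gen) {x y : ℝ} (hx : x ∈ J.toSet)
    (hy : y ∈ J.toSet) : I.haar x = I.haar y := by
  rw [haar_eq_children, haar_eq_children, char_eq_of_mem (I := I.leftChild) h hx hy,
    char_eq_of_mem (I := I.rightChild) h hx hy]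

lemma integrable_char (I : DyadicInterval) : Integrable I.char :=
  (integrable_indicator_iff I.measurableSet_toSet).2
    (integrableOn_const (by rw [volume_toSet]; exact ENNReal.ofReal_ne_top))

lemma integral_char (I : DyadicInterval) : ∫ x, I.char x = I.len := by
  rw [char, integral_indicator_one I.measurableSet_toSet, volume_real_toSet]

lemma integral_haar (I : DyadicInterval) : ∫ x, I.haar x = 0 := by
  simp_rw [haar_eq_children]
  rw [integral_div, integral_sub I.leftChild.integrable_char I.rightChild.integrable_char,
    integral_char, integral_char, len_leftChild, len_rightChild, sub_self, zero_div]

lemma integral_haar_mul_haar_of_lt {I J : DyadicInterval} (h : I.gen < J.gen) :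
    ∫ x, I.haar x * J.haar x = 0 := by
  -- The coarser wavelet is constant on `J`; the left endpoint of `J` serves as sample point, and
  -- `J.haar` has mean zero.
  have h0 : ∀ x, I.haar x * J.haar x = I.haar (J.pos * J.len) * J.haar x := by
    intro x
    by_cases hx : x ∈ J.toSet
    · rw [haar_eq_of_mem h hx (y := J.pos * J.len)]
      exact ⟨le_rfl, by nlinarith [J.len_pos]⟩
    · rw [haar_of_notMem hx, mul_zero, mul_zero]
  simp_rw [h0]
  rw [integral_const_mul, integral_haar, mul_zero]

lemma integral_haar_mul_haar (I J : DyadicInterval) :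
    ∫ x, I.haar x * J.haar x = if I = J then 1 else 0 := by
  rcases lt_trichotomy I.gen J.gen with h | h | h
  · rw [integral_haar_mul_haar_of_lt h, if_neg]; rintro rfl; exact h.ne rfl
  · split_ifs with hIJ
    · subst hIJ
      simp_rw [haar_sq]
      rw [integral_div, integral_char, div_self I.len_ne_zero]
    · have h0 : ∀ x, I.haar x * J.haar x = 0 := by
        intro x
        by_cases hx : x ∈ I.toSet
        · have : x ∉ J.toSet := fun hJ => hIJ (by rw [eq_containing hx, eq_containing hJ, h])
          rw [haar_of_notMem this, mul_zero]
        · rw [haar_of_notMem hx, zero_mul]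
      simp_rw [h0, integral_zero]
  · simp_rw [mul_comm (I.haar _)]
    rw [integral_haar_mul_haar_of_lt h, if_neg]; rintro rfl; exact h.ne rfl

end DyadicInterval

/-! ### Bellman functions for the dyadic square function -/

/-- Bernoulli's inequality for the exponent `2 - p ≤ 1` bounds `(1 + u)^p` below by the rational
function `(1 + u)² / (1 + (2 - p) u)`. Adding the cases `u = ±t` leaves a polynomial inequality. -/
lemma two_mul_le_one_add_rpow_add_one_sub_rpow {p t : ℝ} (hp : 1 < p) (hp2 : p ≤ 2) (ht : 0 ≤ t)
    (ht1 : t ≤ 1) : 2 * (1 + (p - 1) ^ 2 * t ^ 2) ≤ (1 + t) ^ p + (1 - t) ^ p := by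
  have key : ∀ u : ℝ, -1 ≤ u → u ≤ 1 → (1 + u) ^ 2 / (1 + (2 - p) * u) ≤ (1 + u) ^ p := by
    intro u hu hu1
    have hpos : 0 < 1 + (2 - p) * u := by nlinarith
    rcases hu.eq_or_lt with rfl | hu
    · norm_num
      rw [Real.zero_rpow (by linarith)]
    have h1 : 0 < 1 + u := by linarith
    rw [div_le_iff₀ hpos]
    have h2 : (1 + u) ^ (2 - p) ≤ 1 + (2 - p) * u :=
      rpow_one_add_le_one_add_mul_self hu.le (by linarith) (by linarith)
    calc (1 + u) ^ 2 = (1 + u) ^ p * (1 + u) ^ (2 - p) := by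
          rw [← Real.rpow_add h1]; norm_num
      _ ≤ _ := by gcongr
  have ha := key t (by linarith) ht1
  have hb := key (-t) (by linarith) (by linarith)
  have h1 : 0 < 1 + (2 - p) * t := by nlinarith
  have h2 : 0 < 1 + (2 - p) * (-t) := by nlinarith
  have h3 : 2 * (1 + (p - 1) ^ 2 * t ^ 2) ≤
      (1 + t) ^ 2 / (1 + (2 - p) * t) + (1 + -t) ^ 2 / (1 + (2 - p) * (-t)) := by
    rw [div_add_div _ _ h1.ne' h2.ne', le_div_iff₀ (mul_pos h1 h2)]
    -- After clearing denominators the two sides differ exactly by twice this quartic term.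
    have : 0 ≤ (p - 1) ^ 2 * (2 - p) ^ 2 * t ^ 4 := by positivity
    nlinarith
  rw [← sub_eq_add_neg] at hb h3
  linarith

/-- Both sides are homogeneous of degree `p`, so the larger of `x` and `d` is scaled to one. For `d
≤ x` both sides are of order `t²` and the constant `2 / (p - 1)²` would do. For `x < d` the left
side is at most `3` and the difference on the right at least `(p - 1)² / 2`; this is the source of
the `6`. -/
lemma rpow_sub_rpow_le_two_point_of_nonneg {p x d : ℝ} (hp : 1 < p) (hp2 : p ≤ 2) (hx : 0 ≤ x)
    (hd : 0 ≤ d) : (x ^ 2 + 2 * d ^ 2) ^ (p / 2) - x ^ p ≤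
      6 / (p - 1) ^ 2 * (((x + d) ^ p + |x - d| ^ p) / 2 - x ^ p) := by
  have hp0 : 0 < p := by linarith
  have ha : 0 < (p - 1) ^ 2 := by have : 0 < p - 1 := by linarith
                                  positivity
  have ha1 : (p - 1) ^ 2 ≤ 1 := by nlinarith
  have sqr : ∀ y : ℝ, 0 ≤ y → (y ^ 2) ^ (p / 2) = y ^ p := by
    intro y hy
    rw [← Real.rpow_natCast, ← Real.rpow_mul hy]; norm_num; congr 1; ring
  rw [div_mul_eq_mul_div, le_div_iff₀ ha]
  rcases le_or_gt d x with h | h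
  · rcases hx.eq_or_lt with rfl | hx
    · have : d = 0 := le_antisymm h hd
      subst this
      simp [Real.zero_rpow hp0.ne', Real.zero_rpow (div_pos hp0 two_pos).ne']
    set t := d / x
    have ht : 0 ≤ t := by positivity
    have ht1 : t ≤ 1 := (div_le_one hx).2 h
    have hd' : d = x * t := by simp only [t]; field_simp
    have hX : 0 < x ^ p := by positivity
    have e1 : (x ^ 2 + 2 * d ^ 2) ^ (p / 2) = x ^ p * (1 + 2 * t ^ 2) ^ (p / 2) := by
      rw [← sqr x hx.le, ← Real.mul_rpow (by positivity) (by positivity), hd']; congr 1; ring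
    have e2 : (x + d) ^ p = x ^ p * (1 + t) ^ p := by
      rw [← Real.mul_rpow hx.le (by linarith), hd']; congr 1; ring
    have e3 : |x - d| ^ p = x ^ p * (1 - t) ^ p := by
      rw [abs_of_nonneg (by linarith), ← Real.mul_rpow hx.le (by linarith), hd']; congr 1; ring
    have b1 : (1 + 2 * t ^ 2) ^ (p / 2) ≤ 1 + p / 2 * (2 * t ^ 2) :=
      rpow_one_add_le_one_add_mul_self (by nlinarith [sq_nonneg t]) (by linarith) (by linarith)
    have b2 := two_mul_le_one_add_rpow_add_one_sub_rpow hp hp2 ht ht1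
    rw [e1, e2, e3]
    have c1 : (x ^ p * (1 + 2 * t ^ 2) ^ (p / 2) - x ^ p) ≤ x ^ p * (2 * t ^ 2) := by
      have b1' : (1 + 2 * t ^ 2) ^ (p / 2) ≤ 1 + 2 * t ^ 2 := by nlinarith [sq_nonneg t]
      linarith [mul_le_mul_of_nonneg_left b1' hX.le]
    have c2 : x ^ p * ((p - 1) ^ 2 * t ^ 2) ≤
        (x ^ p * (1 + t) ^ p + x ^ p * (1 - t) ^ p) / 2 - x ^ p := by
      nlinarith
    have c3 : 0 ≤ x ^ p * ((p - 1) ^ 2 * t ^ 2) := by positivity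
    calc _ ≤ x ^ p * (2 * t ^ 2) * (p - 1) ^ 2 := by gcongr
      _ = 2 * (x ^ p * ((p - 1) ^ 2 * t ^ 2)) := by ring
      _ ≤ _ := by linarith
  · have hd : 0 < d := by linarith
    set t := x / d
    have ht : 0 ≤ t := by positivity
    have ht1 : t ≤ 1 := (div_le_one hd).2 h.le
    have hx' : x = d * t := by simp only [t]; field_simp
    have hD : 0 < d ^ p := by positivity
    have e1 : (x ^ 2 + 2 * d ^ 2) ^ (p / 2) = d ^ p * (t ^ 2 + 2) ^ (p / 2) := by
      rw [← sqr d hd.le, ← Real.mul_rpow (by positivity) (by positivity), hx']; congr 1; ring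
    have e2 : (x + d) ^ p = d ^ p * (1 + t) ^ p := by
      rw [← Real.mul_rpow hd.le (by linarith), hx']; congr 1; ring
    have e3 : |x - d| ^ p = d ^ p * (1 - t) ^ p := by
      rw [abs_sub_comm, abs_of_nonneg (by linarith), ← Real.mul_rpow hd.le (by linarith), hx']
      congr 1; ring
    have e4 : x ^ p = d ^ p * t ^ p := by rw [← Real.mul_rpow hd.le ht, ← hx']
    have b1 : (t ^ 2 + 2) ^ (p / 2) ≤ 3 := by
      calc (t ^ 2 + 2) ^ (p / 2) ≤ (3 : ℝ) ^ (p / 2) := by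
            gcongr; nlinarith
        _ ≤ (3 : ℝ) ^ (1 : ℝ) := Real.rpow_le_rpow_of_exponent_le (by norm_num) (by linarith)
        _ = 3 := by norm_num
    have b2 := two_mul_le_one_add_rpow_add_one_sub_rpow hp hp2 ht ht1
    have b3 : t ^ p ≤ t := by
      simpa using Real.rpow_le_rpow_of_exponent_ge' ht ht1 zero_le_one hp.le
    have b4 : 0 ≤ t ^ p := by positivity
    rw [e1, e2, e3, e4]
    have c2 : (p - 1) ^ 2 * (1 / 2) ≤ ((1 + t) ^ p + (1 - t) ^ p) / 2 - t ^ p := by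
      have : (p - 1) ^ 2 * (1 - t) ≤ 1 - t := by nlinarith
      nlinarith [mul_nonneg ha.le (sq_nonneg (t - 1 / 2))]
    calc (d ^ p * (t ^ 2 + 2) ^ (p / 2) - d ^ p * t ^ p) * (p - 1) ^ 2
        ≤ (d ^ p * 3) * (p - 1) ^ 2 := by
          gcongr
          nlinarith
      _ = 6 * (d ^ p * ((p - 1) ^ 2 * (1 / 2))) := by ring
      _ ≤ 6 * (d ^ p * (((1 + t) ^ p + (1 - t) ^ p) / 2 - t ^ p)) := by gcongr
      _ = _ := by ring

lemma rpow_sub_rpow_le_two_point {p : ℝ} (hp : 1 < p) (hp2 : p ≤ 2) (x d : ℝ) :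
    (x ^ 2 + 2 * d ^ 2) ^ (p / 2) - |x| ^ p ≤
      6 / (p - 1) ^ 2 * ((|x + d| ^ p + |x - d| ^ p) / 2 - |x| ^ p) := by
  have h := rpow_sub_rpow_le_two_point_of_nonneg hp hp2 (abs_nonneg x) (abs_nonneg d)
  rw [sq_abs, sq_abs] at h
  refine h.trans_eq ?_
  congr 3
  rcases le_total 0 x with hx | hx <;> rcases le_total 0 d with hd | hd
  · rw [abs_of_nonneg hx, abs_of_nonneg hd, abs_of_nonneg (add_nonneg hx hd)]
  · rw [abs_of_nonneg hx, abs_of_nonpos hd, sub_neg_eq_add, ← sub_eq_add_neg,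
      abs_of_nonneg (sub_nonneg.2 (hd.trans hx)), add_comm]
  · rw [abs_of_nonpos hx, abs_of_nonneg hd, abs_of_nonpos (sub_nonpos.2 (hx.trans hd)),
      add_comm, ← abs_neg (-x - d)]
    congr 2 <;> ring_nf
  · rw [abs_of_nonpos hx, abs_of_nonpos hd, abs_of_nonpos (add_nonpos hx hd),
      ← abs_neg (-x - -d)]
    congr 2 <;> ring_nf

/-- Increments of a concave function decrease: `s + a` and `a + h` are convex combinations of `a`
and `s + a + h` with interchanged weights, and the two concavity inequalities are added. -/
lemma rpow_add_sub_le_of_concave {q a s h : ℝ} (hq : 0 ≤ q) (hq1 : q ≤ 1) (ha : 0 ≤ a)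
    (hs : 0 ≤ s) (hh : 0 ≤ h) : (s + a + h) ^ q - (s + a) ^ q ≤ (a + h) ^ q - a ^ q := by
  rcases (add_nonneg hs hh).eq_or_lt with h0 | h0
  · have h1 : s = 0 := by linarith
    have h2 : h = 0 := by linarith
    simp [h1, h2]
  have hc := (Real.concaveOn_rpow hq hq1).2
  have w1 : 0 ≤ h / (s + h) := by positivity
  have w2 : 0 ≤ s / (s + h) := by positivity
  have w : h / (s + h) + s / (s + h) = 1 := by field_simp; ring
  have A := @hc a ha (s + a + h) (by simp; linarith) _ _ w1 w2 w
  have B := @hc a ha (s + a + h) (by simp; linarith) _ _ w2 w1 (by rw [add_comm]; exact w)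
  simp only [smul_eq_mul] at A B
  have e1 : h / (s + h) * a + s / (s + h) * (s + a + h) = s + a := by field_simp; ring
  have e2 : s / (s + h) * a + h / (s + h) * (s + a + h) = a + h := by field_simp; ring
  rw [e1] at A
  rw [e2] at B
  have e3 : ∀ u v : ℝ, h / (s + h) * u + s / (s + h) * v + (s / (s + h) * u + h / (s + h) * v)
      = u + v := by intro u v; field_simp; ring
  have := e3 (a ^ q) ((s + a + h) ^ q)
  linarith

lemma rpow_midpoint_le {q a b : ℝ} (hq : 0 ≤ q) (hq1 : q ≤ 1) (ha : 0 ≤ a) (hb : 0 ≤ b) :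
    (a ^ q + b ^ q) / 2 ≤ ((a + b) / 2) ^ q := by
  have hc := @(Real.concaveOn_rpow hq hq1).2 a ha b hb (1 / 2) (1 / 2) (by norm_num) (by norm_num)
    (by norm_num)
  simp only [smul_eq_mul] at hc
  calc _ = 1 / 2 * a ^ q + 1 / 2 * b ^ q := by ring
    _ ≤ _ := hc
    _ = _ := by congr 1; ring

/-- A Bellman function for the `L^p` bound of the dyadic square function. -/
structure IsSquareBellman (p : ℝ) (U : ℝ → ℝ → ℝ) (C : ℝ) : Prop where
  nonneg : 0 ≤ C
  midpoint_le : ∀ x d s, 0 ≤ s → (U (x + d) (s + d ^ 2) + U (x - d) (s + d ^ 2)) / 2 ≤ U x s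
  rpow_le : ∀ x s, 0 ≤ s → s ^ (p / 2) ≤ U x s + C * |x| ^ p
  initial : ∀ x, U x 0 ≤ 0

/-- Concavity of `t ↦ t^{p/2}` replaces the mean of the first terms by its value at `s + x² + 2d²`.
The increment over `s + x²` is then largest at `s = 0`, where the two-point inequality applies. -/
lemma isSquareBellman_of_le_two {p : ℝ} (hp : 1 < p) (hp2 : p ≤ 2) :
    IsSquareBellman p (fun x s => (s + x ^ 2) ^ (p / 2) - 6 / (p - 1) ^ 2 * |x| ^ p)
      (6 / (p - 1) ^ 2) where
  nonneg := by positivity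
  midpoint_le x d s hs := by
    have h1 := rpow_midpoint_le (q := p / 2) (a := s + d ^ 2 + (x + d) ^ 2)
      (b := s + d ^ 2 + (x - d) ^ 2) (by linarith) (by linarith) (by positivity) (by positivity)
    have e : (s + d ^ 2 + (x + d) ^ 2 + (s + d ^ 2 + (x - d) ^ 2)) / 2 = s + x ^ 2 + 2 * d ^ 2 := by
      ring
    rw [e] at h1
    have h2 := rpow_add_sub_le_of_concave (q := p / 2) (a := x ^ 2) (s := s) (h := 2 * d ^ 2)
      (by linarith) (by linarith) (by positivity) hs (by positivity)
    have h3 := rpow_sub_rpow_le_two_point hp hp2 x d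
    have h4 : (x ^ 2) ^ (p / 2) = |x| ^ p := by
      rw [← sq_abs, ← Real.rpow_natCast, ← Real.rpow_mul (abs_nonneg x)]; norm_num; congr 1; ring
    linarith
  rpow_le x s hs := by
    have : s ^ (p / 2) ≤ (s + x ^ 2) ^ (p / 2) := by gcongr; nlinarith [sq_nonneg x]
    linarith
  initial x := by
    have h4 : (x ^ 2) ^ (p / 2) = |x| ^ p := by
      rw [← sq_abs, ← Real.rpow_natCast, ← Real.rpow_mul (abs_nonneg x)]; norm_num; congr 1; ring
    have h5 : 1 ≤ 6 / (p - 1) ^ 2 := by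
      rw [le_div_iff₀ (by have : 0 < p - 1 := by linarith
                          positivity)]
      nlinarith
    have h6 : 0 ≤ |x| ^ p := by positivity
    simp only [zero_add, h4]
    nlinarith

/-- Averaging over `x ± d` replaces `x²` by `x² + d²`, so the midpoint inequality follows from the
tangent line of the convex `t ↦ t^{p/2}` at `s + d²`. The majorization is `y s^{p/2-1} ≤ s^{p/2} +
y^{p/2}` with `y = p x²`, which dictates the constant `p^{p/2}`. -/
lemma isSquareBellman_of_two_le {p : ℝ} (hp : 2 ≤ p) :
    IsSquareBellman p (fun x s => 2 * (s ^ (p / 2) - p / 2 * x ^ 2 * s ^ (p / 2 - 1)))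
      (p ^ (p / 2)) where
  nonneg := by positivity
  midpoint_le x d s hs := by
    have hq : 1 ≤ p / 2 := by linarith
    have h1 : s ^ (p / 2 - 1) ≤ (s + d ^ 2) ^ (p / 2 - 1) := by
      gcongr
      nlinarith [sq_nonneg d]
    have h2 : (s + d ^ 2) ^ (p / 2) - p / 2 * d ^ 2 * (s + d ^ 2) ^ (p / 2 - 1) ≤ s ^ (p / 2) := by
      have hb : 0 ≤ s + d ^ 2 := by positivity
      rcases hb.eq_or_lt with hb | hb
      · have hs0 : s = 0 := by nlinarith [sq_nonneg d]
        have hd0 : d ^ 2 = 0 := by linarith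
        simp [hs0, hd0]
      · have hB := one_add_mul_self_le_rpow_one_add (s := - d ^ 2 / (s + d ^ 2))
          (by rw [le_div_iff₀ hb]; linarith) hq
        have e1 : 1 + - d ^ 2 / (s + d ^ 2) = s / (s + d ^ 2) := by field_simp; ring
        rw [e1, Real.div_rpow hs hb.le, le_div_iff₀ (by positivity)] at hB
        refine le_trans (le_of_eq ?_) hB
        have e2 : (s + d ^ 2) ^ (p / 2) = (s + d ^ 2) ^ (p / 2 - 1) * (s + d ^ 2) := by
          rw [← Real.rpow_add_one hb.ne']; congr 1; ring
        rw [e2]; field_simp; ring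
    have h3 : 0 ≤ p / 2 * x ^ 2 := by positivity
    nlinarith [mul_le_mul_of_nonneg_left h1 h3]
  rpow_le x s hs := by
    have hp0 : 0 < p := by linarith
    have h4 : |x| ^ p = (x ^ 2) ^ (p / 2) := by
      rw [← sq_abs, ← Real.rpow_natCast, ← Real.rpow_mul (abs_nonneg x)]; norm_num; congr 1; ring
    rw [h4, ← Real.mul_rpow hp0.le (sq_nonneg x)]
    set y := p * x ^ 2 with hy
    have hy0 : 0 ≤ y := by positivity
    have e : p / 2 * x ^ 2 = y / 2 := by rw [hy]; ring
    have add1 : ∀ u : ℝ, 0 ≤ u → u ^ (p / 2) = u * u ^ (p / 2 - 1) := by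
      intro u hu
      rw [← Real.rpow_one_add' hu (by linarith)]; congr 1; ring
    simp only [e]
    rcases le_total y s with h | h
    · have h5 : y * s ^ (p / 2 - 1) ≤ s ^ (p / 2) := by
        rw [add1 s hs]; gcongr
      have : 0 ≤ y ^ (p / 2) := by positivity
      linarith
    · have h5 : y * s ^ (p / 2 - 1) ≤ y ^ (p / 2) := by
        rw [add1 y hy0]; gcongr; linarith
      have : 0 ≤ s ^ (p / 2) := by positivity
      linarith
  initial x := by
    have h1 : (0 : ℝ) ^ (p / 2) = 0 := Real.zero_rpow (by linarith)
    -- At `p = 2` this power is `0 ^ 0 = 1`, so only its sign is used.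
    have h2 : 0 ≤ (0 : ℝ) ^ (p / 2 - 1) := Real.rpow_nonneg le_rfl _
    have h3 : 0 ≤ p / 2 * x ^ 2 := by positivity
    simp only [h1]
    nlinarith [mul_nonneg h3 h2]

lemma exists_isSquareBellman {p : ℝ} (hp : 1 < p) : ∃ U C, IsSquareBellman p U C := by
  rcases le_total p 2 with h | h
  · exact ⟨_, _, isSquareBellman_of_le_two hp h⟩
  · exact ⟨_, _, isSquareBellman_of_two_le h⟩

/-! ### The dyadic square function on the line -/

namespace DyadicInterval

/-- The average of `f` over `I`. -/
def avg (f : ℝ → ℝ) (I : DyadicInterval) : ℝ := (∫ x in I.toSet, f x) / I.len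

lemma setAverage_eq_avg (f : ℝ → ℝ) (I : DyadicInterval) : ⨍ x in I.toSet, f x = avg f I := by
  rw [setAverage_eq, volume_real_toSet, smul_eq_mul, avg, div_eq_inv_mul]

lemma integral_mul_char (f : ℝ → ℝ) (I : DyadicInterval) :
    ∫ x, f x * I.char x = ∫ x in I.toSet, f x := by
  rw [← integral_indicator I.measurableSet_toSet]
  congr 1; ext x
  by_cases h : x ∈ I.toSet
  · rw [char_of_mem h, Set.indicator_of_mem h, mul_one]
  · rw [char_of_notMem h, Set.indicator_of_notMem h, mul_zero]

lemma setIntegral_children {f : ℝ → ℝ} {I : DyadicInterval} (hf : IntegrableOn f I.toSet) :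
    ∫ x in I.toSet, f x = (∫ x in I.leftChild.toSet, f x) + ∫ x in I.rightChild.toSet, f x := by
  conv_lhs => rw [toSet_eq_union]
  exact setIntegral_union I.disjoint_children (measurableSet_toSet _)
    (hf.mono_set I.leftChild_subset) (hf.mono_set I.rightChild_subset)

lemma integrable_mul_char {f : ℝ → ℝ} {I : DyadicInterval} (hf : IntegrableOn f I.toSet) :
    Integrable (fun x => f x * I.char x) := by
  refine ((integrable_indicator_iff I.measurableSet_toSet).2 hf).congr (.of_forall fun x => ?_)
  by_cases h : x ∈ I.toSet
  · simp only [char_of_mem h, Set.indicator_of_mem h, mul_one]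
  · simp only [char_of_notMem h, Set.indicator_of_notMem h, mul_zero]

lemma integral_mul_haar {f : ℝ → ℝ} {I : DyadicInterval} (hf : IntegrableOn f I.toSet) :
    ∫ x, f x * I.haar x =
      ((∫ x in I.leftChild.toSet, f x) - ∫ x in I.rightChild.toSet, f x) / Real.sqrt I.len := by
  rw [← integral_mul_char, ← integral_mul_char, ← integral_sub
    (integrable_mul_char (hf.mono_set I.leftChild_subset))
    (integrable_mul_char (hf.mono_set I.rightChild_subset)), ← integral_div]
  congr 1; ext x
  rw [haar_eq_children]; ring

/-- Half the difference of the averages of `f` over the two children of `I`. -/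
def halfDiff (f : ℝ → ℝ) (I : DyadicInterval) : ℝ := (∫ x, f x * I.haar x) / Real.sqrt I.len

lemma halfDiff_sq (f : ℝ → ℝ) (I : DyadicInterval) :
    halfDiff f I ^ 2 = (∫ x, f x * I.haar x) ^ 2 / I.len := by
  rw [halfDiff, div_pow, Real.sq_sqrt I.len_pos.le]

lemma halfDiff_eq {f : ℝ → ℝ} {I : DyadicInterval} (hf : IntegrableOn f I.toSet) :
    halfDiff f I =
      ((∫ x in I.leftChild.toSet, f x) - ∫ x in I.rightChild.toSet, f x) / I.len := by
  rw [halfDiff, integral_mul_haar hf, div_div, Real.mul_self_sqrt I.len_pos.le]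

lemma avg_leftChild {f : ℝ → ℝ} {I : DyadicInterval} (hf : IntegrableOn f I.toSet) :
    avg f I.leftChild = avg f I + halfDiff f I := by
  have := I.len_ne_zero
  rw [avg, avg, halfDiff_eq hf, setIntegral_children hf, len_leftChild]
  field_simp; ring

lemma avg_rightChild {f : ℝ → ℝ} {I : DyadicInterval} (hf : IntegrableOn f I.toSet) :
    avg f I.rightChild = avg f I - halfDiff f I := by
  have := I.len_ne_zero
  rw [avg, avg, halfDiff_eq hf, setIntegral_children hf, len_rightChild]
  field_simp; ring

lemma abs_avg_rpow_le {f : ℝ → ℝ} {I : DyadicInterval} {p : ℝ} (hp : 1 ≤ p)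
    (hf : IntegrableOn f I.toSet) (hfp : IntegrableOn (fun x => |f x| ^ p) I.toSet) :
    I.len * |avg f I| ^ p ≤ ∫ x in I.toSet, |f x| ^ p := by
  have h0 : volume I.toSet ≠ 0 := by
    rw [volume_toSet]; simpa using I.len_pos
  have h1 : volume I.toSet ≠ ∞ := by rw [volume_toSet]; exact ENNReal.ofReal_ne_top
  have hc := (convexOn_rpow hp).map_set_average_le (f := fun x => |f x|)
    (Real.continuous_rpow_const (by linarith)).continuousOn isClosed_Ici h0 h1
    (.of_forall fun x => Set.mem_Ici.2 (abs_nonneg _)) hf.abs hfp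
  rw [setAverage_eq, setAverage_eq, volume_real_toSet, smul_eq_mul, smul_eq_mul] at hc
  have h2 : |avg f I| ≤ I.len⁻¹ * ∫ x in I.toSet, |f x| := by
    rw [avg, abs_div, abs_of_pos I.len_pos, div_eq_inv_mul]
    exact mul_le_mul_of_nonneg_left (abs_integral_le_integral_abs) (inv_nonneg.2 I.len_pos.le)
  calc I.len * |avg f I| ^ p ≤ I.len * (I.len⁻¹ * ∫ x in I.toSet, |f x| ^ p) :=
        mul_le_mul_of_nonneg_left
          ((Real.rpow_le_rpow (abs_nonneg _) h2 (by linarith)).trans hc) I.len_pos.le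
    _ = _ := by rw [mul_inv_cancel_left₀ I.len_ne_zero]

lemma containing_eq_of_mem {I : DyadicInterval} {x : ℝ} (h : x ∈ I.toSet) :
    containing I.gen x = I := (eq_containing h).symm

/-- The Bellman induction over the generations below `I`. -/
lemma lintegral_rpow_sum_le {p C : ℝ} {U : ℝ → ℝ → ℝ} (hU : IsSquareBellman p U C) (hp : 1 < p)
    {f : ℝ → ℝ} (hf : ∀ I : DyadicInterval, IntegrableOn f I.toSet)
    (hfp : ∀ I : DyadicInterval, IntegrableOn (fun x => |f x| ^ p) I.toSet) (n : ℕ) :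
    ∀ (I : DyadicInterval) (s : ℝ), 0 ≤ s →
      ∫⁻ y in I.toSet, ENNReal.ofReal
        ((s + ∑ j ∈ Finset.range n, halfDiff f (containing (I.gen + j) y) ^ 2) ^ (p / 2)) ≤
      ENNReal.ofReal (I.len * U (avg f I) s + C * ∫ x in I.toSet, |f x| ^ p) := by
  have base : ∀ (I : DyadicInterval) (s : ℝ), 0 ≤ s →
      I.len * s ^ (p / 2) ≤ I.len * U (avg f I) s + C * ∫ x in I.toSet, |f x| ^ p := by
    intro I s hs
    have h1 := mul_le_mul_of_nonneg_left (hU.rpow_le (avg f I) s hs) I.len_pos.le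
    have h2 := mul_le_mul_of_nonneg_left (abs_avg_rpow_le hp.le (hf I) (hfp I)) hU.nonneg
    nlinarith
  induction n with
  | zero =>
    intro I s hs
    simp only [Finset.range_zero, Finset.sum_empty, add_zero]
    rw [setLIntegral_const, volume_toSet, mul_comm, ← ENNReal.ofReal_mul I.len_pos.le]
    exact ENNReal.ofReal_le_ofReal (base I s hs)
  | succ n ih =>
    intro I s hs
    have hs' : 0 ≤ s + halfDiff f I ^ 2 := by positivity
    have step : ∀ K : DyadicInterval, K.gen = I.gen + 1 → K.toSet ⊆ I.toSet →
        ∫⁻ y in K.toSet, ENNReal.ofReal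
          ((s + ∑ j ∈ Finset.range (n + 1), halfDiff f (containing (I.gen + j) y) ^ 2) ^ (p / 2)) ≤
        ENNReal.ofReal (K.len * U (avg f K) (s + halfDiff f I ^ 2) +
          C * ∫ x in K.toSet, |f x| ^ p) := by
      intro K hK hKI
      refine le_trans (le_of_eq ?_) (ih K _ hs')
      refine setLIntegral_congr_fun K.measurableSet_toSet fun y hy => ?_
      -- The summand `j = 0` is constant on `I`. It is absorbed into the accumulated sum `s`, and
      -- the remaining summands form the sum that starts at the child `K`.
      rw [Finset.sum_range_succ', add_assoc s, add_comm (halfDiff f I ^ 2)]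
      simp only [Nat.cast_zero, add_zero, containing_eq_of_mem (hKI hy), hK, Nat.cast_succ]
      congr 5
      ext j
      rw [add_assoc, add_comm (1 : ℤ)]
    conv_lhs => rw [toSet_eq_union]
    rw [lintegral_union (measurableSet_toSet _) I.disjoint_children]
    refine (add_le_add (step I.leftChild rfl I.leftChild_subset)
      (step I.rightChild rfl I.rightChild_subset)).trans ?_
    -- `ENNReal.ofReal` adds only on nonnegative numbers; the sign comes from the majorization in
    -- `base`.
    have nn : ∀ K : DyadicInterval, 0 ≤ K.len * U (avg f K) (s + halfDiff f I ^ 2) +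
          C * ∫ x in K.toSet, |f x| ^ p := fun K =>
      le_trans (mul_nonneg K.len_pos.le (Real.rpow_nonneg hs' _)) (base K _ hs')
    rw [← ENNReal.ofReal_add (nn _) (nn _)]
    apply ENNReal.ofReal_le_ofReal
    rw [len_leftChild, len_rightChild, avg_leftChild (hf I), avg_rightChild (hf I),
      setIntegral_children (hfp I)]
    have := mul_le_mul_of_nonneg_left (hU.midpoint_le (avg f I) (halfDiff f I) s hs) I.len_pos.le
    linarith

lemma iUnion_toSet (m : ℤ) : ⋃ k : ℤ, (DyadicInterval.mk m k).toSet = Set.univ :=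
  Set.eq_univ_of_forall fun x => Set.mem_iUnion.2 ⟨_, mem_containing m x⟩

lemma pairwise_disjoint_toSet (m : ℤ) :
    Pairwise (Function.onFun Disjoint fun k : ℤ => (DyadicInterval.mk m k).toSet) := by
  intro k l hkl
  refine Set.disjoint_left.2 fun x hk hl => hkl ?_
  exact (mem_toSet_iff.1 hk).symm.trans (mem_toSet_iff.1 hl)

/-- A point lies in one interval of each generation, so an arbitrary finite family is dominated by
the full tower of intervals over `y`. -/
lemma sum_char_le (F : Finset DyadicInterval) {m : ℤ} {n : ℕ}
    (hF : ∀ J ∈ F, m ≤ J.gen ∧ J.gen < m + n) {w : DyadicInterval → ℝ} (hw : ∀ J, 0 ≤ w J)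
    (y : ℝ) : ∑ J ∈ F, w J * J.char y ≤ ∑ j ∈ Finset.range n, w (containing (m + j) y) := by
  classical
  have h1 : ∑ J ∈ F, w J * J.char y = ∑ J ∈ F with y ∈ J.toSet, w J := by
    rw [Finset.sum_filter]
    refine Finset.sum_congr rfl fun J _ => ?_
    split_ifs with h
    · rw [char_of_mem h, mul_one]
    · rw [char_of_notMem h, mul_zero]
  have inj : Set.InjOn (fun j : ℕ => containing (m + j) y) (Finset.range n) := by
    intro a _ b _ h
    have := congrArg DyadicInterval.gen h
    simpa [containing] using this
  rw [h1, ← Finset.sum_image (f := w) inj]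
  refine Finset.sum_le_sum_of_subset_of_nonneg (fun J hJ => ?_) fun J _ _ => hw J
  obtain ⟨hJF, hyJ⟩ := Finset.mem_filter.1 hJ
  obtain ⟨ha, hb⟩ := hF J hJF
  refine Finset.mem_image.2 ⟨(J.gen - m).toNat, Finset.mem_range.2 (by omega), ?_⟩
  rw [Int.toNat_of_nonneg (by omega), add_sub_cancel, containing_eq_of_mem hyJ]

/-- The `L^p` bound of the dyadic square function, for finitely many intervals. -/
theorem exists_lintegral_square_le {p : ℝ} (hp : 1 < p) : ∃ C : ℝ≥0, ∀ f : ℝ → ℝ,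
    MemLp f (ENNReal.ofReal p) → ∀ F : Finset DyadicInterval,
      ∫⁻ y, (∑ J ∈ F, ENNReal.ofReal ((∫ x, f x * J.haar x) ^ 2 / J.len * J.char y)) ^ (p / 2) ≤
        C * ∫⁻ y, ‖f y‖ₑ ^ p := by
  obtain ⟨U, C, hU⟩ := exists_isSquareBellman hp
  refine ⟨C.toNNReal, fun f hf F => ?_⟩
  have hp0 : 0 < p := by linarith
  have hfp : Integrable (fun x => |f x| ^ p) := by
    have := hf.integrable_norm_rpow (by simpa using hp0) ENNReal.ofReal_ne_top
    rwa [ENNReal.toReal_ofReal hp0.le] at this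
  have hfin : ∀ I : DyadicInterval, volume I.toSet ≠ ∞ := fun I => by
    rw [volume_toSet]; exact ENNReal.ofReal_ne_top
  have hf1 : ∀ I : DyadicInterval, IntegrableOn f I.toSet := fun I => by
    have : IsFiniteMeasure (volume.restrict I.toSet) := ⟨by
      rw [Measure.restrict_apply_univ]; exact (hfin I).lt_top⟩
    exact (hf.restrict I.toSet).integrable (by simpa using hp.le)
  obtain ⟨m, n, hmn⟩ : ∃ (m : ℤ) (n : ℕ), ∀ J ∈ F, m ≤ J.gen ∧ J.gen < m + n := by
    obtain ⟨a, ha⟩ := (F.image DyadicInterval.gen).bddBelow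
    obtain ⟨b, hb⟩ := (F.image DyadicInterval.gen).bddAbove
    refine ⟨a, (b + 1 - a).toNat, fun J hJ => ?_⟩
    have h1 := ha (Finset.mem_coe.2 (Finset.mem_image_of_mem _ hJ))
    have h2 := hb (Finset.mem_coe.2 (Finset.mem_image_of_mem _ hJ))
    omega
  have pt : ∀ y, (∑ J ∈ F, ENNReal.ofReal ((∫ x, f x * J.haar x) ^ 2 / J.len * J.char y)) ^ (p / 2)
      ≤ ENNReal.ofReal
        ((0 + ∑ j ∈ Finset.range n, halfDiff f (containing (m + j) y) ^ 2) ^ (p / 2)) := by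
    intro y
    rw [← ENNReal.ofReal_sum_of_nonneg fun J _ =>
      mul_nonneg (div_nonneg (sq_nonneg _) J.len_pos.le) (J.char_nonneg y),
      ENNReal.ofReal_rpow_of_nonneg (Finset.sum_nonneg fun J _ =>
      mul_nonneg (div_nonneg (sq_nonneg _) J.len_pos.le) (J.char_nonneg y)) (by positivity)]
    refine ENNReal.ofReal_le_ofReal (Real.rpow_le_rpow (Finset.sum_nonneg fun J _ =>
      mul_nonneg (div_nonneg (sq_nonneg _) J.len_pos.le) (J.char_nonneg y)) ?_ (by positivity))
    simp_rw [← halfDiff_sq, zero_add]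
    exact sum_char_le F hmn (fun J => sq_nonneg _) y
  refine (lintegral_mono pt).trans ?_
  -- The intervals of generation `m` tile the line. Starting the induction on each of them with `s =
  -- 0` makes the Bellman term nonpositive, and only `C ∫ |f|^p` survives.
  have hloc : ∀ k : ℤ, ∫⁻ y in (DyadicInterval.mk m k).toSet, ENNReal.ofReal
        ((0 + ∑ j ∈ Finset.range n, halfDiff f (containing (m + j) y) ^ 2) ^ (p / 2)) ≤
      C.toNNReal * ∫⁻ y in (DyadicInterval.mk m k).toSet, ‖f y‖ₑ ^ p := by
    intro k
    refine (lintegral_rpow_sum_le hU hp hf1 (fun I => hfp.integrableOn) n ⟨m, k⟩ 0 le_rfl).trans ?_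
    have h1 : (DyadicInterval.mk m k).len * U (avg f ⟨m, k⟩) 0 ≤ 0 :=
      mul_nonpos_of_nonneg_of_nonpos (len_pos _).le (hU.initial _)
    refine (ENNReal.ofReal_le_ofReal (add_le_of_nonpos_left h1)).trans ?_
    rw [ENNReal.ofReal_mul hU.nonneg, ofReal_integral_eq_lintegral_ofReal hfp.integrableOn
      (.of_forall fun x => by positivity)]
    refine le_of_eq ?_
    congr 1
    refine lintegral_congr fun x => ?_
    rw [← ENNReal.ofReal_rpow_of_nonneg (abs_nonneg _) hp0.le, Real.enorm_eq_ofReal_abs]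
  rw [← setLIntegral_univ, ← setLIntegral_univ (fun y => ‖f y‖ₑ ^ p), ← iUnion_toSet m,
    lintegral_iUnion (fun k => measurableSet_toSet _) (pairwise_disjoint_toSet m),
    lintegral_iUnion (fun k => measurableSet_toSet _) (pairwise_disjoint_toSet m),
    ← ENNReal.tsum_mul_left]
  exact ENNReal.tsum_le_tsum hloc

end DyadicInterval

/-! ### Row square functions in the plane and the bilinear estimate -/

open DyadicInterval

/-- The square function `∑_J φ_J(x)² χ_J(y) / |J|` of a family of functions of the first
variable. -/
def rowSquare (F : Finset DyadicInterval) (φ : DyadicInterval → ℝ → ℝ) (z : ℝ × ℝ) : ℝ≥0∞ :=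
  ∑ J ∈ F, ENNReal.ofReal (φ J z.1 ^ 2 / J.len * J.char z.2)

/-- The `L^p` norm of the square root of `rowSquare`. -/
def rowNorm (p : ℝ) (F : Finset DyadicInterval) (φ : DyadicInterval → ℝ → ℝ) : ℝ≥0∞ :=
  (∫⁻ z, rowSquare F φ z ^ (p / 2)) ^ (1 / p)

lemma aemeasurable_rowSquare {F : Finset DyadicInterval} {φ : DyadicInterval → ℝ → ℝ}
    (hφ : ∀ J, AEMeasurable (φ J)) : AEMeasurable (rowSquare F φ) := by
  refine Finset.aemeasurable_fun_sum _ fun J _ => AEMeasurable.ennreal_ofReal ?_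
  have h1 : AEMeasurable (fun z : ℝ × ℝ => φ J z.1) :=
    (hφ J).comp_quasiMeasurePreserving Measure.quasiMeasurePreserving_fst
  exact ((h1.pow_const 2).div_const _).mul (J.measurable_char.comp measurable_snd).aemeasurable

lemma rowNorm_abs (p : ℝ) (F : Finset DyadicInterval) (φ : DyadicInterval → ℝ → ℝ) :
    rowNorm p F (fun J x => |φ J x|) = rowNorm p F φ := by
  simp only [rowNorm, rowSquare, sq_abs]

lemma aestronglyMeasurable_partialHaarSnd {f : ℝ × ℝ → ℝ} (hf : AEStronglyMeasurable f volume)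
    (J : DyadicInterval) : AEStronglyMeasurable (partialHaarSnd f J) volume := by
  have h : AEStronglyMeasurable (fun z : ℝ × ℝ => f z * J.haar z.2) (volume.prod volume) :=
    hf.mul (J.measurable_haar.comp measurable_snd).aestronglyMeasurable
  exact h.integral_prod_right'

lemma ae_memLp_section {f : ℝ × ℝ → ℝ} {p : ℝ} (hp : 0 < p) (hf : MemLp f (ENNReal.ofReal p)) :
    ∀ᵐ x : ℝ, MemLp (fun y => f (x, y)) (ENNReal.ofReal p) := by
  have h0 : ENNReal.ofReal p ≠ 0 := by simpa using hp
  have h1 : ∫⁻ z, ‖f z‖ₑ ^ p < ∞ := by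
    have := (eLpNorm_lt_top_iff_lintegral_rpow_enorm_lt_top h0 ENNReal.ofReal_ne_top).1 hf.2
    rwa [ENNReal.toReal_ofReal hp.le] at this
  have hm : AEMeasurable (fun z => ‖f z‖ₑ ^ p) (volume.prod volume) := hf.1.enorm.pow_const p
  rw [Measure.volume_eq_prod, lintegral_prod _ hm] at h1
  have h2 := ae_lt_top' hm.lintegral_prod_right' h1.ne
  have h3 : ∀ᵐ x : ℝ, AEStronglyMeasurable (fun y => f (x, y)) volume :=
    AEStronglyMeasurable.prodMk_left (μ := (volume : Measure ℝ)) (ν := (volume : Measure ℝ)) hf.1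
  filter_upwards [h2, h3] with x hx hx'
  refine ⟨hx', (eLpNorm_lt_top_iff_lintegral_rpow_enorm_lt_top h0 ENNReal.ofReal_ne_top).2 ?_⟩
  rwa [ENNReal.toReal_ofReal hp.le]

/-- The `L^p` bound of the square function in the second variable. -/
theorem exists_rowNorm_partialHaarSnd_le {p : ℝ} (hp : 1 < p) : ∃ C : ℝ≥0, ∀ f : ℝ × ℝ → ℝ,
    MemLp f (ENNReal.ofReal p) → ∀ F : Finset DyadicInterval,
      rowNorm p F (partialHaarSnd f) ≤ C * eLpNorm f (ENNReal.ofReal p) volume := by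
  obtain ⟨C, hC⟩ := exists_lintegral_square_le hp
  have hp0 : 0 < p := by linarith
  refine ⟨C ^ (1 / p), fun f hf F => ?_⟩
  have h0 : ENNReal.ofReal p ≠ 0 := by simpa using hp0
  rw [eLpNorm_eq_lintegral_rpow_enorm_toReal h0 ENNReal.ofReal_ne_top,
    ENNReal.toReal_ofReal hp0.le, ENNReal.coe_rpow_of_nonneg _ (by positivity),
    ← ENNReal.mul_rpow_of_nonneg _ _ (by positivity), rowNorm]
  refine ENNReal.rpow_le_rpow ?_ (by positivity)
  have hm : AEMeasurable (fun z => ‖f z‖ₑ ^ p) (volume.prod volume) := hf.1.enorm.pow_const p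
  have hm2 : AEMeasurable (fun z => rowSquare F (partialHaarSnd f) z ^ (p / 2))
      (volume.prod volume) :=
    (aemeasurable_rowSquare fun J =>
      (aestronglyMeasurable_partialHaarSnd hf.1 J).aemeasurable).pow_const _
  rw [Measure.volume_eq_prod, lintegral_prod _ hm, lintegral_prod _ hm2,
    ← lintegral_const_mul'' _ hm.lintegral_prod_right']
  refine lintegral_mono_ae ?_
  -- For fixed `x` the row square function is the one-variable square function of the section `f (x,
  -- ·)`.
  filter_upwards [ae_memLp_section hp0 hf] with x hx
  exact hC _ hx F

lemma integrable_mul_of_bounded {f k : ℝ × ℝ → ℝ} {p : ℝ≥0∞} (hp : 1 ≤ p)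
    (hf : MemLp f p volume) (hk : Measurable k) {c : ℝ} (hc : ∀ z, |k z| ≤ c)
    {R : DyadicRectangle} (hR : ∀ z ∉ R.toSet, k z = 0) : Integrable (fun z => f z * k z) := by
  have hm : MeasurableSet R.toSet := R.1.measurableSet_toSet.prod R.2.measurableSet_toSet
  have hfin : volume R.toSet < ∞ := by
    rw [DyadicRectangle.toSet, Measure.volume_eq_prod, Measure.prod_prod, volume_toSet,
      volume_toSet]
    exact ENNReal.mul_lt_top ENNReal.ofReal_lt_top ENNReal.ofReal_lt_top
  have : IsFiniteMeasure (volume.restrict R.toSet) := ⟨by rwa [Measure.restrict_apply_univ]⟩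
  have h1 : IntegrableOn f R.toSet := (hf.restrict R.toSet).integrable hp
  have h2 : Integrable (R.toSet.indicator f) := (integrable_indicator_iff hm).2 h1
  refine (h2.mul_bdd hk.aestronglyMeasurable (.of_forall hc)).congr (.of_forall fun z => ?_)
  by_cases hz : z ∈ R.toSet
  · simp only [Set.indicator_of_mem hz]
  · simp only [Set.indicator_of_notMem hz, hR z hz, mul_zero]

lemma abs_char_mul_haar_le (R : DyadicRectangle) (z : ℝ × ℝ) :
    |R.1.char z.1 * R.2.haar z.2| ≤ 1 / Real.sqrt R.2.len := by
  rw [abs_mul, abs_haar, abs_of_nonneg (char_nonneg _ _), ← mul_div_assoc]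
  gcongr
  rcases R.1.char_eq_zero_or_one z.1 with h | h <;> rcases R.2.char_eq_zero_or_one z.2 with h' | h'
    <;> simp [h, h']

lemma integrable_mul_char_mul_haar {f : ℝ × ℝ → ℝ} {p : ℝ≥0∞} (hp : 1 ≤ p)
    (hf : MemLp f p volume) (R : DyadicRectangle) :
    Integrable (fun z : ℝ × ℝ => f z * (R.1.char z.1 * R.2.haar z.2)) := by
  refine integrable_mul_of_bounded hp hf
    ((R.1.measurable_char.comp measurable_fst).mul (R.2.measurable_haar.comp measurable_snd))
    (abs_char_mul_haar_le R) (R := R) fun z hz => ?_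
  by_cases h1 : z.1 ∈ R.1.toSet
  · rw [haar_of_notMem (fun h2 => hz ⟨h1, h2⟩), mul_zero]
  · rw [char_of_notMem h1, zero_mul]

lemma integral_char_mul_partialHaarSnd (f : ℝ × ℝ → ℝ) (R : DyadicRectangle) (x : ℝ) :
    ∫ y, f (x, y) * (R.1.char x * R.2.haar y) = partialHaarSnd f R.2 x * R.1.char x := by
  rw [partialHaarSnd, ← integral_mul_const]
  congr 1; ext y; ring

lemma integrableOn_partialHaarSnd {f : ℝ × ℝ → ℝ} {p : ℝ≥0∞} (hp : 1 ≤ p)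
    (hf : MemLp f p volume) (I J : DyadicInterval) :
    IntegrableOn (partialHaarSnd f J) I.toSet := by
  have h := (integrable_mul_char_mul_haar hp hf (I, J)).integral_prod_left
  simp only [integral_char_mul_partialHaarSnd f (I, J)] at h
  rw [← integrable_indicator_iff I.measurableSet_toSet]
  refine h.congr (.of_forall fun x => ?_)
  by_cases hx : x ∈ I.toSet
  · simp only [char_of_mem hx, Set.indicator_of_mem hx, mul_one]
  · simp only [char_of_notMem hx, Set.indicator_of_notMem hx, mul_zero]

lemma coeffAvgHaar_eq_avg {f : ℝ × ℝ → ℝ} {p : ℝ≥0∞} (hp : 1 ≤ p) (hf : MemLp f p volume)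
    (R : DyadicRectangle) : coeffAvgHaar f R = avg (partialHaarSnd f R.2) R.1 := by
  have h : ∀ z : ℝ × ℝ, f z * (R.1.avgChar z.1 * R.2.haar z.2) =
      f z * (R.1.char z.1 * R.2.haar z.2) / R.1.len := fun z => by rw [avgChar]; ring
  simp_rw [coeffAvgHaar, h]
  rw [integral_div, avg, Measure.volume_eq_prod,
    integral_prod _ (integrable_mul_char_mul_haar hp hf R)]
  simp_rw [integral_char_mul_partialHaarSnd f R]
  rw [integral_mul_char]

lemma memLp_swap {f : ℝ × ℝ → ℝ} {p : ℝ≥0∞} (hf : MemLp f p volume) :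
    MemLp (fun z : ℝ × ℝ => f z.swap) p volume :=
  hf.comp_measurePreserving (Measure.measurePreserving_swap (μ := volume) (ν := volume))

lemma eLpNorm_swap {f : ℝ × ℝ → ℝ} {p : ℝ≥0∞} (hf : MemLp f p volume) :
    eLpNorm (fun z : ℝ × ℝ => f z.swap) p volume = eLpNorm f p volume :=
  eLpNorm_comp_measurePreserving hf.1
    (Measure.measurePreserving_swap (μ := volume) (ν := volume))

lemma partialHaarFst_eq (f : ℝ × ℝ → ℝ) :
    partialHaarFst f = partialHaarSnd (fun z => f z.swap) := rfl

lemma coeffHaarAvg_eq (f : ℝ × ℝ → ℝ) (R : DyadicRectangle) :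
    coeffHaarAvg f R = coeffAvgHaar (fun z => f z.swap) R.swap := by
  rw [coeffHaarAvg, coeffAvgHaar, Measure.volume_eq_prod, ← integral_prod_swap]
  congr 1; ext z
  simp only [Prod.fst_swap, Prod.snd_swap]; ring

lemma coeffHaarAvg_eq_avg {f : ℝ × ℝ → ℝ} {p : ℝ≥0∞} (hp : 1 ≤ p) (hf : MemLp f p volume)
    (R : DyadicRectangle) : coeffHaarAvg f R = avg (partialHaarFst f R.1) R.2 := by
  rw [coeffHaarAvg_eq, coeffAvgHaar_eq_avg hp (memLp_swap hf), partialHaarFst_eq]; rfl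

/-! #### Operator norms of matrices -/

lemma enorm_sum_le_l2OpNorm {ι : Type*} (A : ι → ι → ℝ) (S T : Finset ι) (v w : ι → ℝ) :
    ‖∑ i ∈ S, ∑ j ∈ T, A i j * v j * w i‖ₑ ≤ l2OpNorm A *
      ((∑ j ∈ T, ENNReal.ofReal (v j ^ 2)) ^ (1 / 2 : ℝ) *
        (∑ i ∈ S, ENNReal.ofReal (w i ^ 2)) ^ (1 / 2 : ℝ)) := by
  classical
  have hV0 : 0 ≤ ∑ j ∈ T, v j ^ 2 := Finset.sum_nonneg fun _ _ => sq_nonneg _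
  have root : ∀ t : ℝ, 0 ≤ t → ENNReal.ofReal t ^ (1 / 2 : ℝ) = ENNReal.ofReal (Real.sqrt t) := by
    intro t ht
    rw [ENNReal.ofReal_rpow_of_nonneg ht (by norm_num), Real.sqrt_eq_rpow]
  rw [← ENNReal.ofReal_sum_of_nonneg fun _ _ => sq_nonneg _,
    ← ENNReal.ofReal_sum_of_nonneg fun _ _ => sq_nonneg _, root _ hV0,
    root _ (Finset.sum_nonneg fun _ _ => sq_nonneg _)]
  set V := Real.sqrt (∑ j ∈ T, v j ^ 2) with hV
  have e1 : ∑ i ∈ S, ∑ j ∈ T, A i j * v j * w i = ∑ i ∈ S, (∑ j ∈ T, A i j * v j) * w i := by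
    simp_rw [Finset.sum_mul]
  rw [e1]
  rcases (Real.sqrt_nonneg _ : 0 ≤ V).eq_or_lt with h0 | hpos
  · have hv : ∀ j ∈ T, v j = 0 := by
      have := (Finset.sum_eq_zero_iff_of_nonneg fun j _ => sq_nonneg (v j)).1
        ((Real.sqrt_eq_zero hV0).1 h0.symm)
      exact fun j hj => pow_eq_zero_iff two_ne_zero |>.1 (this j hj)
    have : ∑ i ∈ S, (∑ j ∈ T, A i j * v j) * w i = 0 :=
      Finset.sum_eq_zero fun i _ => by
        rw [Finset.sum_eq_zero fun j hj => by rw [hv j hj, mul_zero], zero_mul]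
    simp [this]
  -- The test vectors of `l2OpNorm` have length at most one, so `v` is cut to `T` and divided by its
  -- nonzero length `V`.
  let u : ι →₀ ℝ := Finsupp.onFinset T (fun j => if j ∈ T then v j / V else 0) (by
    intro j hj; by_contra h; simp [h] at hj)
  have hsub : u.support ⊆ T := Finsupp.support_onFinset_subset
  have hu : ∀ j ∈ T, u j = v j / V := fun j hj => by simp [u, hj]
  have hu1 : ∑ j ∈ u.support, u j ^ 2 ≤ 1 := by
    rw [Finset.sum_subset hsub fun j _ hj => by rw [Finsupp.notMem_support_iff.1 hj]; norm_num,
      Finset.sum_congr rfl fun j hj => by rw [hu j hj, div_pow], ← Finset.sum_div, hV,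
      Real.sq_sqrt hV0, div_self]
    exact (Real.sqrt_pos.1 hpos).ne'
  have hAu : ∀ i, ∑ j ∈ u.support, A i j * u j = (∑ j ∈ T, A i j * v j) / V := by
    intro i
    rw [Finset.sum_subset hsub fun j _ hj => by rw [Finsupp.notMem_support_iff.1 hj, mul_zero],
      Finset.sum_div]
    exact Finset.sum_congr rfl fun j hj => by rw [hu j hj, mul_div_assoc]
  have hle : ENNReal.ofReal (Real.sqrt (∑ i ∈ S, ((∑ j ∈ T, A i j * v j) / V) ^ 2)) ≤
      l2OpNorm A := by
    refine le_trans ?_ (le_iSup₂_of_le u hu1 le_rfl)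
    rw [← root _ (Finset.sum_nonneg fun _ _ => sq_nonneg _),
      ENNReal.ofReal_sum_of_nonneg fun _ _ => sq_nonneg _]
    refine ENNReal.rpow_le_rpow ?_ (by norm_num)
    simp_rw [hAu]
    exact ENNReal.sum_le_tsum S
  refine le_trans ?_ (mul_le_mul_left hle _)
  rw [← ENNReal.ofReal_mul hpos.le, ← ENNReal.ofReal_mul (Real.sqrt_nonneg _),
    Real.enorm_eq_ofReal_abs]
  refine ENNReal.ofReal_le_ofReal ?_
  have e2 : Real.sqrt (∑ i ∈ S, ((∑ j ∈ T, A i j * v j) / V) ^ 2) =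
      Real.sqrt (∑ i ∈ S, (∑ j ∈ T, A i j * v j) ^ 2) / V := by
    simp_rw [div_pow]
    rw [← Finset.sum_div, Real.sqrt_div (Finset.sum_nonneg fun _ _ => sq_nonneg _),
      Real.sqrt_sq hpos.le]
  rw [e2, ← mul_assoc, div_mul_cancel₀ _ hpos.ne']
  refine abs_le.2 ⟨?_, Real.sum_mul_le_sqrt_mul_sqrt _ _ _⟩
  have := Real.sum_mul_le_sqrt_mul_sqrt S (fun i => ∑ j ∈ T, A i j * v j) (fun i => - w i)
  simp only [mul_neg, Finset.sum_neg_distrib, neg_sq] at this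
  linarith

/-! #### The bilinear estimate -/

lemma rowSquare_eq (F : Finset DyadicInterval) (φ : DyadicInterval → ℝ → ℝ) (z : ℝ × ℝ) :
    rowSquare F φ z =
      ∑ J ∈ F, ENNReal.ofReal ((φ J z.1 / Real.sqrt J.len * J.char z.2) ^ 2) := by
  refine Finset.sum_congr rfl fun J _ => ?_
  rw [mul_pow, div_pow, Real.sq_sqrt J.len_pos.le, sq (J.char _), char_mul_self]

/-- Both averages are written as one integral over the plane of the matrix `G(z)` applied to two
vectors; the `ℓ²` bound at each point precedes Hölder's inequality. General families `φ`, `ψ` are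
allowed, so that the estimate serves partial Haar coefficients, their absolute values and the `L²`
tensor form alike. -/
theorem enorm_sum_avg_le {p q : ℝ} (hpq : p.HolderConjugate q) {φ ψ : DyadicInterval → ℝ → ℝ}
    (hφ : ∀ J, AEMeasurable (φ J)) (hψ : ∀ I, AEMeasurable (ψ I))
    (hφi : ∀ I J : DyadicInterval, IntegrableOn (φ J) I.toSet)
    (hψi : ∀ I J : DyadicInterval, IntegrableOn (ψ I) J.toSet)
    (g : ℝ × ℝ → ℝ) {M : ℝ≥0∞} (hM : ∀ᵐ z, l2OpNorm (haarMatrix g z) ≤ M)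
    (S T : Finset DyadicInterval) :
    ‖∑ I ∈ S, ∑ J ∈ T, avg (φ J) I * avg (ψ I) J * haarCoeff g (I, J)‖ₑ ≤
      M * (rowNorm p T φ * rowNorm q S ψ) := by
  let v : DyadicInterval → ℝ × ℝ → ℝ := fun J z => φ J z.1 / Real.sqrt J.len * J.char z.2
  let w : DyadicInterval → ℝ × ℝ → ℝ := fun I z => ψ I z.2 / Real.sqrt I.len * I.char z.1
  have term : ∀ (I J : DyadicInterval) (z : ℝ × ℝ), haarMatrix g z I J * v J z * w I z =
      haarCoeff g (I, J) / (I.len * J.len) * ((φ J z.1 * I.char z.1) * (ψ I z.2 * J.char z.2)) := by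
    intro I J z
    have h1 := Real.mul_self_sqrt I.len_pos.le
    have h2 := Real.mul_self_sqrt J.len_pos.le
    have h3 := I.sqrt_len_pos.ne'
    have h4 := J.sqrt_len_pos.ne'
    have h5 := I.char_mul_self z.1
    have h6 := J.char_mul_self z.2
    simp only [haarMatrix, DyadicRectangle.area, v, w]
    rw [Real.sqrt_mul I.len_pos.le]
    conv_rhs => rw [← h1, ← h2, ← h5, ← h6]
    field_simp
  have int : ∀ I J : DyadicInterval, Integrable (fun z => haarMatrix g z I J * v J z * w I z) := by
    intro I J
    simp_rw [term]
    exact ((integrable_mul_char (hφi I J)).mul_prod (integrable_mul_char (hψi I J))).const_mul _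
  have ident : ∑ I ∈ S, ∑ J ∈ T, avg (φ J) I * avg (ψ I) J * haarCoeff g (I, J) =
      ∫ z, ∑ I ∈ S, ∑ J ∈ T, haarMatrix g z I J * v J z * w I z := by
    rw [integral_finsetSum _ fun I _ => integrable_finsetSum _ fun J _ => int I J]
    refine Finset.sum_congr rfl fun I _ => ?_
    rw [integral_finsetSum _ fun J _ => int I J]
    refine Finset.sum_congr rfl fun J _ => ?_
    simp_rw [term]
    rw [integral_const_mul, Measure.volume_eq_prod,
      integral_prod_mul (fun x => φ J x * I.char x) (fun y => ψ I y * J.char y),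
      integral_mul_char, integral_mul_char, avg, avg]
    have := I.len_ne_zero
    have := J.len_ne_zero
    field_simp
  rw [ident]
  refine (enorm_integral_le_lintegral_enorm _).trans ?_
  have mφ : AEMeasurable (fun z => rowSquare T φ z ^ (1 / 2 : ℝ)) :=
    (aemeasurable_rowSquare hφ).pow_const _
  have swap : MeasurePreserving (Prod.swap : ℝ × ℝ → ℝ × ℝ) volume volume :=
    Measure.measurePreserving_swap (μ := volume) (ν := volume)
  have mψ : AEMeasurable (fun z : ℝ × ℝ => rowSquare S ψ z.swap ^ (1 / 2 : ℝ)) :=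
    ((aemeasurable_rowSquare hψ).comp_quasiMeasurePreserving
      swap.quasiMeasurePreserving).pow_const _
  have bound : ∫⁻ z, ‖∑ I ∈ S, ∑ J ∈ T, haarMatrix g z I J * v J z * w I z‖ₑ ≤
      ∫⁻ z, M * (rowSquare T φ z ^ (1 / 2 : ℝ) * rowSquare S ψ z.swap ^ (1 / 2 : ℝ)) := by
    refine lintegral_mono_ae ?_
    filter_upwards [hM] with z hz
    refine (enorm_sum_le_l2OpNorm (haarMatrix g z) S T (fun J => v J z) (fun I => w I z)).trans ?_
    rw [rowSquare_eq, rowSquare_eq]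
    exact mul_le_mul_left hz _
  refine bound.trans ?_
  have mm : AEMeasurable
      (fun z => rowSquare T φ z ^ (1 / 2 : ℝ) * rowSquare S ψ z.swap ^ (1 / 2 : ℝ)) := mφ.mul mψ
  rw [lintegral_const_mul'' _ mm]
  refine mul_le_mul_right ?_ _
  refine (ENNReal.lintegral_mul_le_Lp_mul_Lq volume hpq mφ mψ).trans_eq ?_
  rw [rowNorm, rowNorm]
  congr 2
  · refine lintegral_congr fun z => ?_
    rw [← ENNReal.rpow_mul]; congr 1; ring
  · rw [← swap.lintegral_comp_emb MeasurableEquiv.prodComm.measurableEmbedding]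
    refine lintegral_congr fun z => ?_
    rw [← ENNReal.rpow_mul]; congr 1; ring

/-! ### Haar coefficients of finite sums -/

namespace DyadicRectangle

lemma measurable_haar (R : DyadicRectangle) : Measurable R.haar :=
  (R.1.measurable_haar.comp measurable_fst).mul (R.2.measurable_haar.comp measurable_snd)

lemma integral_haar_mul_haar (R R' : DyadicRectangle) :
    ∫ z, R.haar z * R'.haar z = if R = R' then 1 else 0 := by
  have h : ∀ z : ℝ × ℝ, R.haar z * R'.haar z =
      (R.1.haar z.1 * R'.1.haar z.1) * (R.2.haar z.2 * R'.2.haar z.2) := fun z => by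
    simp only [haar]; ring
  simp_rw [h]
  rw [Measure.volume_eq_prod, integral_prod_mul (fun x => R.1.haar x * R'.1.haar x)
    (fun y => R.2.haar y * R'.2.haar y), DyadicInterval.integral_haar_mul_haar,
    DyadicInterval.integral_haar_mul_haar]
  by_cases h1 : R.1 = R'.1 <;> by_cases h2 : R.2 = R'.2 <;> simp [h1, h2, Prod.ext_iff]

lemma area_pos (R : DyadicRectangle) : 0 < R.area := mul_pos R.1.len_pos R.2.len_pos

lemma haar_of_notMem {R : DyadicRectangle} {z : ℝ × ℝ} (hz : z ∉ R.toSet) : R.haar z = 0 := by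
  by_cases h1 : z.1 ∈ R.1.toSet
  · rw [haar, DyadicInterval.haar_of_notMem (fun h2 => hz ⟨h1, h2⟩), mul_zero]
  · rw [haar, DyadicInterval.haar_of_notMem h1, zero_mul]

lemma abs_haar_le (R : DyadicRectangle) (z : ℝ × ℝ) :
    |R.haar z| ≤ 1 / Real.sqrt R.1.len * (1 / Real.sqrt R.2.len) := by
  rw [haar, abs_mul, abs_haar, abs_haar]
  have h1 : R.1.char z.1 ≤ 1 := by rcases R.1.char_eq_zero_or_one z.1 with h | h <;> simp [h]
  have h2 : R.2.char z.2 ≤ 1 := by rcases R.2.char_eq_zero_or_one z.2 with h | h <;> simp [h]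
  have := R.1.char_nonneg z.1
  have := R.2.char_nonneg z.2
  gcongr

lemma measurableSet_toSet (R : DyadicRectangle) : MeasurableSet R.toSet :=
  R.1.measurableSet_toSet.prod R.2.measurableSet_toSet

lemma volume_toSet (R : DyadicRectangle) : volume R.toSet = ENNReal.ofReal R.area := by
  rw [toSet, Measure.volume_eq_prod, Measure.prod_prod, DyadicInterval.volume_toSet,
    DyadicInterval.volume_toSet, area, ENNReal.ofReal_mul R.1.len_pos.le]

end DyadicRectangle

lemma memLp_of_bounded_of_support {k : ℝ × ℝ → ℝ} (hk : Measurable k) {c : ℝ}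
    (hc : ∀ z, |k z| ≤ c) {R : DyadicRectangle} (hR : ∀ z ∉ R.toSet, k z = 0) (p : ℝ≥0∞) :
    MemLp k p volume := by
  have : IsFiniteMeasure (volume.restrict R.toSet) := ⟨by
    rw [Measure.restrict_apply_univ, R.volume_toSet]; exact ENNReal.ofReal_lt_top⟩
  have h1 : MemLp k p (volume.restrict R.toSet) :=
    MemLp.of_bound hk.aestronglyMeasurable c (.of_forall hc)
  have h2 := (memLp_indicator_iff_restrict R.measurableSet_toSet).2 h1
  rwa [Set.indicator_eq_self.2 fun z hz => by_contra fun h => hz (hR z h)] at h2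

lemma DyadicRectangle.memLp_haar (R : DyadicRectangle) (p : ℝ≥0∞) : MemLp R.haar p volume :=
  memLp_of_bounded_of_support R.measurable_haar R.abs_haar_le (fun _ => R.haar_of_notMem) p

lemma integrable_mul_haar {f : ℝ × ℝ → ℝ} {p : ℝ≥0∞} (hp : 1 ≤ p) (hf : MemLp f p volume)
    (R : DyadicRectangle) : Integrable (fun z => f z * R.haar z) :=
  integrable_mul_of_bounded hp hf R.measurable_haar R.abs_haar_le (fun _ => R.haar_of_notMem)

lemma haarCoeff_congr {f g : ℝ × ℝ → ℝ} (h : f =ᵐ[volume] g) (R : DyadicRectangle) :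
    haarCoeff f R = haarCoeff g R :=
  integral_congr_ae (by filter_upwards [h] with z hz; rw [hz])

lemma haarCoeff_sum_haar (s : Finset DyadicRectangle) (a : DyadicRectangle → ℝ)
    (R : DyadicRectangle) :
    haarCoeff (fun z => ∑ R' ∈ s, a R' * R'.haar z) R = if R ∈ s then a R else 0 := by
  simp_rw [haarCoeff, Finset.sum_mul, mul_assoc]
  rw [integral_finsetSum _ fun R' _ =>
    (integrable_mul_haar le_rfl (R'.memLp_haar 1) R).const_mul _]
  simp_rw [integral_const_mul, DyadicRectangle.integral_haar_mul_haar]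
  simp

lemma FiniteHaarSupport.exists_finset {g : ℝ × ℝ → ℝ} (hg : FiniteHaarSupport g) :
    ∃ S : Finset DyadicInterval, ∀ R, R ∉ S ×ˢ S → haarCoeff g R = 0 := by
  classical
  obtain ⟨s, a, h⟩ := hg
  refine ⟨s.image Prod.fst ∪ s.image Prod.snd, fun R hR => ?_⟩
  rw [haarCoeff_congr h, haarCoeff_sum_haar, if_neg]
  refine fun hs => hR (Finset.mem_product.2 ⟨?_, ?_⟩)
  · exact Finset.mem_union_left _ (Finset.mem_image_of_mem _ hs)
  · exact Finset.mem_union_right _ (Finset.mem_image_of_mem _ hs)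

/-! ### Bounds of the paraproducts by the matrix norms -/

lemma exists_real_conjugate {p : ℝ≥0∞} (hp : 1 < p) (hp' : p < ∞) : ∃ r s : ℝ,
    r.HolderConjugate s ∧ p = ENNReal.ofReal r ∧ p.conjExponent = ENNReal.ofReal s := by
  have h1 : 1 < p.toReal := by
    rw [← ENNReal.toReal_one]; exact (ENNReal.toReal_lt_toReal ENNReal.one_ne_top hp'.ne).2 hp
  refine ⟨p.toReal, p.toReal.conjExponent, Real.HolderConjugate.conjExponent h1,
    (ENNReal.ofReal_toReal hp'.ne).symm, ?_⟩
  have h2 : 0 < p.toReal - 1 := by linarith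
  rw [ENNReal.conjExponent, Real.conjExponent]
  have h3 : p.toReal / (p.toReal - 1) = 1 + (p.toReal - 1)⁻¹ := by field_simp; ring
  rw [h3, ENNReal.ofReal_add zero_le_one (inv_nonneg.2 h2.le), ENNReal.ofReal_one,
    ENNReal.ofReal_inv_of_pos h2, ENNReal.ofReal_sub _ zero_le_one,
    ENNReal.ofReal_toReal hp'.ne, ENNReal.ofReal_one]

/-- The bilinear estimate for the partial Haar coefficients of two functions and for their absolute
values. -/
theorem exists_form_bound {r s : ℝ} (hrs : r.HolderConjugate s) : ∃ C : ℝ≥0, 0 < C ∧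
    ∀ (g : ℝ × ℝ → ℝ) (M : ℝ≥0∞), (∀ᵐ z, l2OpNorm (haarMatrix g z) ≤ M) →
    ∀ (S : Finset DyadicInterval) (f f' : ℝ × ℝ → ℝ),
      MemLp f (ENNReal.ofReal r) volume → MemLp f' (ENNReal.ofReal s) volume →
      ‖∑ R ∈ S ×ˢ S, coeffAvgHaar f R * coeffHaarAvg f' R * haarCoeff g R‖ₑ ≤
        C * M * (eLpNorm f (ENNReal.ofReal r) volume * eLpNorm f' (ENNReal.ofReal s) volume) ∧
      ‖∑ R ∈ S ×ˢ S, avg (fun x => |partialHaarSnd f R.2 x|) R.1 *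
          avg (fun y => |partialHaarFst f' R.1 y|) R.2 * haarCoeff g R‖ₑ ≤
        C * M * (eLpNorm f (ENNReal.ofReal r) volume * eLpNorm f' (ENNReal.ofReal s) volume) := by
  obtain ⟨A, hA⟩ := exists_rowNorm_partialHaarSnd_le hrs.lt
  obtain ⟨B, hB⟩ := exists_rowNorm_partialHaarSnd_le hrs.symm.lt
  have hr : 1 ≤ ENNReal.ofReal r := by simpa using hrs.lt.le
  have hs : 1 ≤ ENNReal.ofReal s := by simpa using hrs.symm.lt.le
  -- The product `A * B` already bounds the form; adding one makes the constant positive.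
  refine ⟨A * B + 1, by positivity, fun g M hM S f f' hf hf' => ?_⟩
  have fin : M * (rowNorm r S (partialHaarSnd f) * rowNorm s S (partialHaarFst f')) ≤
      ↑(A * B + 1) * M * (eLpNorm f (ENNReal.ofReal r) volume *
        eLpNorm f' (ENNReal.ofReal s) volume) := by
    have h2 := hB _ (memLp_swap hf') S
    rw [eLpNorm_swap hf', ← partialHaarFst_eq] at h2
    calc _ ≤ M * ((A * eLpNorm f (ENNReal.ofReal r) volume) *
          (B * eLpNorm f' (ENNReal.ofReal s) volume)) := by
          gcongr
          exact hA f hf S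
      _ = ↑(A * B) * M * (eLpNorm f (ENNReal.ofReal r) volume *
            eLpNorm f' (ENNReal.ofReal s) volume) := by push_cast; ring
      _ ≤ _ := by gcongr; exact le_self_add
  have mf : ∀ J, AEMeasurable (partialHaarSnd f J) := fun J =>
    (aestronglyMeasurable_partialHaarSnd hf.1 J).aemeasurable
  have mf' : ∀ I, AEMeasurable (partialHaarFst f' I) := fun I =>
    (aestronglyMeasurable_partialHaarSnd (memLp_swap hf').1 I).aemeasurable
  have jf : ∀ I J : DyadicInterval, IntegrableOn (partialHaarSnd f J) I.toSet :=
    integrableOn_partialHaarSnd hr hf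
  have jf' : ∀ I J : DyadicInterval, IntegrableOn (partialHaarFst f' I) J.toSet := fun I J =>
    integrableOn_partialHaarSnd hs (memLp_swap hf') J I
  constructor
  · simp_rw [coeffAvgHaar_eq_avg hr hf, coeffHaarAvg_eq_avg hs hf', Finset.sum_product]
    exact (enorm_sum_avg_le hrs mf mf' jf jf' g hM S S).trans fin
  · simp_rw [Finset.sum_product]
    refine (enorm_sum_avg_le hrs (φ := fun J x => |partialHaarSnd f J x|)
      (ψ := fun I y => |partialHaarFst f' I y|) (fun J => (mf J).abs) (fun I => (mf' I).abs)
      (fun I J => (jf I J).abs) (fun I J => (jf' I J).abs) g hM S S).trans ?_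
    rwa [rowNorm_abs, rowNorm_abs]

/-! ### Duality between `π⁴` and the bilinear form. -/

lemma abs_haar_mul_avgChar_le (R : DyadicRectangle) (z : ℝ × ℝ) :
    |R.1.haar z.1 * R.2.avgChar z.2| ≤ 1 / Real.sqrt R.1.len * (1 / R.2.len) := by
  rw [abs_mul, abs_haar, avgChar, abs_of_nonneg (div_nonneg (R.2.char_nonneg _) R.2.len_pos.le)]
  have h1 : R.1.char z.1 ≤ 1 := by rcases R.1.char_eq_zero_or_one z.1 with h | h <;> simp [h]
  have h2 : R.2.char z.2 ≤ 1 := by rcases R.2.char_eq_zero_or_one z.2 with h | h <;> simp [h]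
  have := R.1.char_nonneg z.1
  have := R.2.char_nonneg z.2
  have := R.2.len_pos
  gcongr

lemma measurable_haar_mul_avgChar (R : DyadicRectangle) :
    Measurable (fun z : ℝ × ℝ => R.1.haar z.1 * R.2.avgChar z.2) :=
  (R.1.measurable_haar.comp measurable_fst).mul (R.2.measurable_avgChar.comp measurable_snd)

lemma haar_mul_avgChar_of_notMem {R : DyadicRectangle} {z : ℝ × ℝ} (hz : z ∉ R.toSet) :
    R.1.haar z.1 * R.2.avgChar z.2 = 0 := by
  by_cases h1 : z.1 ∈ R.1.toSet
  · rw [avgChar, char_of_notMem (fun h2 => hz ⟨h1, h2⟩), zero_div, mul_zero]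
  · rw [haar_of_notMem h1, zero_mul]

lemma pi4_eq_sum {g : ℝ × ℝ → ℝ} {S : Finset DyadicInterval}
    (hS : ∀ R, R ∉ S ×ˢ S → haarCoeff g R = 0) (f : ℝ × ℝ → ℝ) (z : ℝ × ℝ) :
    pi4 g f z = ∑ R ∈ S ×ˢ S,
      coeffAvgHaar f R * haarCoeff g R * (R.1.haar z.1 * R.2.avgChar z.2) :=
  tsum_eq_sum fun R hR => by rw [hS R hR, mul_zero, zero_mul]

lemma memLp_pi4 {g : ℝ × ℝ → ℝ} {S : Finset DyadicInterval}
    (hS : ∀ R, R ∉ S ×ˢ S → haarCoeff g R = 0) (f : ℝ × ℝ → ℝ) (p : ℝ≥0∞) :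
    MemLp (pi4 g f) p volume := by
  have : pi4 g f = fun z => ∑ R ∈ S ×ˢ S,
      coeffAvgHaar f R * haarCoeff g R * (R.1.haar z.1 * R.2.avgChar z.2) :=
    funext (pi4_eq_sum hS f)
  rw [this]
  exact memLp_finsetSum _ fun R _ => (memLp_of_bounded_of_support (measurable_haar_mul_avgChar R)
    (abs_haar_mul_avgChar_le R) (fun _ => haar_mul_avgChar_of_notMem) p).const_mul _

lemma integral_mul_pi4 {g : ℝ × ℝ → ℝ} {S : Finset DyadicInterval}
    (hS : ∀ R, R ∉ S ×ˢ S → haarCoeff g R = 0) (f : ℝ × ℝ → ℝ) {f' : ℝ × ℝ → ℝ} {q : ℝ≥0∞}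
    (hq : 1 ≤ q) (hf' : MemLp f' q volume) :
    ∫ z, f' z * pi4 g f z =
      ∑ R ∈ S ×ˢ S, coeffAvgHaar f R * coeffHaarAvg f' R * haarCoeff g R := by
  have int : ∀ R : DyadicRectangle,
      Integrable (fun z : ℝ × ℝ => f' z * (R.1.haar z.1 * R.2.avgChar z.2)) := fun R =>
    integrable_mul_of_bounded hq hf' (measurable_haar_mul_avgChar R)
      (abs_haar_mul_avgChar_le R) (fun _ => haar_mul_avgChar_of_notMem)
  have e : ∀ (z : ℝ × ℝ) (R : DyadicRectangle),
      f' z * (coeffAvgHaar f R * haarCoeff g R * (R.1.haar z.1 * R.2.avgChar z.2)) =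
        coeffAvgHaar f R * haarCoeff g R * (f' z * (R.1.haar z.1 * R.2.avgChar z.2)) :=
    fun z R => mul_left_comm _ _ _
  simp_rw [pi4_eq_sum hS f, Finset.mul_sum, e]
  rw [integral_finsetSum _ fun R _ => (int R).const_mul _]
  refine Finset.sum_congr rfl fun R _ => ?_
  rw [integral_const_mul, coeffHaarAvg]
  ring

/-- The extremal function in the duality between `L^r` and `L^s`. -/
lemma exists_dual_function {r s : ℝ} (hrs : r.HolderConjugate s) {h : ℝ × ℝ → ℝ}
    (hh : MemLp h (ENNReal.ofReal r) volume) :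
    ∃ k : ℝ × ℝ → ℝ, MemLp k (ENNReal.ofReal s) volume ∧
      eLpNorm k (ENNReal.ofReal s) volume = (∫⁻ z, ‖h z‖ₑ ^ r) ^ (1 / s) ∧
      ENNReal.ofReal (∫ z, k z * h z) = ∫⁻ z, ‖h z‖ₑ ^ r := by
  have hr0 := hrs.pos
  have hs0 := hrs.symm.pos
  have hm := hh.1.aemeasurable
  have hfin : ∫⁻ z, ‖h z‖ₑ ^ r < ∞ := by
    have := (eLpNorm_lt_top_iff_lintegral_rpow_enorm_lt_top (by simpa using hr0)
      ENNReal.ofReal_ne_top).1 hh.2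
    rwa [ENNReal.toReal_ofReal hr0.le] at this
  let k : ℝ × ℝ → ℝ := fun z => SignType.sign (h z) * |h z| ^ (r - 1)
  have habs : ∀ z, |k z| = |h z| ^ (r - 1) := by
    intro z
    rcases lt_trichotomy (h z) 0 with hz | hz | hz
    · simp only [k, sign_neg hz]
      rw [abs_mul, abs_of_nonneg (by positivity : 0 ≤ |h z| ^ (r - 1))]; simp
    · simp [k, hz, Real.zero_rpow hrs.sub_one_ne_zero]
    · simp only [k, sign_pos hz]
      rw [abs_mul, abs_of_nonneg (by positivity : 0 ≤ |h z| ^ (r - 1))]; simp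
  have hpow : ∀ z, ‖k z‖ₑ ^ s = ‖h z‖ₑ ^ r := by
    intro z
    rw [Real.enorm_eq_ofReal_abs, Real.enorm_eq_ofReal_abs, habs,
      ENNReal.ofReal_rpow_of_nonneg (by positivity) hs0.le,
      ENNReal.ofReal_rpow_of_nonneg (by positivity) hr0.le, ← Real.rpow_mul (abs_nonneg _),
      hrs.sub_one_mul_conj]
  have hprod : ∀ z, k z * h z = |h z| ^ r := by
    intro z
    have h1 : k z * h z = |h z| ^ (r - 1) * |h z| := by
      simp only [k]
      rw [mul_right_comm, mul_comm]
      congr 1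
      exact sign_mul_self (h z)
    rw [h1, ← Real.rpow_add_one' (abs_nonneg _) (by linarith)]
    congr 1; ring
  have hkm : AEStronglyMeasurable k volume := by
    have h1 : Measurable (fun t : ℝ => (SignType.sign t : ℝ) * |t| ^ (r - 1)) := by
      have : (fun t : ℝ => (SignType.sign t : ℝ)) =
          fun t => if 0 < t then 1 else if t < 0 then -1 else 0 := by
        ext t; rw [sign_apply]; split_ifs <;> simp
      refine Measurable.mul ?_ (by fun_prop)
      rw [this]
      exact Measurable.ite measurableSet_Ioi measurable_const
        (Measurable.ite measurableSet_Iio measurable_const measurable_const)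
    exact (h1.comp_aemeasurable hm).aestronglyMeasurable
  have hnorm : eLpNorm k (ENNReal.ofReal s) volume = (∫⁻ z, ‖h z‖ₑ ^ r) ^ (1 / s) := by
    rw [eLpNorm_eq_lintegral_rpow_enorm_toReal (by simpa using hs0) ENNReal.ofReal_ne_top,
      ENNReal.toReal_ofReal hs0.le]
    simp_rw [hpow]
  refine ⟨k, ⟨hkm, ?_⟩, hnorm, ?_⟩
  · rw [hnorm]
    exact ENNReal.rpow_lt_top_of_nonneg (by positivity) hfin.ne
  · simp_rw [hprod]
    rw [ofReal_integral_eq_lintegral_ofReal]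
    · refine lintegral_congr fun z => ?_
      rw [Real.enorm_eq_ofReal_abs, ENNReal.ofReal_rpow_of_nonneg (abs_nonneg _) hr0.le]
    · have := hh.integrable_norm_rpow (by simpa using hr0) ENNReal.ofReal_ne_top
      rwa [ENNReal.toReal_ofReal hr0.le] at this
    · exact .of_forall fun z => by positivity

/-- The operator norm of `π⁴_g` is controlled by the matrix norms. -/
theorem exists_pi4Norm_le {p : ℝ≥0∞} (hp : 1 < p) (hp' : p < ∞) : ∃ C : ℝ≥0,
    ∀ g : ℝ × ℝ → ℝ, FiniteHaarSupport g → ∀ M, (∀ᵐ z, l2OpNorm (haarMatrix g z) ≤ M) →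
      pi4Norm p g ≤ C * M := by
  obtain ⟨r, s, hrs, rfl, -⟩ := exists_real_conjugate hp hp'
  obtain ⟨C, -, hC⟩ := exists_form_bound hrs
  refine ⟨C, fun g hg M hM => iSup_le fun f => iSup₂_le fun hf hf1 => ?_⟩
  obtain ⟨S, hS⟩ := hg.exists_finset
  have hh := memLp_pi4 hS f (ENNReal.ofReal r)
  obtain ⟨k, hk, hkn, hki⟩ := exists_dual_function hrs hh
  have hs : 1 ≤ ENNReal.ofReal s := by simpa using hrs.symm.lt.le
  have h1 := (hC g M hM S f k hf hk).1
  rw [← integral_mul_pi4 hS f hs hk, hkn] at h1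
  have hr0 := hrs.pos
  rw [eLpNorm_eq_lintegral_rpow_enorm_toReal (by simpa using hr0) ENNReal.ofReal_ne_top,
      ENNReal.toReal_ofReal hr0.le]
  have hfin : ∫⁻ z, ‖pi4 g f z‖ₑ ^ r < ∞ := by
    have := (eLpNorm_lt_top_iff_lintegral_rpow_enorm_lt_top (by simpa using hr0)
      ENNReal.ofReal_ne_top).1 hh.2
    rwa [ENNReal.toReal_ofReal hr0.le] at this
  set Y := ∫⁻ z, ‖pi4 g f z‖ₑ ^ r
  rcases eq_or_ne Y 0 with h0 | h0
  · rw [h0, ENNReal.zero_rpow_of_pos (by positivity)]; exact zero_le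
  have h2 : Y ≤ C * M * Y ^ (1 / s) := by
    calc Y = ENNReal.ofReal (∫ z, k z * pi4 g f z) := hki.symm
      _ ≤ ‖∫ z, k z * pi4 g f z‖ₑ := by
          rw [Real.enorm_eq_ofReal_abs]; exact ENNReal.ofReal_le_ofReal (le_abs_self _)
      _ ≤ _ := h1
      _ ≤ C * M * (1 * Y ^ (1 / s)) := by gcongr
      _ = _ := by rw [one_mul]
  -- The bound `Y ≤ C M Y^{1/s}` becomes `Y^{1/r} ≤ C M`. The cancellation needs `Y < ∞`, which
  -- holds because `π⁴_g(f)` is a finite sum of bounded functions supported on rectangles.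
  have h3 : Y = Y ^ (1 / r) * Y ^ (1 / s) := by
    rw [← ENNReal.rpow_add _ _ h0 hfin.ne, one_div, one_div, hrs.inv_add_inv_eq_one,
      ENNReal.rpow_one]
  have h4 : Y ^ (1 / s) ≠ 0 := fun h => by
    rw [ENNReal.rpow_eq_zero_iff] at h
    rcases h with h | h
    · exact h0 h.1
    · exact hfin.ne h.1
  have h5 : Y ^ (1 / s) ≠ ∞ :=
    (ENNReal.rpow_lt_top_of_nonneg (by have := hrs.symm.pos; positivity) hfin.ne).ne
  nth_rewrite 1 [h3] at h2
  exact (ENNReal.mul_le_mul_iff_left h4 h5).1 h2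

/-- The pairing of `g` with `π³_{f'}(f)` is controlled by the matrix norms. -/
theorem exists_pi3_pairing_le {p : ℝ≥0∞} (hp : 1 < p) (hp' : p < ∞) : ∃ C : ℝ≥0,
    ∀ g : ℝ × ℝ → ℝ, ∀ M, (∀ᵐ z, l2OpNorm (haarMatrix g z) ≤ M) →
    ∀ (S : Finset DyadicInterval) (f f' : ℝ × ℝ → ℝ),
      (MemLp f p volume ∧ eLpNorm f p volume = 1) →
      (MemLp f' p.conjExponent volume ∧ eLpNorm f' p.conjExponent volume = 1) →
      ‖∑ R ∈ S ×ˢ S, pi3Coeff f' f R * haarCoeff g R‖ₑ ≤ C * M := by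
  obtain ⟨r, s, hrs, rfl, hps⟩ := exists_real_conjugate hp hp'
  obtain ⟨C, -, hC⟩ := exists_form_bound hrs
  refine ⟨C, fun g M hM S f f' hf hf' => ?_⟩
  rw [hps] at hf'
  have := (hC g M hM S f f' hf.1 hf'.1).1
  rwa [hf.2, hf'.2, mul_one, mul_one] at this

theorem exists_pi3DualNorm_le {p : ℝ≥0∞} (hp : 1 < p) (hp' : p < ∞) : ∃ C : ℝ≥0,
    ∀ g : ℝ × ℝ → ℝ, FiniteHaarSupport g → ∀ M, (∀ᵐ z, l2OpNorm (haarMatrix g z) ≤ M) →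
      pi3DualNorm p g ≤ C * M := by
  obtain ⟨C, hC⟩ := exists_pi3_pairing_le hp hp'
  refine ⟨C, fun g hg M hM => iSup₂_le fun f f' => iSup₂_le fun hf hf' => ?_⟩
  obtain ⟨S, hS⟩ := hg.exists_finset
  rw [tsum_eq_sum (s := S ×ˢ S) fun R hR => by rw [hS R hR, mul_zero]]
  exact hC g M hM S f f' hf hf'

/-- Absolute values on the partial Haar coefficients do not change the square functions. Absolute
values on the entries of `G` may change its norm, hence the sign condition on `g`. -/
theorem exists_absPi4Norm_le {p : ℝ≥0∞} (hp : 1 < p) (hp' : p < ∞) : ∃ C : ℝ≥0,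
    ∀ g : ℝ × ℝ → ℝ, FiniteHaarSupport g → (∀ R, 0 ≤ haarCoeff g R) →
      ∀ M, (∀ᵐ z, l2OpNorm (haarMatrix g z) ≤ M) → absPi4Norm p g ≤ C * M := by
  obtain ⟨r, s, hrs, rfl, hps⟩ := exists_real_conjugate hp hp'
  obtain ⟨C, -, hC⟩ := exists_form_bound hrs
  refine ⟨C, fun g hg hpos M hM => iSup₂_le fun f f' => iSup₂_le fun hf hf' => ?_⟩
  obtain ⟨S, hS⟩ := hg.exists_finset
  rw [hps] at hf'
  have h := (hC g M hM S f f' hf.1 hf'.1).2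
  rw [hf.2, hf'.2, mul_one, mul_one] at h
  refine le_trans ?_ h
  have avg_nonneg : ∀ (k : ℝ → ℝ) (I : DyadicInterval), 0 ≤ avg (fun x => |k x|) I := fun k I =>
    div_nonneg (integral_nonneg fun x => abs_nonneg _) I.len_pos.le
  simp_rw [setAverage_eq_avg, abs_of_nonneg (hpos _)]
  rw [tsum_eq_sum (s := S ×ˢ S) fun R hR => by rw [hS R hR, mul_zero, ENNReal.ofReal_zero],
    ← ENNReal.ofReal_sum_of_nonneg fun R _ =>
      mul_nonneg (mul_nonneg (avg_nonneg _ _) (avg_nonneg _ _)) (hpos R),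
    Real.enorm_eq_ofReal_abs]
  exact ENNReal.ofReal_le_ofReal (le_abs_self _)

/-! ### Functions whose Haar coefficients depend on the generations only -/

/-- The dyadic intervals `I ⊆ [0, 1)` of generation less than `n`. -/
def unitIntervals (n : ℕ) : Finset DyadicInterval :=
  ((Finset.range n).sigma fun i => Finset.range (2 ^ i)).map
    ⟨fun s => ⟨(s.1 : ℤ), (s.2 : ℤ)⟩, by
      rintro ⟨a, b⟩ ⟨c, d⟩ h
      simp only [DyadicInterval.mk.injEq, Nat.cast_inj] at h
      obtain ⟨rfl, rfl⟩ := h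
      rfl⟩

lemma sum_unitIntervals {M : Type*} [AddCommMonoid M] (n : ℕ) (φ : DyadicInterval → M) :
    ∑ I ∈ unitIntervals n, φ I = ∑ i ∈ Finset.range n, ∑ a ∈ Finset.range (2 ^ i), φ ⟨i, a⟩ := by
  rw [unitIntervals, Finset.sum_map, Finset.sum_sigma]; rfl

lemma mem_unitIntervals {n : ℕ} {I : DyadicInterval} :
    I ∈ unitIntervals n ↔ ∃ i < n, ∃ a < 2 ^ i, (⟨(i : ℕ), (a : ℕ)⟩ : DyadicInterval) = I := by
  simp only [unitIntervals, Finset.mem_map, Finset.mem_sigma, Finset.mem_range,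
    Sigma.exists]
  constructor
  · rintro ⟨i, a, ⟨hi, ha⟩, rfl⟩
    exact ⟨i, hi, a, ha, rfl⟩
  · rintro ⟨i, hi, a, ha, rfl⟩
    exact ⟨i, a, ⟨hi, ha⟩, rfl⟩

/-- The dyadic rectangles with sides in `unitIntervals n`. -/
abbrev unitRectangles (n : ℕ) : Finset DyadicRectangle := unitIntervals n ×ˢ unitIntervals n

lemma len_natCast (i : ℕ) (a : ℤ) : (DyadicInterval.mk i a).len = ((2 : ℝ) ^ i)⁻¹ := by
  rw [len, zpow_neg, zpow_natCast]

lemma toSet_subset_unit {n : ℕ} {I : DyadicInterval} (h : I ∈ unitIntervals n) :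
    I.toSet ⊆ Set.Ico 0 1 := by
  obtain ⟨i, -, a, ha, rfl⟩ := mem_unitIntervals.1 h
  rw [toSet, len_natCast]
  have h2 : (0 : ℝ) < 2 ^ i := by positivity
  have h1 : (a : ℝ) + 1 ≤ 2 ^ i := by exact_mod_cast ha
  refine Set.Ico_subset_Ico (by positivity) ?_
  rw [← div_eq_mul_inv, div_le_one h2]
  simpa using h1

lemma containing_mem_unitIntervals {n i : ℕ} (hi : i < n) {x : ℝ} (hx : x ∈ Set.Ico (0 : ℝ) 1) :
    containing i x ∈ unitIntervals n := by
  have h2 : (0 : ℝ) < 2 ^ i := by positivity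
  have h0 : 0 ≤ x * 2 ^ i := mul_nonneg hx.1 h2.le
  refine mem_unitIntervals.2 ⟨i, hi, ⌊x * 2 ^ i⌋₊, ?_, ?_⟩
  · rw [Nat.floor_lt h0]; push_cast; nlinarith [hx.2]
  · rw [containing, zpow_natCast, Int.natCast_floor_eq_floor h0]

lemma sum_len_generation (i : ℕ) : ∑ a ∈ Finset.range (2 ^ i), (DyadicInterval.mk i a).len = 1 := by
  simp_rw [len_natCast]
  simp

/-- The Haar coefficients of `gridFun`. -/
def gridCoeff (A : ℕ → ℕ → ℝ) (R : DyadicRectangle) : ℝ :=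
  A R.1.gen.toNat R.2.gen.toNat * Real.sqrt R.area

/-- The function with Haar coefficients `A i j |I × J|^{1/2}` for the dyadic `I, J ⊆ [0, 1)` of
generations `i, j < n`. -/
def gridFun (n : ℕ) (A : ℕ → ℕ → ℝ) (z : ℝ × ℝ) : ℝ :=
  ∑ R ∈ unitRectangles n, gridCoeff A R * R.haar z

lemma finiteHaarSupport_gridFun (n : ℕ) (A : ℕ → ℕ → ℝ) : FiniteHaarSupport (gridFun n A) :=
  ⟨_, gridCoeff A, .rfl⟩

lemma haarCoeff_gridFun (n : ℕ) (A : ℕ → ℕ → ℝ) (R : DyadicRectangle) :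
    haarCoeff (gridFun n A) R =
      if R ∈ unitRectangles n then gridCoeff A R else 0 :=
  haarCoeff_sum_haar _ _ R

/-- The extension of a matrix by zero. -/
def extendMatrix {n : ℕ} (H : Matrix (Fin n) (Fin n) ℝ) (i j : ℕ) : ℝ :=
  if h : i < n ∧ j < n then H ⟨i, h.1⟩ ⟨j, h.2⟩ else 0

lemma extendMatrix_coe {n : ℕ} (H : Matrix (Fin n) (Fin n) ℝ) (i j : Fin n) :
    extendMatrix H i j = H i j := by
  rw [extendMatrix, dif_pos ⟨i.2, j.2⟩]

lemma exampleFun_eq_gridFun {n : ℕ} (H : Matrix (Fin n) (Fin n) ℝ) :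
    exampleFun H = gridFun n (extendMatrix H) := by
  ext z
  symm
  rw [gridFun, Finset.sum_product, sum_unitIntervals, Finset.sum_range, exampleFun]
  refine Finset.sum_congr rfl fun i _ => ?_
  simp_rw [sum_unitIntervals]
  rw [Finset.sum_comm, Finset.sum_range]
  refine Finset.sum_congr rfl fun j _ => Finset.sum_congr rfl fun a _ =>
    Finset.sum_congr rfl fun b _ => ?_
  simp only [gridCoeff, Int.toNat_natCast, extendMatrix_coe]

/-- The rectangles of generations `(i, j)` have total area one, so the `L²` pairing of grid
functions is the Frobenius pairing of their matrices. -/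
lemma sum_gridCoeff_mul (n : ℕ) (A B : ℕ → ℕ → ℝ) :
    ∑ R ∈ unitRectangles n, gridCoeff A R * gridCoeff B R =
      ∑ i ∈ Finset.range n, ∑ j ∈ Finset.range n, A i j * B i j := by
  rw [Finset.sum_product, sum_unitIntervals]
  refine Finset.sum_congr rfl fun i _ => ?_
  simp_rw [sum_unitIntervals]
  rw [Finset.sum_comm]
  refine Finset.sum_congr rfl fun j _ => ?_
  have h : ∀ a b : ℕ, gridCoeff A (⟨i, a⟩, ⟨j, b⟩) * gridCoeff B (⟨i, a⟩, ⟨j, b⟩) =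
      A i j * B i j * ((DyadicInterval.mk i a).len * (DyadicInterval.mk j b).len) := by
    intro a b
    simp only [gridCoeff, Int.toNat_natCast]
    have := Real.mul_self_sqrt (DyadicRectangle.area_pos (⟨i, a⟩, ⟨j, b⟩)).le
    rw [mul_mul_mul_comm, this, DyadicRectangle.area]
  simp_rw [h, ← Finset.mul_sum, sum_len_generation, mul_one, sum_len_generation, mul_one]

/-! #### The matrix norm -/

lemma haarMatrix_gridFun (n : ℕ) (A : ℕ → ℕ → ℝ) (z : ℝ × ℝ) (I J : DyadicInterval) :
    haarMatrix (gridFun n A) z I J = if I ∈ unitIntervals n ∧ J ∈ unitIntervals n then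
      A I.gen.toNat J.gen.toNat * (I.char z.1 * J.char z.2) else 0 := by
  rw [haarMatrix, haarCoeff_gridFun]
  simp only [Finset.mem_product]
  split_ifs
  · rw [gridCoeff, mul_div_assoc, div_self, mul_one]
    exact (Real.sqrt_pos.2 (DyadicRectangle.area_pos (I, J))).ne'
  · rw [zero_div, zero_mul]

lemma l2OpNorm_haarMatrix_gridFun_of_notMem (n : ℕ) (A : ℕ → ℕ → ℝ) {z : ℝ × ℝ}
    (hz : z ∉ Set.Ico (0 : ℝ) 1 ×ˢ Set.Ico (0 : ℝ) 1) :
    l2OpNorm (haarMatrix (gridFun n A) z) = 0 := by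
  have h : ∀ I J, haarMatrix (gridFun n A) z I J = 0 := by
    intro I J
    rw [haarMatrix_gridFun]
    split_ifs with hIJ
    · by_cases h1 : z.1 ∈ I.toSet
      · have h2 : z.2 ∉ J.toSet := fun h2 =>
          hz ⟨toSet_subset_unit hIJ.1 h1, toSet_subset_unit hIJ.2 h2⟩
        rw [char_of_notMem h2, mul_zero, mul_zero]
      · rw [char_of_notMem h1, zero_mul, mul_zero]
    · rfl
  refine le_antisymm (iSup₂_le fun v _ => ?_) zero_le
  simp [h]

/-- A matrix supported on a finite block that is a multiple of an isometry. -/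
lemma l2OpNorm_eq_sqrt {ι : Type*} {n : ℕ} (hn : 1 ≤ n) {H : Matrix (Fin n) (Fin n) ℝ} {K : ℝ}
    (hK : 0 ≤ K) (hH : ∀ v : Fin n → ℝ, ∑ i, (∑ j, H i j * v j) ^ 2 = K * ∑ j, v j ^ 2)
    {A : ι → ι → ℝ} {e e' : Fin n → ι} (he : Function.Injective e) (he' : Function.Injective e')
    (hA : ∀ i j, A (e i) (e' j) = H i j) (hA1 : ∀ I J, I ∉ Set.range e → A I J = 0)
    (hA2 : ∀ I J, J ∉ Set.range e' → A I J = 0) :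
    l2OpNorm A = ENNReal.ofReal (Real.sqrt K) := by
  classical
  have row : ∀ (v : ι →₀ ℝ) (I : ι),
      ∑ j ∈ v.support, A I j * v j = ∑ k, A I (e' k) * v (e' k) := by
    intro v I
    rw [← Finset.sum_image (s := Finset.univ) (f := fun j => A I j * v j) (g := e')
      fun a _ b _ h => he' h]
    refine Finset.sum_congr_of_eq_on_inter ?_ ?_ fun _ _ _ => rfl
    · intro j _ hj
      rw [hA2, zero_mul]
      rintro ⟨k, rfl⟩
      exact hj (Finset.mem_image_of_mem _ (Finset.mem_univ k))
    · intro j _ hj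
      rw [Finsupp.notMem_support_iff.1 hj, mul_zero]
  have val : ∀ v : ι →₀ ℝ, (∑' i, ENNReal.ofReal ((∑ j ∈ v.support, A i j * v j) ^ 2)) =
      ENNReal.ofReal (K * ∑ k, v (e' k) ^ 2) := by
    intro v
    simp_rw [row]
    rw [tsum_eq_sum (s := Finset.univ.image e), Finset.sum_image fun a _ b _ h => he h]
    · simp_rw [hA]
      rw [← hH fun k => v (e' k), ENNReal.ofReal_sum_of_nonneg fun _ _ => sq_nonneg _]
    · intro I hI
      have : I ∉ Set.range e := by
        rintro ⟨k, rfl⟩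
        exact hI (Finset.mem_image_of_mem _ (Finset.mem_univ k))
      simp [hA1 I _ this]
  have root : ∀ t : ℝ, 0 ≤ t → ENNReal.ofReal t ^ (1 / 2 : ℝ) = ENNReal.ofReal (Real.sqrt t) := by
    intro t ht
    rw [ENNReal.ofReal_rpow_of_nonneg ht (by norm_num), Real.sqrt_eq_rpow]
  refine le_antisymm (iSup₂_le fun v hv => ?_) ?_
  · rw [val, ← root K hK]
    refine ENNReal.rpow_le_rpow (ENNReal.ofReal_le_ofReal ?_) (by norm_num)
    refine mul_le_of_le_one_right hK (le_trans ?_ hv)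
    rw [← Finset.sum_image (s := Finset.univ) (f := fun j => v j ^ 2) (g := e')
      fun a _ b _ h => he' h,
      ← Finset.sum_filter_add_sum_filter_not _ (fun j => j ∈ v.support)]
    have h0 : ∑ j ∈ Finset.univ.image e' with j ∉ v.support, v j ^ 2 = 0 :=
      Finset.sum_eq_zero fun j hj => by
        rw [Finsupp.notMem_support_iff.1 (Finset.mem_filter.1 hj).2]; norm_num
    rw [h0, add_zero]
    exact Finset.sum_le_sum_of_subset_of_nonneg
      (fun j hj => (Finset.mem_filter.1 hj).2) fun _ _ _ => sq_nonneg _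
  · let k : Fin n := ⟨0, hn⟩
    refine le_iSup₂_of_le (Finsupp.single (e' k) 1) ?_ ?_
    · rw [Finsupp.support_single _ one_ne_zero]; simp
    · rw [val, root _ (mul_nonneg hK (Finset.sum_nonneg fun _ _ => sq_nonneg _))]
      refine ENNReal.ofReal_le_ofReal (Real.sqrt_le_sqrt ?_)
      refine le_mul_of_one_le_right hK ?_
      refine le_trans ?_ (Finset.single_le_sum (fun _ _ => sq_nonneg _) (Finset.mem_univ k))
      simp

/-- The only nonzero rows and columns belong to the intervals `containing i x` and `containing j y`,
one per generation, and on them the matrix is `H`. -/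
lemma l2OpNorm_haarMatrix_exampleFun {n : ℕ} (hn : 1 ≤ n) {H : Matrix (Fin n) (Fin n) ℝ} {K : ℝ}
    (hK : 0 ≤ K) (hH : ∀ v : Fin n → ℝ, ∑ i, (∑ j, H i j * v j) ^ 2 = K * ∑ j, v j ^ 2)
    {z : ℝ × ℝ} (hz : z ∈ Set.Ico (0 : ℝ) 1 ×ˢ Set.Ico (0 : ℝ) 1) :
    l2OpNorm (haarMatrix (exampleFun H) z) = ENNReal.ofReal (Real.sqrt K) := by
  have inj : ∀ x : ℝ, Function.Injective (fun i : Fin n => containing (i : ℕ) x) := by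
    intro x i j h
    have := congrArg DyadicInterval.gen h
    simpa [containing, Fin.ext_iff] using this
  have range : ∀ {x : ℝ} {I : DyadicInterval}, I ∈ unitIntervals n → x ∈ I.toSet →
      I ∈ Set.range (fun i : Fin n => containing (i : ℕ) x) := by
    intro x I hI hx
    obtain ⟨i, hi, a, -, rfl⟩ := mem_unitIntervals.1 hI
    exact ⟨⟨i, hi⟩, containing_eq_of_mem hx⟩
  rw [exampleFun_eq_gridFun]
  refine l2OpNorm_eq_sqrt hn hK hH (inj z.1) (inj z.2) (fun i j => ?_) (fun I J hI => ?_)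
    fun I J hJ => ?_
  · rw [haarMatrix_gridFun, if_pos ⟨containing_mem_unitIntervals i.2 hz.1,
      containing_mem_unitIntervals j.2 hz.2⟩, char_of_mem (mem_containing _ _),
      char_of_mem (mem_containing _ _), mul_one, mul_one]
    simp only [containing, Int.toNat_natCast, extendMatrix_coe]
  · rw [haarMatrix_gridFun]
    split_ifs with h
    · rw [char_of_notMem fun hx => hI (range h.1 hx), zero_mul, mul_zero]
    · rfl
  · rw [haarMatrix_gridFun]
    split_ifs with h
    · rw [char_of_notMem fun hx => hJ (range h.2 hx), mul_zero, mul_zero]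
    · rfl

lemma l2OpNorm_haarMatrix_exampleFun_le {n : ℕ} (hn : 1 ≤ n) {H : Matrix (Fin n) (Fin n) ℝ} {K : ℝ}
    (hK : 0 ≤ K) (hH : ∀ v : Fin n → ℝ, ∑ i, (∑ j, H i j * v j) ^ 2 = K * ∑ j, v j ^ 2)
    (z : ℝ × ℝ) : l2OpNorm (haarMatrix (exampleFun H) z) ≤ ENNReal.ofReal (Real.sqrt K) := by
  by_cases hz : z ∈ Set.Ico (0 : ℝ) 1 ×ˢ Set.Ico (0 : ℝ) 1
  · exact (l2OpNorm_haarMatrix_exampleFun hn hK hH hz).le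
  · rw [exampleFun_eq_gridFun, l2OpNorm_haarMatrix_gridFun_of_notMem _ _ hz]; exact zero_le

lemma IsHadamardMatrix.sum_sq {n : ℕ} (hn : 1 ≤ n) {H : Matrix (Fin n) (Fin n) ℝ}
    (hH : IsHadamardMatrix H) (v : Fin n → ℝ) :
    ∑ i, (∑ j, H i j * v j) ^ 2 = n * ∑ j, v j ^ 2 := by
  have hn0 : (n : ℝ) ≠ 0 := by positivity
  have h1 : H * ((n : ℝ)⁻¹ • H.transpose) = 1 := by
    rw [Matrix.mul_smul, hH.2, smul_smul, inv_mul_cancel₀ hn0, one_smul]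
  -- Orthogonality of the rows passes to the columns, as a one-sided inverse of a square matrix is
  -- two-sided.
  have h2 : H.transpose * H = (n : ℝ) • (1 : Matrix (Fin n) (Fin n) ℝ) := by
    have := mul_eq_one_comm.1 h1
    rw [← this, Matrix.smul_mul, smul_smul, mul_inv_cancel₀ hn0, one_smul]
  have e1 : ∑ i, (∑ j, H i j * v j) ^ 2 = (H.mulVec v) ⬝ᵥ (H.mulVec v) := by
    simp only [dotProduct, Matrix.mulVec, sq]
  have e2 : ∑ j, v j ^ 2 = v ⬝ᵥ v := by simp only [dotProduct, sq]
  rw [e1, e2, Matrix.dotProduct_mulVec, Matrix.vecMul_mulVec, ← Matrix.dotProduct_mulVec, h2,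
    Matrix.smul_mulVec, Matrix.one_mulVec, dotProduct_smul, smul_eq_mul]

lemma sum_sq_one_mulVec {n : ℕ} (v : Fin n → ℝ) :
    ∑ i, (∑ j, (1 : Matrix (Fin n) (Fin n) ℝ) i j * v j) ^ 2 = 1 * ∑ j, v j ^ 2 := by
  simp [Matrix.one_apply]

/-! #### The product `BMO` norm -/

lemma pairwise_disjoint_rectangles (i j : ℕ) (s : Set (ℕ × ℕ)) :
    s.PairwiseDisjoint
      (fun c : ℕ × ℕ => DyadicRectangle.toSet (⟨i, (c.1 : ℕ)⟩, ⟨j, (c.2 : ℕ)⟩)) := by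
  intro c _ d _ hcd
  refine Set.disjoint_left.2 fun z hc hd => hcd ?_
  have h1 : ((c.1 : ℕ) : ℤ) = (d.1 : ℕ) :=
    (mem_toSet_iff.1 hc.1).symm.trans (mem_toSet_iff (I := ⟨i, (d.1 : ℕ)⟩).1 hd.1)
  have h2 : ((c.2 : ℕ) : ℤ) = (d.2 : ℕ) :=
    (mem_toSet_iff.1 hc.2).symm.trans (mem_toSet_iff (I := ⟨j, (d.2 : ℕ)⟩).1 hd.2)
  exact Prod.ext (Nat.cast_inj.1 h1) (Nat.cast_inj.1 h2)

open Classical in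
lemma tsum_subset_eq (n : ℕ) (A : ℕ → ℕ → ℝ) (Ω : Set (ℝ × ℝ)) :
    (∑' R : DyadicRectangle,
      if R.toSet ⊆ Ω then ENNReal.ofReal (haarCoeff (gridFun n A) R ^ 2) else 0) =
    ∑ i ∈ Finset.range n, ∑ j ∈ Finset.range n, ENNReal.ofReal (A i j ^ 2) *
      ∑ c ∈ Finset.range (2 ^ i) ×ˢ Finset.range (2 ^ j),
        if DyadicRectangle.toSet (⟨i, (c.1 : ℕ)⟩, ⟨j, (c.2 : ℕ)⟩) ⊆ Ω then
          volume (DyadicRectangle.toSet (⟨i, (c.1 : ℕ)⟩, ⟨j, (c.2 : ℕ)⟩)) else 0 := by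
  rw [tsum_eq_sum (s := unitRectangles n) fun R hR => by
    rw [haarCoeff_gridFun, if_neg hR]; simp]
  have h : ∀ R : DyadicRectangle, R ∈ unitRectangles n →
      (if R.toSet ⊆ Ω then ENNReal.ofReal (haarCoeff (gridFun n A) R ^ 2) else 0) =
      ENNReal.ofReal (A R.1.gen.toNat R.2.gen.toNat ^ 2) *
        if R.toSet ⊆ Ω then volume R.toSet else 0 := by
    intro R hR
    rw [haarCoeff_gridFun, if_pos hR, gridCoeff, mul_pow, Real.sq_sqrt R.area_pos.le,
      ENNReal.ofReal_mul (sq_nonneg _), R.volume_toSet]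
    split_ifs <;> simp
  rw [Finset.sum_congr rfl h, Finset.sum_product, sum_unitIntervals]
  refine Finset.sum_congr rfl fun i _ => ?_
  simp_rw [sum_unitIntervals]
  rw [Finset.sum_comm]
  refine Finset.sum_congr rfl fun j _ => ?_
  simp only [Int.toNat_natCast]
  rw [Finset.mul_sum, Finset.sum_product]

open Classical in
-- For fixed generations the rectangles inside `Ω` are disjoint, so their areas add up to at most
-- `|Ω|`.
lemma tsum_subset_le (n : ℕ) (A : ℕ → ℕ → ℝ) (Ω : Set (ℝ × ℝ)) :
    (∑' R : DyadicRectangle,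
      if R.toSet ⊆ Ω then ENNReal.ofReal (haarCoeff (gridFun n A) R ^ 2) else 0) ≤
    ENNReal.ofReal (∑ i ∈ Finset.range n, ∑ j ∈ Finset.range n, A i j ^ 2) * volume Ω := by
  rw [tsum_subset_eq, ENNReal.ofReal_sum_of_nonneg fun i _ =>
    Finset.sum_nonneg fun j _ => sq_nonneg (A i j), Finset.sum_mul]
  refine Finset.sum_le_sum fun i _ => ?_
  rw [ENNReal.ofReal_sum_of_nonneg fun j _ => sq_nonneg (A i j), Finset.sum_mul]
  refine Finset.sum_le_sum fun j _ => mul_le_mul_right ?_ _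
  rw [← Finset.sum_filter, ← measure_biUnion_finset (pairwise_disjoint_rectangles i j _)
    fun c _ => DyadicRectangle.measurableSet_toSet _]
  exact measure_mono (Set.iUnion₂_subset fun c hc => (Finset.mem_filter.1 hc).2)

open Classical in
lemma tsum_subset_eq_of_unit_subset (n : ℕ) (A : ℕ → ℕ → ℝ) {Ω : Set (ℝ × ℝ)}
    (hΩ : Set.Ico (0 : ℝ) 1 ×ˢ Set.Ico (0 : ℝ) 1 ⊆ Ω) :
    (∑' R : DyadicRectangle,
      if R.toSet ⊆ Ω then ENNReal.ofReal (haarCoeff (gridFun n A) R ^ 2) else 0) =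
    ENNReal.ofReal (∑ i ∈ Finset.range n, ∑ j ∈ Finset.range n, A i j ^ 2) := by
  rw [tsum_eq_sum (s := unitRectangles n) fun R hR => by
    rw [haarCoeff_gridFun, if_neg hR]; simp]
  have h : ∀ R : DyadicRectangle, R ∈ unitRectangles n →
      (if R.toSet ⊆ Ω then ENNReal.ofReal (haarCoeff (gridFun n A) R ^ 2) else 0) =
      ENNReal.ofReal (gridCoeff A R * gridCoeff A R) := by
    intro R hR
    have hsub : R.toSet ⊆ Ω := (Set.prod_mono (toSet_subset_unit (Finset.mem_product.1 hR).1)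
      (toSet_subset_unit (Finset.mem_product.1 hR).2)).trans hΩ
    rw [haarCoeff_gridFun, if_pos hR, if_pos hsub, sq]
  rw [Finset.sum_congr rfl h, ← ENNReal.ofReal_sum_of_nonneg fun R _ => mul_self_nonneg _,
    sum_gridCoeff_mul]
  simp_rw [sq]

lemma prodBMONorm_gridFun (n : ℕ) (A : ℕ → ℕ → ℝ) :
    prodBMONorm (gridFun n A) =
      ENNReal.ofReal (Real.sqrt (∑ i ∈ Finset.range n, ∑ j ∈ Finset.range n, A i j ^ 2)) := by
  set σ := ∑ i ∈ Finset.range n, ∑ j ∈ Finset.range n, A i j ^ 2 with hσ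
  have hσ0 : 0 ≤ σ := Finset.sum_nonneg fun i _ => Finset.sum_nonneg fun j _ => sq_nonneg _
  have root : ∀ t : ℝ, 0 ≤ t → ENNReal.ofReal t ^ (1 / 2 : ℝ) = ENNReal.ofReal (Real.sqrt t) := by
    intro t ht
    rw [ENNReal.ofReal_rpow_of_nonneg ht (by norm_num), Real.sqrt_eq_rpow]
  refine le_antisymm (iSup₂_le fun Ω _ => iSup₂_le fun h0 h1 => ?_) ?_
  · rw [← root σ hσ0]
    refine ENNReal.rpow_le_rpow (ENNReal.div_le_of_le_mul ?_) (by norm_num)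
    exact tsum_subset_le n A Ω
  -- The half-open unit square would be extremal but is not open; the open squares `(-ε, 1)²`
  -- contain it and approximate its area.
  · have low : ∀ ε : ℝ, 0 < ε →
        ENNReal.ofReal (Real.sqrt (σ / (1 + ε) ^ 2)) ≤ prodBMONorm (gridFun n A) := by
      intro ε hε
      have hv : volume (Set.Ioo (-ε) 1 ×ˢ Set.Ioo (-ε) 1 : Set (ℝ × ℝ)) =
          ENNReal.ofReal ((1 + ε) ^ 2) := by
        rw [Measure.volume_eq_prod, Measure.prod_prod, Real.volume_Ioo,
          ← ENNReal.ofReal_mul (by linarith)]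
        congr 1; ring
      have hpos : (0 : ℝ) < (1 + ε) ^ 2 := by positivity
      refine le_iSup₂_of_le (Set.Ioo (-ε) 1 ×ˢ Set.Ioo (-ε) 1) (isOpen_Ioo.prod isOpen_Ioo)
        (le_iSup₂_of_le (by rw [hv]; simpa using hpos)
          (by rw [hv]; exact ENNReal.ofReal_lt_top) ?_)
      have hsub : Set.Ico (0 : ℝ) 1 ⊆ Set.Ioo (-ε) 1 := fun x hx => ⟨by linarith [hx.1], hx.2⟩
      rw [tsum_subset_eq_of_unit_subset n A (Set.prod_mono hsub hsub), hv,
        ← ENNReal.ofReal_div_of_pos hpos, root _ (by positivity)]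
    have lim : Filter.Tendsto (fun ε : ℝ => ENNReal.ofReal (Real.sqrt (σ / (1 + ε) ^ 2)))
        (nhdsWithin 0 (Set.Ioi 0)) (nhds (ENNReal.ofReal (Real.sqrt σ))) := by
      have hc : ContinuousAt (fun ε : ℝ => ENNReal.ofReal (Real.sqrt (σ / (1 + ε) ^ 2))) 0 := by
        refine ENNReal.continuous_ofReal.continuousAt.comp
          (Real.continuous_sqrt.continuousAt.comp ?_)
        exact ContinuousAt.div continuousAt_const (by fun_prop) (by norm_num)
      have := hc.tendsto
      simp only [add_zero, one_pow, div_one] at this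
      exact this.mono_left nhdsWithin_le_nhds
    exact le_of_tendsto lim (by filter_upwards [self_mem_nhdsWithin] with ε hε using low ε hε)

lemma prodBMONorm_exampleFun {n : ℕ} (H : Matrix (Fin n) (Fin n) ℝ) :
    prodBMONorm (exampleFun H) = ENNReal.ofReal (Real.sqrt (∑ i, ∑ j, H i j ^ 2)) := by
  rw [exampleFun_eq_gridFun, prodBMONorm_gridFun]
  congr 2
  rw [Finset.sum_range]
  refine Finset.sum_congr rfl fun i _ => ?_
  rw [Finset.sum_range]
  simp_rw [extendMatrix_coe]

lemma prodBMONorm_exampleFun_of_isSignMatrix {n : ℕ} {H : Matrix (Fin n) (Fin n) ℝ}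
    (hH : IsSignMatrix H) : prodBMONorm (exampleFun H) = n := by
  have h : ∀ i j, H i j ^ 2 = 1 := fun i j => by rcases hH i j with h | h <;> rw [h] <;> norm_num
  rw [prodBMONorm_exampleFun]
  simp_rw [h]
  simp [Real.sqrt_mul_self]

lemma prodBMONorm_exampleFun_one (n : ℕ) :
    prodBMONorm (exampleFun (1 : Matrix (Fin n) (Fin n) ℝ)) = ENNReal.ofReal (Real.sqrt n) := by
  rw [prodBMONorm_exampleFun]
  simp [Matrix.one_apply]

/-! #### Sylvester's matrices -/

lemma sylvesterEntry_eq_one_or (k i j : ℕ) :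
    sylvesterEntry k i j = 1 ∨ sylvesterEntry k i j = -1 := by
  induction k generalizing i j with
  | zero => exact .inl rfl
  | succ k ih =>
    rw [sylvesterEntry]
    rcases ih (i % 2 ^ k) (j % 2 ^ k) with h | h <;> rw [h] <;> split_ifs <;> simp

/-- On the second half of the columns the product of two rows is that on the first half times the
signs of both rows. The halves cancel if the rows lie in different blocks and otherwise double the
value for the reduced indices. -/
lemma sum_sylvesterEntry_mul (k : ℕ) : ∀ i l : ℕ, i < 2 ^ k → l < 2 ^ k →
    ∑ j ∈ Finset.range (2 ^ k), sylvesterEntry k i j * sylvesterEntry k l j =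
      if i = l then (2 : ℝ) ^ k else 0 := by
  induction k with
  | zero =>
    intro i l hi hl
    have : i = l := by simp at hi hl; omega
    simp [sylvesterEntry, this]
  | succ k ih =>
    intro i l hi hl
    have hpos : 0 < 2 ^ k := by positivity
    have e1 : ∀ m j, j < 2 ^ k →
        sylvesterEntry (k + 1) m j = sylvesterEntry k (m % 2 ^ k) j := by
      intro m j hj
      rw [sylvesterEntry, if_neg (by omega), one_mul, Nat.mod_eq_of_lt hj]
    have e2 : ∀ m j, j < 2 ^ k → sylvesterEntry (k + 1) m (2 ^ k + j) =
        (if 2 ^ k ≤ m then -1 else 1) * sylvesterEntry k (m % 2 ^ k) j := by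
      intro m j hj
      rw [sylvesterEntry, Nat.add_mod_left, Nat.mod_eq_of_lt hj]
      simp
    have h := ih (i % 2 ^ k) (l % 2 ^ k) (Nat.mod_lt _ hpos) (Nat.mod_lt _ hpos)
    have e3 : 2 ^ (k + 1) = 2 ^ k + 2 ^ k := by ring
    rw [e3, Finset.sum_range_add]
    rw [Finset.sum_congr rfl fun j hj => by
      rw [e1 i j (Finset.mem_range.1 hj), e1 l j (Finset.mem_range.1 hj)], h]
    rw [Finset.sum_congr rfl fun j hj => by
      rw [e2 i j (Finset.mem_range.1 hj), e2 l j (Finset.mem_range.1 hj), mul_mul_mul_comm],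
      ← Finset.mul_sum, h]
    rw [e3] at hi hl
    have modlt : ∀ m, m < 2 ^ k → m % 2 ^ k = m := fun m hm => Nat.mod_eq_of_lt hm
    have modge : ∀ m, 2 ^ k ≤ m → m < 2 ^ k + 2 ^ k → m % 2 ^ k = m - 2 ^ k := fun m h1 h2 => by
      rw [Nat.mod_eq_sub_mod h1, Nat.mod_eq_of_lt (by omega)]
    by_cases hi' : 2 ^ k ≤ i <;> by_cases hl' : 2 ^ k ≤ l
    · rw [modge i hi' hi, modge l hl' hl]
      by_cases hil : i = l
      · simp [hil, hl']; ring
      · rw [if_neg hil, if_neg (by omega)]; simp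
    · have : i ≠ l := by omega
      rw [if_neg this]
      simp only [hi', hl', if_true, if_false]
      ring
    · have : i ≠ l := by omega
      rw [if_neg this]
      simp only [hi', hl', if_true, if_false]
      ring
    · rw [modlt i (by omega), modlt l (by omega)]
      by_cases hil : i = l
      · simp [hil, hl']; ring
      · simp [hil]

lemma isHadamardMatrix_sylvesterMatrix (k : ℕ) : IsHadamardMatrix (sylvesterMatrix k) := by
  refine ⟨fun i j => sylvesterEntry_eq_one_or k i j, ?_⟩
  ext i l
  rw [Matrix.mul_apply]
  simp only [Matrix.transpose_apply, sylvesterMatrix, Matrix.of_apply, Matrix.smul_apply,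
    Matrix.one_apply, smul_eq_mul]
  rw [← Finset.sum_range (fun j => sylvesterEntry k i j * sylvesterEntry k l j),
    sum_sylvesterEntry_mul k i l i.2 l.2]
  simp [Fin.ext_iff]

/-! ### Averages and norms of grid functions -/

/-- A wavelet of a coarser generation is constant on `I`. Otherwise `χ_I` is constant on `K`, where
the wavelet has mean zero. -/
lemma DyadicInterval.avg_haar {I K : DyadicInterval} {x : ℝ} (hx : x ∈ I.toSet) :
    avg K.haar I = if K.gen < I.gen then K.haar x else 0 := by
  rw [avg]
  split_ifs with h
  · rw [setIntegral_congr_fun I.measurableSet_toSet fun y hy => haar_eq_of_mem h hy hx,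
      setIntegral_const, volume_real_toSet, smul_eq_mul, mul_div_cancel_left₀ _ I.len_ne_zero]
  · have h0 : ∀ y, K.haar y * I.char y = K.haar y * I.char (K.pos * K.len) := by
      intro y
      by_cases hy : y ∈ K.toSet
      · rw [char_eq_of_mem (not_lt.1 h) hy (y := K.pos * K.len)]
        exact ⟨le_rfl, by nlinarith [K.len_pos]⟩
      · rw [haar_of_notMem hy, zero_mul, zero_mul]
    rw [← integral_mul_char]
    simp_rw [h0]
    rw [integral_mul_const, integral_haar, zero_mul, zero_div]

lemma setAverage_mul (R : DyadicRectangle) (u v : ℝ → ℝ) :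
    ⨍ z in R.toSet, u z.1 * v z.2 = avg u R.1 * avg v R.2 := by
  rw [setAverage_eq, Measure.real, R.volume_toSet, ENNReal.toReal_ofReal R.area_pos.le,
    DyadicRectangle.toSet, Measure.volume_eq_prod, setIntegral_prod_mul, DyadicRectangle.area,
    smul_eq_mul, avg, avg]
  have := R.1.len_ne_zero
  have := R.2.len_ne_zero
  field_simp

lemma setAverage_haar {R : DyadicRectangle} (K : DyadicRectangle) {z : ℝ × ℝ} (hz : z ∈ R.toSet) :
    ⨍ w in R.toSet, K.haar w =
      if K.1.gen < R.1.gen ∧ K.2.gen < R.2.gen then K.haar z else 0 := by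
  refine (setAverage_mul R K.1.haar K.2.haar).trans ?_
  rw [avg_haar hz.1, avg_haar hz.2]
  by_cases h1 : K.1.gen < R.1.gen <;> by_cases h2 : K.2.gen < R.2.gen <;>
    simp [h1, h2, DyadicRectangle.haar]

/-- The matrix whose entries outside the generations coarser than `R` are deleted. -/
def truncateAt (R : DyadicRectangle) (A : ℕ → ℕ → ℝ) (i j : ℕ) : ℝ :=
  if (i : ℤ) < R.1.gen ∧ (j : ℤ) < R.2.gen then A i j else 0

lemma toNat_gen_of_mem {n : ℕ} {I : DyadicInterval} (h : I ∈ unitIntervals n) :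
    (I.gen.toNat : ℤ) = I.gen ∧ I.gen.toNat < n := by
  obtain ⟨i, hi, a, -, rfl⟩ := mem_unitIntervals.1 h
  simpa using hi

lemma measurable_gridFun (n : ℕ) (A : ℕ → ℕ → ℝ) : Measurable (gridFun n A) :=
  Finset.measurable_fun_sum _ fun R _ => R.measurable_haar.const_mul _

lemma memLp_gridFun (n : ℕ) (A : ℕ → ℕ → ℝ) (p : ℝ≥0∞) : MemLp (gridFun n A) p volume :=
  memLp_finsetSum _ fun R _ => (R.memLp_haar p).const_mul _

/-- Averaging acts as a conditional expectation: exactly the wavelets coarser than `R` in both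
variables survive, so an average is a value of another grid function. -/
lemma setAverage_gridFun (n : ℕ) (A : ℕ → ℕ → ℝ) {R : DyadicRectangle} {z : ℝ × ℝ}
    (hz : z ∈ R.toSet) : ⨍ w in R.toSet, gridFun n A w = gridFun n (truncateAt R A) z := by
  have e : ⨍ w in R.toSet, gridFun n A w =
      ∑ K ∈ unitRectangles n, gridCoeff A K * ⨍ w in R.toSet, K.haar w := by
    simp only [setAverage_eq, smul_eq_mul, gridFun]
    rw [integral_finsetSum _ fun K _ =>
      ((memLp_one_iff_integrable.1 (K.memLp_haar 1)).integrableOn).const_mul _, Finset.mul_sum]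
    refine Finset.sum_congr rfl fun K _ => ?_
    rw [integral_const_mul]; ring
  rw [e, gridFun]
  refine Finset.sum_congr rfl fun K hK => ?_
  have h1 := (toNat_gen_of_mem (Finset.mem_product.1 hK).1).1
  have h2 := (toNat_gen_of_mem (Finset.mem_product.1 hK).2).1
  rw [setAverage_haar K hz, gridCoeff, gridCoeff, truncateAt, h1, h2]
  split_ifs <;> ring

lemma gridFun_congr {n : ℕ} {A B : ℕ → ℕ → ℝ} (h : ∀ i < n, ∀ j < n, A i j = B i j) (z : ℝ × ℝ) :
    gridFun n A z = gridFun n B z := by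
  refine Finset.sum_congr rfl fun K hK => ?_
  rw [gridCoeff, gridCoeff, h _ (toNat_gen_of_mem (Finset.mem_product.1 hK).1).2 _
    (toNat_gen_of_mem (Finset.mem_product.1 hK).2).2]

/-! ### Pointwise, `L²` and `L¹` size of grid functions. -/

lemma sum_char_generation_le (i : ℕ) (x : ℝ) :
    ∑ a ∈ Finset.range (2 ^ i), (DyadicInterval.mk i a).char x ≤
      (Set.Ico (0 : ℝ) 1).indicator 1 x := by
  by_cases hx : ∃ a ∈ Finset.range (2 ^ i), x ∈ (DyadicInterval.mk i a).toSet
  · obtain ⟨a, ha, hxa⟩ := hx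
    have hmem : (DyadicInterval.mk i a) ∈ unitIntervals (i + 1) :=
      mem_unitIntervals.2 ⟨i, by omega, a, Finset.mem_range.1 ha, rfl⟩
    rw [Set.indicator_of_mem (toSet_subset_unit hmem hxa), Finset.sum_eq_single a,
      char_of_mem hxa]
    · rfl
    · intro b _ hb
      refine char_of_notMem fun hxb => hb ?_
      have : ((b : ℕ) : ℤ) = a := (mem_toSet_iff (I := ⟨i, b⟩).1 hxb).symm.trans
        (mem_toSet_iff (I := ⟨i, a⟩).1 hxa)
      exact_mod_cast this
    · exact fun h => absurd ha h
  · push Not at hx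
    rw [Finset.sum_eq_zero fun a ha => char_of_notMem (hx a ha)]
    exact Set.indicator_nonneg (fun _ _ => zero_le_one) _

/-- The characteristic function of the unit square. -/
def unitSquareChar : ℝ × ℝ → ℝ := (Set.Ico (0 : ℝ) 1 ×ˢ Set.Ico (0 : ℝ) 1).indicator 1

/-- The function `|R|^{1/2} h_R` has absolute value `χ_R`, and rectangles of the same generations
are disjoint. -/
lemma abs_gridFun_le (n : ℕ) (A : ℕ → ℕ → ℝ) (z : ℝ × ℝ) :
    |gridFun n A z| ≤
      (∑ i ∈ Finset.range n, ∑ j ∈ Finset.range n, |A i j|) * unitSquareChar z := by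
  have e : ∀ R : DyadicRectangle, |gridCoeff A R * R.haar z| =
      |A R.1.gen.toNat R.2.gen.toNat| * (R.1.char z.1 * R.2.char z.2) := by
    intro R
    have h1 := R.1.sqrt_len_pos
    have h2 := R.2.sqrt_len_pos
    rw [gridCoeff, DyadicRectangle.haar, abs_mul, abs_mul, abs_mul, abs_haar, abs_haar,
      DyadicRectangle.area, Real.sqrt_mul R.1.len_pos.le,
      abs_of_pos (mul_pos h1 h2)]
    field_simp
  have hsq : unitSquareChar z =
      (Set.Ico (0 : ℝ) 1).indicator 1 z.1 * (Set.Ico (0 : ℝ) 1).indicator 1 z.2 := by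
    by_cases h1 : z.1 ∈ Set.Ico (0 : ℝ) 1 <;> by_cases h2 : z.2 ∈ Set.Ico (0 : ℝ) 1 <;>
      simp [unitSquareChar, h1, h2, -Set.mem_Ico]
  refine (Finset.abs_sum_le_sum_abs _ _).trans ?_
  simp_rw [e]
  rw [Finset.sum_product, sum_unitIntervals, Finset.sum_mul]
  refine Finset.sum_le_sum fun i _ => ?_
  simp_rw [sum_unitIntervals]
  rw [Finset.sum_comm, Finset.sum_mul]
  refine Finset.sum_le_sum fun j _ => ?_
  simp only [Int.toNat_natCast]
  simp_rw [← Finset.mul_sum, ← Finset.sum_mul]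
  rw [hsq]
  refine mul_le_mul_of_nonneg_left (mul_le_mul (sum_char_generation_le i z.1)
    (sum_char_generation_le j z.2) (Finset.sum_nonneg fun _ _ => char_nonneg _ _)
    (Set.indicator_nonneg (fun _ _ => zero_le_one) _)) (abs_nonneg _)

lemma integral_gridFun_sq (n : ℕ) (A : ℕ → ℕ → ℝ) :
    ∫ z, gridFun n A z ^ 2 = ∑ i ∈ Finset.range n, ∑ j ∈ Finset.range n, A i j ^ 2 := by
  have e : ∀ z, gridFun n A z ^ 2 =
      ∑ R ∈ unitRectangles n, gridCoeff A R * (gridFun n A z * R.haar z) := by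
    intro z
    rw [sq]
    conv_lhs => rw [gridFun.eq_1 n A z, Finset.sum_mul]
    refine Finset.sum_congr rfl fun R _ => ?_
    rw [gridFun]; ring
  simp_rw [e]
  rw [integral_finsetSum _ fun R _ =>
    (integrable_mul_haar le_rfl (memLp_gridFun n A 1) R).const_mul _]
  simp_rw [sq]
  rw [← sum_gridCoeff_mul]
  refine Finset.sum_congr rfl fun R hR => ?_
  rw [integral_const_mul]
  change _ * haarCoeff (gridFun n A) R = _
  rw [haarCoeff_gridFun, if_pos hR]

lemma integrable_unitSquareChar : Integrable unitSquareChar := by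
  refine (integrable_indicator_iff (measurableSet_Ico.prod measurableSet_Ico)).2
    (integrableOn_const ?_)
  rw [Measure.volume_eq_prod, Measure.prod_prod]
  simp

lemma integral_unitSquareChar : ∫ z, unitSquareChar z = 1 := by
  rw [unitSquareChar, integral_indicator_one (measurableSet_Ico.prod measurableSet_Ico),
    Measure.real, Measure.volume_eq_prod, Measure.prod_prod]
  simp

lemma unitSquareChar_nonneg (z : ℝ × ℝ) : 0 ≤ unitSquareChar z :=
  Set.indicator_nonneg (fun _ _ => zero_le_one) _

/-- An `L¹` bound from the `L²` norm. -/
lemma integral_abs_gridFun_le (n : ℕ) (A : ℕ → ℕ → ℝ) {t : ℝ} (ht : 0 < t)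
    (h : ∑ i ∈ Finset.range n, ∑ j ∈ Finset.range n, A i j ^ 2 ≤ t ^ 2) :
    ∫ z, |gridFun n A z| ≤ t := by
  -- The arithmetic-geometric mean inequality replaces Cauchy–Schwarz on the unit square, outside of
  -- which the function vanishes.
  have pt : ∀ z, |gridFun n A z| ≤ (gridFun n A z ^ 2 / t + t * unitSquareChar z) / 2 := by
    intro z
    by_cases hz : z ∈ Set.Ico (0 : ℝ) 1 ×ˢ Set.Ico (0 : ℝ) 1
    · have h1 : unitSquareChar z = 1 := Set.indicator_of_mem hz _
      rw [h1, ← sq_abs, le_div_iff₀ two_pos, div_add' _ _ _ ht.ne', le_div_iff₀ ht]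
      nlinarith [sq_nonneg (|gridFun n A z| - t)]
    · have h1 : unitSquareChar z = 0 := Set.indicator_of_notMem hz _
      have h2 := abs_gridFun_le n A z
      rw [h1, mul_zero] at h2
      rw [h1, mul_zero, add_zero]
      exact h2.trans (by positivity)
  have i1 : Integrable (fun z => gridFun n A z ^ 2) := (memLp_gridFun n A 2).integrable_sq
  have i2 := integrable_unitSquareChar.const_mul t
  refine (integral_mono (memLp_one_iff_integrable.1 (memLp_gridFun n A 1)).abs
    (((i1.div_const t).add i2).div_const 2) pt).trans ?_
  simp only [Pi.add_apply]
  rw [integral_div, integral_add (i1.div_const t) i2, integral_div, integral_const_mul,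
    integral_unitSquareChar, integral_gridFun_sq, mul_one, div_le_iff₀ two_pos]
  have : (∑ i ∈ Finset.range n, ∑ j ∈ Finset.range n, A i j ^ 2) / t ≤ t := by
    rw [div_le_iff₀ ht]; linarith
  linarith

/-! ### A function in `H¹` without weak factorization -/

/-- A diagonal matrix with `4 ^ l` equal entries of sum one. -/
def blockMatrix (l i j : ℕ) : ℝ := if i = j ∧ 4 ^ l ≤ i then ((4 : ℝ) ^ l)⁻¹ else 0

/-- The blocks of the function that has no weak factorization. -/
def blockFun (l : ℕ) : ℝ × ℝ → ℝ := gridFun (2 * 4 ^ l) (blockMatrix l)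

/-- A function in `H¹` that has no weak factorization. -/
def nonFactorizable (z : ℝ × ℝ) : ℝ := ∑' l, blockFun l z

lemma blockMatrix_nonneg (l i j : ℕ) : 0 ≤ blockMatrix l i j := by
  rw [blockMatrix]; split_ifs <;> positivity

/-- Needed for `|t|`, where the result is `1`, and for `t²`, where it is `4^{-l}`. -/
lemma sum_blockMatrix_row (l : ℕ) (f : ℝ → ℝ) (hf : f 0 = 0) :
    ∑ i ∈ Finset.range (2 * 4 ^ l), ∑ j ∈ Finset.range (2 * 4 ^ l), f (blockMatrix l i j) =
      4 ^ l * f ((4 : ℝ) ^ l)⁻¹ := by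
  have h1 : ∀ i ∈ Finset.range (2 * 4 ^ l),
      ∑ j ∈ Finset.range (2 * 4 ^ l), f (blockMatrix l i j) =
        if 4 ^ l ≤ i then f ((4 : ℝ) ^ l)⁻¹ else 0 := by
    intro i hi
    rw [Finset.sum_eq_single i (fun j _ hj => by
      rw [blockMatrix, if_neg (fun h => hj h.1.symm), hf]) (fun h => absurd hi h), blockMatrix]
    by_cases h : 4 ^ l ≤ i <;> simp [h, hf]
  rw [Finset.sum_congr rfl h1, two_mul, Finset.sum_range_add,
    Finset.sum_eq_zero fun i hi => if_neg (not_le.2 (Finset.mem_range.1 hi))]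
  simp

lemma sum_abs_blockMatrix (l : ℕ) :
    ∑ i ∈ Finset.range (2 * 4 ^ l), ∑ j ∈ Finset.range (2 * 4 ^ l), |blockMatrix l i j| = 1 := by
  rw [sum_blockMatrix_row l (fun t => |t|) abs_zero, abs_of_nonneg (by positivity)]
  exact mul_inv_cancel₀ (by positivity)

lemma integral_abs_blockFun_le (l : ℕ) : ∫ z, |blockFun l z| ≤ (1 / 2) ^ l := by
  refine integral_abs_gridFun_le _ _ (by positivity) ?_
  rw [sum_blockMatrix_row l (fun t => t ^ 2) (by norm_num), ← pow_mul, mul_comm l 2, pow_mul]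
  have h4 : (4 : ℝ) ^ l ≠ 0 := by positivity
  rw [sq, mul_inv_cancel_left₀ h4, ← inv_pow]
  norm_num

lemma integrable_blockFun (l : ℕ) : Integrable (blockFun l) :=
  memLp_one_iff_integrable.1 (memLp_gridFun _ _ 1)

lemma measurable_blockFun (l : ℕ) : Measurable (blockFun l) := measurable_gridFun _ _

lemma summable_integral_abs_blockFun : Summable fun l => ∫ z, |blockFun l z| :=
  Summable.of_nonneg_of_le (fun _ => integral_nonneg fun _ => abs_nonneg _)
    integral_abs_blockFun_le (summable_geometric_of_lt_one (by norm_num) (by norm_num))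

lemma lintegral_enorm_blockFun (l : ℕ) :
    ∫⁻ z, ‖blockFun l z‖ₑ = ENNReal.ofReal (∫ z, |blockFun l z|) := by
  rw [ofReal_integral_eq_lintegral_ofReal (integrable_blockFun l).abs
    (.of_forall fun _ => abs_nonneg _)]
  simp_rw [Real.enorm_eq_ofReal_abs]

lemma tsum_lintegral_blockFun_lt_top : ∑' l, ∫⁻ z, ‖blockFun l z‖ₑ < ∞ := by
  simp_rw [lintegral_enorm_blockFun]
  rw [← ENNReal.ofReal_tsum_of_nonneg (fun _ => integral_nonneg fun _ => abs_nonneg _)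
    summable_integral_abs_blockFun]
  exact ENNReal.ofReal_lt_top

lemma integrable_nonFactorizable : Integrable nonFactorizable := by
  refine ⟨(Measurable.tsum measurable_blockFun).aestronglyMeasurable, ?_⟩
  refine lt_of_le_of_lt (lintegral_mono fun z => enorm_tsum_le_tsum_enorm) ?_
  rw [lintegral_tsum fun l => (measurable_blockFun l).enorm.aemeasurable]
  exact tsum_lintegral_blockFun_lt_top

/-- Integration of the series against bounded functions. -/
lemma hasSum_integral_blockFun_mul {k : ℝ × ℝ → ℝ} (hk : Measurable k) {c : ℝ}
    (hc : ∀ z, |k z| ≤ c) :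
    HasSum (fun l => ∫ z, blockFun l z * k z) (∫ z, nonFactorizable z * k z) := by
  simp_rw [nonFactorizable, ← tsum_mul_right]
  have hint : ∀ l, Integrable (fun z => blockFun l z * k z) := fun l =>
    (integrable_blockFun l).mul_bdd hk.aestronglyMeasurable (.of_forall hc)
  refine hasSum_integral_of_summable_integral_norm hint ?_
  refine Summable.of_nonneg_of_le (fun l => integral_nonneg fun z => norm_nonneg _) (fun l => ?_)
    (summable_integral_abs_blockFun.mul_right c)
  rw [← integral_mul_const]
  refine integral_mono (hint l).norm ((integrable_blockFun l).abs.mul_const c) fun z => ?_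
  simp only [norm_mul, Real.norm_eq_abs]
  exact mul_le_mul_of_nonneg_left (hc z) (abs_nonneg _)

lemma hasSum_haarCoeff_blockFun (R : DyadicRectangle) :
    HasSum (fun l => haarCoeff (blockFun l) R) (haarCoeff nonFactorizable R) :=
  hasSum_integral_blockFun_mul R.measurable_haar R.abs_haar_le

lemma hasSum_setAverage_blockFun (R : DyadicRectangle) :
    HasSum (fun l => ⨍ z in R.toSet, blockFun l z) (⨍ z in R.toSet, nonFactorizable z) := by
  have hm := R.measurableSet_toSet
  have h := hasSum_integral_blockFun_mul (k := R.toSet.indicator 1) (measurable_one.indicator hm)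
    (c := 1) fun z => by
      by_cases hz : z ∈ R.toSet <;> simp [hz]
  have e : ∀ f : ℝ × ℝ → ℝ, ∫ z, f z * R.toSet.indicator 1 z = ∫ z in R.toSet, f z := by
    intro f
    rw [← integral_indicator hm]
    congr 1; ext z
    by_cases hz : z ∈ R.toSet <;> simp [hz]
  simp_rw [e] at h
  simp_rw [setAverage_eq, smul_eq_mul]
  exact h.mul_left _

/-- The block is diagonal, so its truncation depends only on the smaller generation `m` of `R`. For
`m ≥ 2 · 4^l` the whole block remains, for `m ≤ 4^l` nothing does. In between, the pointwise bound
applies, since the entries sum to one. -/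
lemma abs_setAverage_blockFun_le {R : DyadicRectangle} {z : ℝ × ℝ} (hz : z ∈ R.toSet) (l : ℕ) :
    ‖⨍ w in R.toSet, blockFun l w‖ₑ ≤ ‖blockFun l z‖ₑ +
      if (4 : ℤ) ^ l < min R.1.gen R.2.gen ∧ min R.1.gen R.2.gen < 2 * (4 : ℤ) ^ l then
        ENNReal.ofReal (unitSquareChar z) else 0 := by
  set m := min R.1.gen R.2.gen with hm
  rw [blockFun, setAverage_gridFun _ _ hz]
  have hdiag : ∀ i j, truncateAt R (blockMatrix l) i j =
      if (i : ℤ) < m then blockMatrix l i j else 0 := by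
    intro i j
    rw [truncateAt]
    by_cases hij : i = j
    · subst hij
      simp only [hm, lt_min_iff]
    · have : blockMatrix l i j = 0 := if_neg fun h => hij h.1
      simp [this]
  by_cases h1 : 2 * (4 : ℤ) ^ l ≤ m
  · refine le_add_right (le_of_eq ?_)
    rw [gridFun_congr fun i hi j hj => ?_]
    rw [hdiag, if_pos]
    have : (i : ℤ) < 2 * 4 ^ l := by exact_mod_cast hi
    omega
  by_cases h2 : m ≤ (4 : ℤ) ^ l
  · have : gridFun (2 * 4 ^ l) (truncateAt R (blockMatrix l)) z = 0 := by
      rw [gridFun_congr (B := fun _ _ => 0)]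
      · simp [gridFun, gridCoeff]
      · intro i _ j _
        rw [hdiag]
        split_ifs with h
        · refine if_neg fun h' => ?_
          have : (4 : ℤ) ^ l ≤ i := by exact_mod_cast h'.2
          omega
        · rfl
    rw [this, enorm_zero]
    exact zero_le
  · rw [if_pos ⟨by omega, by omega⟩]
    refine le_add_left ?_
    rw [Real.enorm_eq_ofReal_abs]
    refine ENNReal.ofReal_le_ofReal ((abs_gridFun_le _ _ z).trans ?_)
    refine mul_le_of_le_one_left (unitSquareChar_nonneg z) ?_
    rw [← sum_abs_blockMatrix l]
    refine Finset.sum_le_sum fun i _ => Finset.sum_le_sum fun j _ => ?_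
    rw [hdiag]
    split_ifs
    · rfl
    · rw [abs_zero]; exact abs_nonneg _

lemma tsum_ite_le_of_unique {P : ℕ → Prop} [DecidablePred P] (hP : ∀ k l, P k → P l → k = l)
    (c : ℝ≥0∞) : ∑' l, (if P l then c else 0) ≤ c := by
  by_cases h : ∃ k, P k
  · obtain ⟨k, hk⟩ := h
    rw [tsum_eq_single k fun l hl => if_neg fun h => hl (hP l k h hk), if_pos hk]
  · push Not at h
    simp [h]

/-- The ranges `4^l < m < 2 · 4^l` are disjoint for different `l`, so each rectangle cuts at most
one block and the error is a single copy of the unit square. -/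
lemma strongMaximal_nonFactorizable_le (z : ℝ × ℝ) :
    strongMaximal nonFactorizable z ≤
      ∑' l, ‖blockFun l z‖ₑ + ENNReal.ofReal (unitSquareChar z) := by
  refine iSup₂_le fun R hz => ?_
  rw [← (hasSum_setAverage_blockFun R).tsum_eq]
  refine enorm_tsum_le_tsum_enorm.trans
    ((ENNReal.tsum_le_tsum (abs_setAverage_blockFun_le hz)).trans ?_)
  rw [ENNReal.tsum_add]
  refine add_le_add le_rfl (tsum_ite_le_of_unique (fun k l hk hl => ?_) _)
  have key : ∀ k l : ℕ, k < l → 2 * (4 : ℤ) ^ k ≤ 4 ^ l := by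
    intro k l h
    calc 2 * (4 : ℤ) ^ k ≤ 4 ^ (k + 1) := by rw [pow_succ]; linarith [pow_pos (four_pos (α := ℤ)) k]
      _ ≤ 4 ^ l := pow_le_pow_right₀ (by norm_num) h
  rcases lt_trichotomy k l with h | h | h
  · have := key k l h; omega
  · exact h
  · have := key l k h; omega

lemma memProdH1_nonFactorizable : MemProdH1 nonFactorizable := by
  refine ⟨integrable_nonFactorizable, ?_⟩
  refine lt_of_le_of_lt (lintegral_mono strongMaximal_nonFactorizable_le) ?_
  have hm : Measurable fun z => ∑' l, ‖blockFun l z‖ₑ :=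
    Measurable.tsum fun l => (measurable_blockFun l).enorm
  rw [lintegral_add_left hm, lintegral_tsum fun l => (measurable_blockFun l).enorm.aemeasurable,
    ← ofReal_integral_eq_lintegral_ofReal integrable_unitSquareChar
      (.of_forall unitSquareChar_nonneg)]
  exact ENNReal.add_lt_top.2 ⟨tsum_lintegral_blockFun_lt_top, ENNReal.ofReal_lt_top⟩

/-! ### Pairing with identity matrices and failure of the `π³` factorization. -/

lemma extendMatrix_one {n i j : ℕ} (hi : i < n) (hj : j < n) :
    extendMatrix (1 : Matrix (Fin n) (Fin n) ℝ) i j = if i = j then 1 else 0 := by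
  rw [extendMatrix, dif_pos ⟨hi, hj⟩, Matrix.one_apply]
  simp [Fin.ext_iff]

/-- The pairings with the functions of identity matrices are unbounded. -/
lemma le_sum_haarCoeff_nonFactorizable (L : ℕ) :
    (L : ℝ) ≤ ∑ R ∈ unitRectangles (2 * 4 ^ L), haarCoeff nonFactorizable R *
      haarCoeff (exampleFun (1 : Matrix (Fin (2 * 4 ^ L)) (Fin (2 * 4 ^ L)) ℝ)) R := by
  set N := 2 * 4 ^ L
  have hcoef : ∀ R ∈ unitRectangles N,
      haarCoeff (exampleFun (1 : Matrix (Fin N) (Fin N) ℝ)) R =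
        gridCoeff (fun i j => if i = j then 1 else 0) R := by
    intro R hR
    rw [exampleFun_eq_gridFun, haarCoeff_gridFun, if_pos hR, gridCoeff, gridCoeff,
      extendMatrix_one (toNat_gen_of_mem (Finset.mem_product.1 hR).1).2
        (toNat_gen_of_mem (Finset.mem_product.1 hR).2).2]
  rw [Finset.sum_congr rfl fun R hR => by rw [hcoef R hR]]
  have hs : HasSum (fun l => ∑ R ∈ unitRectangles N, haarCoeff (blockFun l) R *
      gridCoeff (fun i j => if i = j then 1 else 0) R) (∑ R ∈ unitRectangles N,
      haarCoeff nonFactorizable R * gridCoeff (fun i j => if i = j then 1 else 0) R) :=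
    hasSum_sum fun R _ => (hasSum_haarCoeff_blockFun R).mul_right _
  have nn : ∀ l, 0 ≤ ∑ R ∈ unitRectangles N, haarCoeff (blockFun l) R *
      gridCoeff (fun i j => if i = j then 1 else 0) R := by
    intro l
    refine Finset.sum_nonneg fun R _ => mul_nonneg ?_ ?_
    · rw [blockFun, haarCoeff_gridFun]
      split_ifs
      · exact mul_nonneg (blockMatrix_nonneg _ _ _) (Real.sqrt_nonneg _)
      · exact le_rfl
    · refine mul_nonneg ?_ (Real.sqrt_nonneg _)
      simp only; split_ifs <;> norm_num
  -- A block with `l < L` lies within the first `N` generations, and its pairing with the identity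
  -- is its trace.
  have one : ∀ l ∈ Finset.range L, ∑ R ∈ unitRectangles N, haarCoeff (blockFun l) R *
      gridCoeff (fun i j => if i = j then 1 else 0) R = 1 := by
    intro l hl
    have hle : 2 * 4 ^ l ≤ N :=
      Nat.mul_le_mul_left 2 (Nat.pow_le_pow_right (by norm_num) (Finset.mem_range.1 hl).le)
    have hsubI : unitIntervals (2 * 4 ^ l) ⊆ unitIntervals N := by
      intro I hI
      obtain ⟨i, hi, a, ha, rfl⟩ := mem_unitIntervals.1 hI
      exact mem_unitIntervals.2 ⟨i, hi.trans_le hle, a, ha, rfl⟩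
    have hsub : unitRectangles (2 * 4 ^ l) ⊆ unitRectangles N :=
      Finset.product_subset_product hsubI hsubI
    rw [← Finset.sum_subset hsub fun R _ hR => by
      rw [blockFun, haarCoeff_gridFun, if_neg hR, zero_mul],
      Finset.sum_congr rfl fun R hR => by rw [blockFun, haarCoeff_gridFun, if_pos hR],
      sum_gridCoeff_mul]
    refine Eq.trans ?_ (sum_abs_blockMatrix l)
    refine Finset.sum_congr rfl fun i _ => Finset.sum_congr rfl fun j _ => ?_
    rw [abs_of_nonneg (blockMatrix_nonneg _ _ _), blockMatrix]
    by_cases hij : i = j <;> simp [hij]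
  calc (L : ℝ) = ∑ l ∈ Finset.range L, 1 := by simp
    _ = _ := (Finset.sum_congr rfl one).symm
    _ ≤ _ := sum_le_hasSum _ (fun l _ => nn l) hs

lemma ae_l2OpNorm_haarMatrix_one_le {n : ℕ} (hn : 1 ≤ n) :
    ∀ᵐ z, l2OpNorm (haarMatrix (exampleFun (1 : Matrix (Fin n) (Fin n) ℝ)) z) ≤ 1 :=
  .of_forall fun z => by
    simpa using l2OpNorm_haarMatrix_exampleFun_le hn zero_le_one sum_sq_one_mulVec z

/-- The test functions have finitely many coefficients, so convergence of each coefficient suffices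
to pair the series term by term. This bounds all pairings by `C ∑ c_i`, while they exceed every `L`.
-/
theorem not_hasPi3Factorization_nonFactorizable {p : ℝ≥0∞} (hp : 1 < p) (hp' : p < ∞) :
    ¬ HasPi3Factorization p nonFactorizable := by
  rintro ⟨c, f, f', hc, hcs, hf, hf', hsum⟩
  obtain ⟨C, hC⟩ := exists_pi3_pairing_le hp hp'
  obtain ⟨L, hL⟩ := exists_nat_gt ((∑' i, c i) * C)
  set N := 2 * 4 ^ L with hN
  have hN1 : 1 ≤ N := by have : 0 < 4 ^ L := by positivity
                         omega
  set g := exampleFun (1 : Matrix (Fin N) (Fin N) ℝ) with hg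
  have h1 : HasSum (fun i => ∑ R ∈ unitRectangles N,
      c i * pi3Coeff (f' i) (f i) R * haarCoeff g R)
      (∑ R ∈ unitRectangles N, haarCoeff nonFactorizable R * haarCoeff g R) :=
    hasSum_sum fun R _ => (hsum R).mul_right _
  have h2 : ∀ i, ∑ R ∈ unitRectangles N, c i * pi3Coeff (f' i) (f i) R * haarCoeff g R ≤
      c i * C := by
    intro i
    have := hC g 1 (ae_l2OpNorm_haarMatrix_one_le hN1) (unitIntervals N) (f i) (f' i) (hf i) (hf' i)
    rw [mul_one, enorm_le_coe, ← NNReal.coe_le_coe, coe_nnnorm, Real.norm_eq_abs] at this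
    simp_rw [mul_assoc, ← Finset.mul_sum]
    exact mul_le_mul_of_nonneg_left ((le_abs_self _).trans this) (hc i)
  have h3 := hasSum_le h2 h1 (hcs.hasSum.mul_right (C : ℝ))
  have h4 := le_sum_haarCoeff_nonFactorizable L
  linarith

/-! ### Failure of the `L²` tensor form. -/

lemma eLpNorm_two_sq {α : Type*} [MeasurableSpace α] {μ : Measure α} (f : α → ℝ) :
    eLpNorm f 2 μ ^ 2 = ∫⁻ x, ENNReal.ofReal (f x ^ 2) ∂μ := by
  rw [eLpNorm_eq_lintegral_rpow_enorm_toReal two_ne_zero ENNReal.ofNat_ne_top,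
    ← ENNReal.rpow_natCast, ← ENNReal.rpow_mul]
  simp only [ENNReal.toReal_ofNat, Nat.cast_ofNat]
  rw [one_div, inv_mul_cancel₀ two_ne_zero, ENNReal.rpow_one]
  refine lintegral_congr fun x => ?_
  rw [Real.enorm_eq_ofReal_abs, ENNReal.ofReal_rpow_of_nonneg (abs_nonneg _) zero_le_two,
    Real.rpow_ofNat, sq_abs]

lemma rowNorm_two {F : Finset DyadicInterval} {φ : DyadicInterval → ℝ → ℝ}
    (hφ : ∀ J, AEMeasurable (φ J)) :
    rowNorm 2 F φ = (∑ J ∈ F, ∫⁻ x, ENNReal.ofReal (φ J x ^ 2)) ^ (1 / 2 : ℝ) := by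
  rw [rowNorm]
  congr 1
  have hterm : ∀ (J : DyadicInterval) (z : ℝ × ℝ),
      ENNReal.ofReal (φ J z.1 ^ 2 / J.len * J.char z.2) =
        ENNReal.ofReal (φ J z.1 ^ 2) * ENNReal.ofReal (J.char z.2 / J.len) := by
    intro J z
    rw [← ENNReal.ofReal_mul (sq_nonneg _)]
    congr 1; ring
  have m1 : ∀ J, AEMeasurable fun x => ENNReal.ofReal (φ J x ^ 2) := fun J =>
    ((hφ J).pow_const 2).ennreal_ofReal
  have m2 : ∀ J : DyadicInterval, AEMeasurable fun y => ENNReal.ofReal (J.char y / J.len) :=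
    fun J => (J.measurable_char.div_const _).ennreal_ofReal.aemeasurable
  simp only [div_self (two_ne_zero' ℝ), ENNReal.rpow_one, rowSquare]
  rw [lintegral_finsetSum' _ fun J _ => by
    simp_rw [hterm]
    exact ((m1 J).comp_quasiMeasurePreserving Measure.quasiMeasurePreserving_fst).mul
      ((m2 J).comp_quasiMeasurePreserving Measure.quasiMeasurePreserving_snd)]
  refine Finset.sum_congr rfl fun J _ => ?_
  simp_rw [hterm]
  rw [Measure.volume_eq_prod, lintegral_prod_mul (m1 J) (m2 J),
    ← ofReal_integral_eq_lintegral_ofReal (J.integrable_char.div_const _)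
      (.of_forall fun y => div_nonneg (J.char_nonneg y) J.len_pos.le),
    integral_div, integral_char, div_self J.len_ne_zero, ENNReal.ofReal_one, mul_one]

/-- The coefficients are products of averages of `u_J` over `I` and of `v_I` over `J`, so the
bilinear estimate with `p = 2` applies directly, without square function bounds. -/
theorem not_hasL2TensorForm_nonFactorizable : ¬ HasL2TensorForm nonFactorizable := by
  rintro ⟨u, v, hu, hv, hfin, hcoef⟩
  set K := ∑' R : DyadicRectangle,
      eLpNorm (fun z : ℝ × ℝ => u R.2 z.1 * v R.1 z.2) 2 volume ^ 2 with hK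
  have hprod : ∀ R : DyadicRectangle,
      eLpNorm (fun z : ℝ × ℝ => u R.2 z.1 * v R.1 z.2) 2 volume ^ 2 =
        (∫⁻ x, ENNReal.ofReal (u R.2 x ^ 2)) * ∫⁻ y, ENNReal.ofReal (v R.1 y ^ 2) := by
    intro R
    rw [eLpNorm_two_sq]
    simp_rw [mul_pow, ENNReal.ofReal_mul (sq_nonneg _)]
    rw [Measure.volume_eq_prod]
    exact lintegral_prod_mul (((hu R.2).1.aemeasurable.pow_const 2).ennreal_ofReal)
      (((hv R.1).1.aemeasurable.pow_const 2).ennreal_ofReal)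
  have hloc : ∀ {f : ℝ → ℝ}, MemLp f 2 volume → ∀ I : DyadicInterval, IntegrableOn f I.toSet := by
    intro f hf I
    have : IsFiniteMeasure (volume.restrict I.toSet) := ⟨by
      rw [Measure.restrict_apply_univ, volume_toSet]; exact ENNReal.ofReal_lt_top⟩
    exact (hf.restrict I.toSet).integrable (by norm_num)
  have bound : ∀ L : ℕ, ENNReal.ofReal L ≤ K ^ (1 / 2 : ℝ) := by
    intro L
    set N := 2 * 4 ^ L with hN
    have hN1 : 1 ≤ N := by have : 0 < 4 ^ L := by positivity
                           omega
    have h := enorm_sum_avg_le Real.HolderConjugate.two_two (φ := u) (ψ := v)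
      (fun J => (hu J).1.aemeasurable) (fun I => (hv I).1.aemeasurable)
      (fun I J => hloc (hu J) I) (fun I J => hloc (hv I) J)
      (exampleFun (1 : Matrix (Fin N) (Fin N) ℝ)) (ae_l2OpNorm_haarMatrix_one_le hN1)
      (unitIntervals N) (unitIntervals N)
    rw [one_mul, rowNorm_two fun J => (hu J).1.aemeasurable,
      rowNorm_two fun I => (hv I).1.aemeasurable,
      ← ENNReal.mul_rpow_of_nonneg _ _ (by norm_num)] at h
    refine le_trans (ENNReal.ofReal_le_ofReal ((le_sum_haarCoeff_nonFactorizable L).trans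
      (le_abs_self _))) ?_
    rw [← Real.enorm_eq_ofReal_abs, Finset.sum_product]
    simp_rw [hcoef, setAverage_mul]
    refine h.trans (ENNReal.rpow_le_rpow ?_ (by norm_num))
    -- The product of the two row norms squared expands into a partial sum of `K`.
    rw [Finset.sum_mul_sum, Finset.sum_comm, ← Finset.sum_product', hK]
    simp_rw [hprod]
    exact ENNReal.sum_le_tsum (f := fun R : DyadicRectangle =>
      (∫⁻ x, ENNReal.ofReal (u R.2 x ^ 2)) * ∫⁻ y, ENNReal.ofReal (v R.1 y ^ 2)) _
  have hKf : K ^ (1 / 2 : ℝ) ≠ ∞ := (ENNReal.rpow_lt_top_of_nonneg (by norm_num) hfin.ne).ne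
  obtain ⟨L, hL⟩ := ENNReal.exists_nat_gt hKf
  have := bound L
  rw [ENNReal.ofReal_natCast] at this
  exact absurd this (not_le.2 hL)

/-! ### The main theorem -/

lemma exists_pi4Norm_exampleFun_le {p : ℝ≥0∞} (hp : 1 < p) (hp' : p < ∞) : ∃ C : ℝ≥0,
    ∀ n : ℕ, 1 ≤ n → ∀ H : Matrix (Fin n) (Fin n) ℝ, IsHadamardMatrix H →
      pi4Norm p (exampleFun H) ≤ C * ENNReal.ofReal (Real.sqrt n) ∧
      pi3DualNorm p (exampleFun H) ≤ C * ENNReal.ofReal (Real.sqrt n) := by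
  obtain ⟨A, hA⟩ := exists_pi4Norm_le hp hp'
  obtain ⟨B, hB⟩ := exists_pi3DualNorm_le hp hp'
  refine ⟨max A B, fun n hn H hH => ?_⟩
  have hfin : FiniteHaarSupport (exampleFun H) := by
    rw [exampleFun_eq_gridFun]; exact finiteHaarSupport_gridFun _ _
  have hM : ∀ᵐ z, l2OpNorm (haarMatrix (exampleFun H) z) ≤ ENNReal.ofReal (Real.sqrt n) :=
    .of_forall (l2OpNorm_haarMatrix_exampleFun_le hn n.cast_nonneg (hH.sum_sq hn))
  constructor
  · refine (hA _ hfin _ hM).trans (mul_le_mul_left ?_ _)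
    exact_mod_cast le_max_left A B
  · refine (hB _ hfin _ hM).trans (mul_le_mul_left ?_ _)
    exact_mod_cast le_max_right A B

lemma haarCoeff_exampleFun_one_nonneg (n : ℕ) (R : DyadicRectangle) :
    0 ≤ haarCoeff (exampleFun (1 : Matrix (Fin n) (Fin n) ℝ)) R := by
  rw [exampleFun_eq_gridFun, haarCoeff_gridFun]
  split_ifs with hR
  · rw [gridCoeff, extendMatrix_one (toNat_gen_of_mem (Finset.mem_product.1 hR).1).2
      (toNat_gen_of_mem (Finset.mem_product.1 hR).2).2]
    refine mul_nonneg ?_ (Real.sqrt_nonneg _)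
    split_ifs <;> norm_num
  · exact le_rfl

lemma exists_absPi4Norm_exampleFun_one_le {p : ℝ≥0∞} (hp : 1 < p) (hp' : p < ∞) : ∃ C : ℝ≥0,
    ∀ n : ℕ, 1 ≤ n → absPi4Norm p (exampleFun (1 : Matrix (Fin n) (Fin n) ℝ)) ≤ C := by
  obtain ⟨C, hC⟩ := exists_absPi4Norm_le hp hp'
  refine ⟨C, fun n hn => ?_⟩
  have hfin : FiniteHaarSupport (exampleFun (1 : Matrix (Fin n) (Fin n) ℝ)) := by
    rw [exampleFun_eq_gridFun]; exact finiteHaarSupport_gridFun _ _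
  simpa using hC _ hfin (haarCoeff_exampleFun_one_nonneg n) 1 (ae_l2OpNorm_haarMatrix_one_le hn)

lemma coe_lt_ofReal_sqrt {a : ℝ≥0} {n : ℕ} (h : (a : ℝ) ^ 2 < n) :
    (a : ℝ≥0∞) < ENNReal.ofReal (Real.sqrt n) := by
  rw [ENNReal.lt_ofReal_iff_toReal_lt ENNReal.coe_ne_top, ENNReal.coe_toReal]
  exact Real.lt_sqrt_of_sq_lt h

lemma coe_mul_ofReal_sqrt_lt {a : ℝ≥0} {n : ℕ} (h : (a : ℝ) ^ 2 < n) :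
    (a : ℝ≥0∞) * ENNReal.ofReal (Real.sqrt n) < n := by
  have hn : (0 : ℝ) < n := lt_of_le_of_lt (sq_nonneg _) h
  have e : (n : ℝ≥0∞) = ENNReal.ofReal (Real.sqrt n) * ENNReal.ofReal (Real.sqrt n) := by
    rw [← ENNReal.ofReal_mul (Real.sqrt_nonneg _), Real.mul_self_sqrt hn.le,
      ENNReal.ofReal_natCast]
  refine lt_of_lt_of_eq ?_ e.symm
  refine ENNReal.mul_lt_mul_left ?_ ENNReal.ofReal_ne_top (coe_lt_ofReal_sqrt h)
  simpa using hn

end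

theorem mainTheorem4 :
    -- the bound of the operator norm of `π⁴_g` by the matrix norms
    (∀ p : ℝ≥0∞, 1 < p → p < ∞ → ∃ C : ℝ≥0, ∀ g : ℝ × ℝ → ℝ, FiniteHaarSupport g →
      pi4Norm p g ≤ C * essSup (fun z => l2OpNorm (haarMatrix g z)) volume) ∧
    -- the example: every choice of signs has product BMO norm `n`, a Hadamard choice has matrix
    -- norm `√n` on the unit square and operator norm at most a constant times `√n`
    (∀ n : ℕ, 1 ≤ n → ∀ H : Matrix (Fin n) (Fin n) ℝ,
      FiniteHaarSupport (exampleFun H) ∧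
      (IsSignMatrix H → prodBMONorm (exampleFun H) = n) ∧
      (IsHadamardMatrix H → ∀ z ∈ Set.Ico (0 : ℝ) 1 ×ˢ Set.Ico (0 : ℝ) 1,
        l2OpNorm (haarMatrix (exampleFun H) z) = ENNReal.ofReal (Real.sqrt n))) ∧
    (∀ k : ℕ, IsHadamardMatrix (sylvesterMatrix k)) ∧
    (∀ p : ℝ≥0∞, 1 < p → p < ∞ → ∃ C : ℝ≥0, ∀ n : ℕ, 1 ≤ n →
      ∀ H : Matrix (Fin n) (Fin n) ℝ, IsHadamardMatrix H →
        pi4Norm p (exampleFun H) ≤ C * ENNReal.ofReal (Real.sqrt n)) ∧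
    -- the absolute-value variant, with the identity matrix
    (∀ n : ℕ, 1 ≤ n →
      ENNReal.ofReal (Real.sqrt n) ≤
        prodBMONorm (exampleFun (1 : Matrix (Fin n) (Fin n) ℝ)) ∧
      ∀ z ∈ Set.Ico (0 : ℝ) 1 ×ˢ Set.Ico (0 : ℝ) 1,
        l2OpNorm (haarMatrix (exampleFun (1 : Matrix (Fin n) (Fin n) ℝ)) z) = 1) ∧
    (∀ p : ℝ≥0∞, 1 < p → p < ∞ → ∃ C : ℝ≥0, ∀ n : ℕ, 1 ≤ n →
      absPi4Norm p (exampleFun (1 : Matrix (Fin n) (Fin n) ℝ)) ≤ C) ∧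
    -- none of the three quantities controls the product BMO norm
    (∀ p : ℝ≥0∞, 1 < p → p < ∞ → ∀ C : ℝ≥0,
      (∃ g : ℝ × ℝ → ℝ, FiniteHaarSupport g ∧ C * pi4Norm p g < prodBMONorm g) ∧
      (∃ g : ℝ × ℝ → ℝ, FiniteHaarSupport g ∧ C * absPi4Norm p g < prodBMONorm g) ∧
      (∃ g : ℝ × ℝ → ℝ, FiniteHaarSupport g ∧ C * pi3DualNorm p g < prodBMONorm g)) ∧
    -- weak factorization of `H¹_d(ℝ ⊗ ℝ)` through `π³` fails
    (∃ g' : ℝ × ℝ → ℝ, MemProdH1 g' ∧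
      (∀ p : ℝ≥0∞, 1 < p → p < ∞ → ¬ HasPi3Factorization p g') ∧
      ¬ HasL2TensorForm g') := by
  have fin : ∀ (n : ℕ) (H : Matrix (Fin n) (Fin n) ℝ), FiniteHaarSupport (exampleFun H) := by
    intro n H
    rw [exampleFun_eq_gridFun]; exact finiteHaarSupport_gridFun _ _
  refine ⟨?_, ?_, isHadamardMatrix_sylvesterMatrix, ?_, ?_, ?_, ?_, ?_⟩
  · intro p hp hp'
    obtain ⟨C, hC⟩ := exists_pi4Norm_le hp hp'
    exact ⟨C, fun g hg => hC g hg _ (ENNReal.ae_le_essSup _)⟩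
  · exact fun n hn H => ⟨fin n H, prodBMONorm_exampleFun_of_isSignMatrix, fun hH z hz =>
      l2OpNorm_haarMatrix_exampleFun hn n.cast_nonneg (hH.sum_sq hn) hz⟩
  · intro p hp hp'
    obtain ⟨C, hC⟩ := exists_pi4Norm_exampleFun_le hp hp'
    exact ⟨C, fun n hn H hH => (hC n hn H hH).1⟩
  · refine fun n hn => ⟨(prodBMONorm_exampleFun_one n).ge, fun z hz => ?_⟩
    simpa using l2OpNorm_haarMatrix_exampleFun hn zero_le_one sum_sq_one_mulVec hz
  · exact fun p hp hp' => exists_absPi4Norm_exampleFun_one_le hp hp'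
  · intro p hp hp' C
    obtain ⟨D, hD⟩ := exists_pi4Norm_exampleFun_le hp hp'
    obtain ⟨E, hE⟩ := exists_absPi4Norm_exampleFun_one_le hp hp'
    -- With `n = 2^k` this gives `C D √n < n`, the gap for Hadamard matrices; the choice of `m`
    -- gives `C E < √m`, the gap for the identity.
    obtain ⟨k, hk⟩ := pow_unbounded_of_one_lt (((C * D : ℝ≥0) : ℝ) ^ 2) one_lt_two
    obtain ⟨m, hm⟩ := exists_nat_gt (((C * E : ℝ≥0) : ℝ) ^ 2)
    have hm1 : 1 ≤ m := by
      have : (0 : ℝ) < m := lt_of_le_of_lt (sq_nonneg _) hm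
      exact_mod_cast this
    have hH := isHadamardMatrix_sylvesterMatrix k
    have hlt : (C : ℝ≥0∞) * (D * ENNReal.ofReal (Real.sqrt (2 ^ k : ℕ))) <
        prodBMONorm (exampleFun (sylvesterMatrix k)) := by
      rw [prodBMONorm_exampleFun_of_isSignMatrix hH.1, ← mul_assoc, ← ENNReal.coe_mul]
      exact coe_mul_ofReal_sqrt_lt (by exact_mod_cast hk)
    obtain ⟨h4, h3⟩ := hD (2 ^ k) Nat.one_le_two_pow _ hH
    refine ⟨⟨_, fin _ (sylvesterMatrix k), lt_of_le_of_lt (mul_le_mul_right h4 _) hlt⟩,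
      ⟨_, fin m 1, ?_⟩, ⟨_, fin _ (sylvesterMatrix k), lt_of_le_of_lt (mul_le_mul_right h3 _) hlt⟩⟩
    rw [prodBMONorm_exampleFun_one]
    refine lt_of_le_of_lt (mul_le_mul_right (hE m hm1) _) ?_
    rw [← ENNReal.coe_mul]
    exact coe_lt_ofReal_sqrt hm
  · exact ⟨nonFactorizable, memProdH1_nonFactorizable,
      fun p hp hp' => not_hasPi3Factorization_nonFactorizable hp hp',
      not_hasL2TensorForm_nonFactorizable⟩
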